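/- **Setting.** Let $p\ge 1$ and $q$ be coprime integers and $m\ge 2$. The grid torus of size $m$ for the lens space $L(p,q)$ is the plane modulo the lattice spanned by $(pm,0)$ and $(qm,m)$; the images of the lines $b\in\mathbb Z$ are the $m$ $\alpha$-curves, the images of the lines $a\in\mathbb Z$ are the $m$ $\beta$-curves, and the unit squares are the cells. A grid diagram $g$ is a set of marks $O_i$, $X$, $XX$ in distinct cells such that each row and each column contains either one $O$ and one $X$, or two $O$'s and one $XX$. The projection of its (possibly singular) link $L\subset L(p,q)$ consists of vertical arcs, running upwards from $X$ or $XX$ to $O$, and, below them, of horizontal arcs from $O$ to $X$ or $XX$, each in a chosen direction. A crossing is negative if its horizontal arc runs to the right and positive if it runs to the left. For a commutative ring $R$, $CFK^-(g)$ is the free module over $R[U_i]$ (one variable for each $O_i$) on the sets of intersection points with exactly one point on each $\alpha$- and each $\beta$-curve, with differential $\partial^-\mathbf x=\sum_{\mathbf y}\sum_r S(r)\prod_i U_i^{n_{O_i}(r)}\,\mathbf y$, where $r$ runs over the empty embedded rectangles from $\mathbf x$ to $\mathbf y$ (lower left and upper right corners in $\mathbf x$) without $X$ and $XX$. For $R=\mathbb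 Z/2$ the signs $S$ play no role. For $R=\mathbb Z$, $S$ is a sign assignment: a function from rectangles to $\{\pm1\}$ with $S(r_1)S(r_2)=-S(r_1')S(r_2')$ whenever $r_1*r_2=r_1'*r_2'$ are two decompositions of the same domain with different intermediate generators, and $S(r_1)S(r_2)=1$ (resp. $-1$) if $r_1*r_2$ is a horizontal (resp. vertical) annulus. $HFK^-(g)$ denotes the homology of $CFK^-(g)$. **Resolutions.** Let $c$ be a crossing of a grid diagram $g$ of size $m$ at which $g$ has the standard picture, as it does at every crossing of a special grid diagram with standard pictures: the cell directly below the crossing square, from which the vertical arc comes, and the cell next to the crossing square into which the horizontal arc runs, carry $X$'s. Let $g_r$ be obtained by moving these two $X$'s to the other two cells of the $2\times2$ block spanned by them and the crossing square. Let $g_s$, of size $m-1$, be obtained by merging the two rows and the two columns of the block and putting an $XX$ in the merged cell in place of the two $X$'s. Assume that $g_s$ is a grid diagram, i.e. no two marks fall into the same cell. Let $O_a\ne O_b$ be the $O$'s in the column, and $O_c\neq O_d$ the $O$'s in the row, of the new $XX$ in $g_s$, and assume $\{O_a,O_b\}\ne\{O_c,O_d\}$, i.e. $U_a+U_b-U_c-U_d\neq0$.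 **Theorem.** Let $R=\mathbb Z/2$, or let $R=\mathbb Z$ with a sign assignment $S$ on the grid of $g$. In the latter case use $S$ for $g_r$, which has the same grid, and the induced sign assignment for $g_s$: a rectangle of $g_s$ from $\mathbf x$ to $\mathbf y$ has the sign of the rectangle covering the same region of the grid of $g$, from $\mathbf x\cup\{P\}$ to $\mathbf y\cup\{P\}$, with $P$ the centre of the $2\times 2$ block; this is a sign assignment. Then $g_r$ is a grid diagram, the differentials of $CFK^-(g)$, $CFK^-(g_r)$ and $CFK^-(g_s)$ have square zero, and there are exact sequences of $R[U_i]$-modules: if $c$ is positive, $$\cdots\to HFK^-(g)\to H_*\Big(\frac{CFK^-(g_s)}{U_a+U_b-U_c-U_d}\Big)\to HFK^-(g_r)\to HFK^-(g)\to\cdots,$$ and if $c$ is negative, $$\cdots\to HFK^-(g)\to HFK^-(g_r)\to H_*\Big(\frac{CFK^-(g_s)}{U_a+U_b-U_c-U_d}\Big)\to HFK^-(g)\to\cdots.$$ Here $g$, $g_r$ and $g_s$ represent $L$, its smoothing $L_r$ and its singularization $L_s$ at $c$. -/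

import Mathlib

/-!
Grid diagrams of (possibly singular) links in the lens space `L(p,q)`, the unblocked grid complex,
sign assignments, and the resolutions of a crossing in standard position.
-/

noncomputable section

namespace LensGrid

open MvPolynomial

/-! ### The grid torus -/

/-- The lattice of the grid torus with `N` rows and `N` columns for `L(p,q)`. Coordinates: the
horizontal lines `b = const ∈ ℤ` are the lifts of the `α`-curves, the lines `a = const ∈ ℤ`
are the lifts of the (slanted) `β`-curves. Going once around a row is the translation by `(pN, 0)`;
crossing all `N` rows upwards returns to the same row, shifted by `qN` cells. -/
def lattice (N p : ℕ) (q : ℤ) : AddSubgroup (ℤ × ℤ) :=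
  AddSubgroup.closure {((p : ℤ) * N, 0), (q * N, (N : ℤ))}

/-- The integral points of the grid torus. A point stands both for an intersection point of an
`α`-curve with a `β`-curve and for the cell of which it is the lower left corner. -/
abbrev Torus (N p : ℕ) (q : ℤ) : Type := (ℤ × ℤ) ⧸ lattice N p q

/-- The class of `(a, b)` in the torus; also used as the translation by `a` steps to the right
and `b` steps up. -/
def pt {N p : ℕ} {q : ℤ} (a b : ℤ) : Torus N p q := QuotientAddGroup.mk (a, b)

theorem mem_lattice {N p : ℕ} {q : ℤ} {v : ℤ × ℤ} (hv : v ∈ lattice N p q) :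
    ∃ s t : ℤ, v.1 = (s * p + t * q) * N ∧ v.2 = t * N := by
  induction hv using AddSubgroup.closure_induction with
  | mem x hx =>
    rcases hx with rfl | rfl
    · exact ⟨1, 0, by simp, by simp⟩
    · exact ⟨0, 1, by simp, by simp⟩
  | zero => exact ⟨0, 0, by simp, by simp⟩
  | add x y _ _ hx hy =>
    obtain ⟨s, t, h1, h2⟩ := hx
    obtain ⟨s', t', h1', h2'⟩ := hy
    refine ⟨s + s', t + t', ?_, ?_⟩
    · rw [Prod.fst_add, h1, h1']; ring
    · rw [Prod.snd_add, h2, h2']; ring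
  | neg x _ hx =>
    obtain ⟨s, t, h1, h2⟩ := hx
    refine ⟨-s, -t, ?_, ?_⟩
    · rw [Prod.fst_neg, h1]; ring
    · rw [Prod.snd_neg, h2]; ring

theorem lattice_mem {N p : ℕ} {q : ℤ} (s t : ℤ) :
    ((s * p + t * q) * N, t * (N : ℤ)) ∈ lattice N p q := by
  have h1 : ((p : ℤ) * N, (0 : ℤ)) ∈ lattice N p q := AddSubgroup.subset_closure (by simp)
  have h2 : (q * N, (N : ℤ)) ∈ lattice N p q := AddSubgroup.subset_closure (by simp)
  have h := add_mem (zsmul_mem h1 s) (zsmul_mem h2 t)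
  convert h using 1
  ext
  · simp; ring
  · simp

/-- The row of a cell (the `α`-curve through a point). -/
def row {N p : ℕ} {q : ℤ} : Torus N p q →+ ZMod N :=
  QuotientAddGroup.lift (lattice N p q)
    ((Int.castAddHom (ZMod N)).comp (AddMonoidHom.snd ℤ ℤ)) (by
      intro v hv
      obtain ⟨s, t, -, h⟩ := mem_lattice hv
      simp [h])

/-- The column of a cell (the `β`-curve through a point). -/
def col {N p : ℕ} {q : ℤ} : Torus N p q →+ ZMod N :=
  QuotientAddGroup.lift (lattice N p q)
    ((Int.castAddHom (ZMod N)).comp (AddMonoidHom.fst ℤ ℤ)) (by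
      intro v hv
      obtain ⟨s, t, h, -⟩ := mem_lattice hv
      simp [h])

instance {N p : ℕ} {q : ℤ} [NeZero N] [NeZero p] : Finite (Torus N p q) := by
  have hN : (0 : ℤ) < N := by exact_mod_cast Nat.pos_of_ne_zero (NeZero.ne N)
  have hp : (0 : ℤ) < p := by exact_mod_cast Nat.pos_of_ne_zero (NeZero.ne p)
  have hpN : (0 : ℤ) < p * N := mul_pos hp hN
  let f : Fin (p * N) × Fin N → Torus N p q := fun u => pt (u.1 : ℕ) (u.2 : ℕ)
  refine Finite.of_surjective f ?_
  rintro ⟨a, b⟩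
  set t := b / (N : ℤ) with ht
  set a' := a - t * q * N with ha'
  set s := a' / ((p : ℤ) * N) with hs
  have hb0 := Int.emod_nonneg b hN.ne'
  have hb1 := Int.emod_lt_of_pos b hN
  have ha0 := Int.emod_nonneg a' hpN.ne'
  have ha1 := Int.emod_lt_of_pos a' hpN
  refine ⟨(⟨(a' % ((p : ℤ) * N)).toNat, ?_⟩, ⟨(b % (N : ℤ)).toNat, ?_⟩), ?_⟩
  · zify; rw [Int.toNat_of_nonneg ha0]; exact ha1
  · zify; rw [Int.toNat_of_nonneg hb0]; exact hb1
  · change QuotientAddGroup.mk _ = QuotientAddGroup.mk (a, b)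
    rw [QuotientAddGroup.eq]
    have h := lattice_mem (N := N) (p := p) (q := q) s t
    convert h using 1
    have e1 := Int.emod_add_mul_ediv a' ((p : ℤ) * N)
    have e2 := Int.emod_add_mul_ediv b (N : ℤ)
    ext
    · simp only [Prod.fst_add, Prod.fst_neg, Int.toNat_of_nonneg ha0]
      rw [← hs] at e1
      linarith
    · simp only [Prod.snd_add, Prod.snd_neg, Int.toNat_of_nonneg hb0]
      rw [← ht] at e2
      linarith

instance {N p : ℕ} {q : ℤ} [NeZero N] [NeZero p] : Fintype (Torus N p q) := Fintype.ofFinite _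

/-! ### Grid diagrams -/

/-- Markings of the grid torus: `O`-marks (labelled by `ι`), `X`-marks and `XX`-marks. -/
structure Markings (N p : ℕ) (q : ℤ) (ι : Type*) where
  O : ι → Torus N p q
  X : Set (Torus N p q)
  XX : Set (Torus N p q)

/-- Grid diagrams: every cell carries at most one mark, and every row and every column is either
regular (one `O` and one `X`) or singular (two `O`s and one `XX`). -/
structure Markings.IsGridDiagram {N p : ℕ} {q : ℤ} {ι : Type*} (g : Markings N p q ι) : Prop where
  O_injective : Function.Injective g.O
  O_notMem : ∀ i, g.O i ∉ g.X ∪ g.XX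
  disjoint : Disjoint g.X g.XX
  rows : ∀ r : ZMod N,
    ({i | row (g.O i) = r}.ncard = 1 ∧ {x ∈ g.X | row x = r}.ncard = 1 ∧
      {x ∈ g.XX | row x = r}.ncard = 0) ∨
    ({i | row (g.O i) = r}.ncard = 2 ∧ {x ∈ g.X | row x = r}.ncard = 0 ∧
      {x ∈ g.XX | row x = r}.ncard = 1)
  cols : ∀ c : ZMod N,
    ({i | col (g.O i) = c}.ncard = 1 ∧ {x ∈ g.X | col x = c}.ncard = 1 ∧
      {x ∈ g.XX | col x = c}.ncard = 0) ∨
    ({i | col (g.O i) = c}.ncard = 2 ∧ {x ∈ g.X | col x = c}.ncard = 0 ∧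
      {x ∈ g.XX | col x = c}.ncard = 1)

/-! ### The unblocked grid complex -/

/-- Generators: sets of intersection points with exactly one point on each `α`-curve and exactly
one point on each `β`-curve. -/
def State (N p : ℕ) (q : ℤ) : Type :=
  {x : Set (Torus N p q) //
    (∀ r : ZMod N, ∃! v, v ∈ x ∧ row v = r) ∧ (∀ c : ZMod N, ∃! v, v ∈ x ∧ col v = c)}

instance {N p : ℕ} {q : ℤ} [NeZero N] [NeZero p] : Finite (State N p q) := Subtype.finite

instance {N p : ℕ} {q : ℤ} [NeZero N] [NeZero p] : Fintype (State N p q) := Fintype.ofFinite _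

/-- A rectangle: lower left corner, width and height. The sides of an embedded rectangle have
fewer than `p * N` unit segments, the length of an `α`- or `β`-curve. -/
abbrev Rectangle (N p : ℕ) (q : ℤ) : Type := Torus N p q × Fin (p * N) × Fin (p * N)

namespace Rectangle

variable {N p : ℕ} {q : ℤ}

/-- The lower left corner. -/
def corner (r : Rectangle N p q) : Torus N p q := r.1

/-- The width. -/
def width (r : Rectangle N p q) : ℕ := r.2.1

/-- The height. -/
def height (r : Rectangle N p q) : ℕ := r.2.2

/-- The multiplicity of the rectangle, as a 2-chain, at a cell. -/
def mult (r : Rectangle N p q) (c : Torus N p q) : ℕ :=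
  {u : ℕ × ℕ | u.1 < r.width ∧ u.2 < r.height ∧ r.corner + pt u.1 u.2 = c}.ncard

/-- The closed rectangle is embedded in the torus. -/
def IsEmbedded (r : Rectangle N p q) : Prop :=
  Set.InjOn (fun u : ℕ × ℕ => r.corner + pt u.1 u.2) {u | u.1 ≤ r.width ∧ u.2 ≤ r.height}

/-- `r` is an embedded rectangle from `x` to `y`: the lower left and upper right corners belong
to `x`, and `y` is obtained from `x` by replacing them with the two other corners. -/
def IsFromTo (r : Rectangle N p q) (x y : State N p q) : Prop :=
  0 < r.width ∧ 0 < r.height ∧ r.IsEmbedded ∧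
  r.corner ∈ x.1 ∧ r.corner + pt r.width r.height ∈ x.1 ∧
  y.1 = (x.1 \ {r.corner, r.corner + pt r.width r.height}) ∪
    {r.corner + pt r.width 0, r.corner + pt 0 r.height}

/-- No point of `x` or `y` lies in the interior of `r`. -/
def IsEmpty (r : Rectangle N p q) (x y : State N p q) : Prop :=
  ∀ i j : ℕ, 0 < i → i < r.width → 0 < j → j < r.height →
    r.corner + pt i j ∉ x.1 ∧ r.corner + pt i j ∉ y.1

end Rectangle

/-- A choice of a sign for each rectangle from a generator to another one (only the values at
triples `x y r` with `r.IsFromTo x y` matter). -/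
abbrev Signs (N p : ℕ) (q : ℤ) : Type := State N p q → State N p q → Rectangle N p q → ℤˣ

/-- Sign assignments on the grid. -/
structure IsSignAssignment {N p : ℕ} {q : ℤ} (S : Signs N p q) : Prop where
  alternative : ∀ (x w y z : State N p q) (r₁ r₂ s₁ s₂ : Rectangle N p q),
    r₁.IsFromTo x w → r₂.IsFromTo w z → s₁.IsFromTo x y → s₂.IsFromTo y z → y ≠ w →
    (∀ c, r₁.mult c + r₂.mult c = s₁.mult c + s₂.mult c) →
    S x w r₁ * S w z r₂ = -(S x y s₁ * S y z s₂)
  horizontal : ∀ (x y : State N p q) (r₁ r₂ : Rectangle N p q),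
    r₁.IsFromTo x y → r₂.IsFromTo y x → r₂.corner = r₁.corner + pt r₁.width 0 →
    r₂.height = r₁.height → r₁.width + r₂.width = p * N → S x y r₁ * S y x r₂ = 1
  vertical : ∀ (x y : State N p q) (r₁ r₂ : Rectangle N p q),
    r₁.IsFromTo x y → r₂.IsFromTo y x → r₂.corner = r₁.corner + pt 0 r₁.height →
    r₂.width = r₁.width → r₁.height + r₂.height = p * N → S x y r₁ * S y x r₂ = -1

/-- The chain group `CFK⁻`: the free module on the generators over the polynomial ring with one
variable for each `O`-mark. -/
abbrev CFK (R : Type*) [CommRing R] (N p : ℕ) (q : ℤ) (ι : Type*) : Type _ :=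
  State N p q →₀ MvPolynomial ι R

open Classical in
/-- The differential `∂⁻` of `CFK⁻(g)` with signs `S`: it counts the empty rectangles which contain
no `X` and no `XX`, and records the `O`s in them. With `S = 1` this is the unsigned differential. -/
def boundary (R : Type*) [CommRing R] {N p : ℕ} [NeZero N] [NeZero p] {q : ℤ}
    {ι : Type*} [Fintype ι] (g : Markings N p q ι) (S : Signs N p q) :
    CFK R N p q ι →ₗ[MvPolynomial ι R] CFK R N p q ι :=
  Finsupp.linearCombination (MvPolynomial ι R) fun x =>
    ∑ y : State N p q, ∑ r : Rectangle N p q with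
      r.IsFromTo x y ∧ r.IsEmpty x y ∧ ∀ c ∈ g.X ∪ g.XX, r.mult c = 0,
      Finsupp.single y (C (((S x y r : ℤˣ) : ℤ) : R) * ∏ i, (X i : MvPolynomial ι R) ^ r.mult (g.O i))

/-! ### Homology, quotients, exact triangles -/

/-- The homology `ker d / im d` of a differential `d`. -/
abbrev Homology {A M : Type*} [CommRing A] [AddCommGroup M] [Module A M] (d : M →ₗ[A] M) : Type _ :=
  LinearMap.ker d ⧸ (LinearMap.range d).submoduleOf (LinearMap.ker d)

/-- The differential induced by `d` on the quotient `M / u M`. -/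
def quotientDifferential {A M : Type*} [CommRing A] [AddCommGroup M] [Module A M]
    (d : M →ₗ[A] M) (u : A) :
    (M ⧸ (Ideal.span {u} • (⊤ : Submodule A M))) →ₗ[A]
      (M ⧸ (Ideal.span {u} • (⊤ : Submodule A M))) :=
  Submodule.mapQ _ _ d (by
    rw [← Submodule.map_le_iff_le_comap, Submodule.map_smul'']
    exact smul_mono_right _ le_top)

/-- There is an exact sequence `⋯ → M₁ → M₂ → M₃ → M₁ → M₂ → ⋯` of `A`-modules. -/
def ExactTriangle (A M₁ M₂ M₃ : Type*) [CommRing A] [AddCommGroup M₁] [Module A M₁]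
    [AddCommGroup M₂] [Module A M₂] [AddCommGroup M₃] [Module A M₃] : Prop :=
  ∃ (f₁ : M₁ →ₗ[A] M₂) (f₂ : M₂ →ₗ[A] M₃) (f₃ : M₃ →ₗ[A] M₁),
    Function.Exact f₁ f₂ ∧ Function.Exact f₂ f₃ ∧ Function.Exact f₃ f₁

/-! ### Crossings -/

/-- The direction of a horizontal arc. -/
inductive Direction
  | left
  | right

/-- The horizontal step of a direction. -/
def Direction.step : Direction → ℤ
  | .left => -1
  | .right => 1

namespace Markings

variable {N p : ℕ} {q : ℤ} {ι : Type*}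

/-- The cell `z` lies in the interior of the vertical arc ending at `O i`; vertical arcs run
upwards, from the `X` or `XX` in the column of `O i` to `O i`. -/
def OnVerticalArc (g : Markings N p q ι) (i : ι) (z : Torus N p q) : Prop :=
  ∃ s ∈ g.X ∪ g.XX, ∃ m n : ℕ, 0 < m ∧ m < n ∧ n < p * N ∧
    g.O i = s + pt 0 n ∧ z = s + pt 0 m

/-- The cell `z` lies in the interior of the horizontal arc that runs from `O j` in the direction
`δ` to the `X` or `XX` in the row of `O j`. -/
def OnHorizontalArc (g : Markings N p q ι) (δ : Direction) (j : ι) (z : Torus N p q) : Prop :=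
  ∃ s ∈ g.X ∪ g.XX, ∃ m n : ℕ, 0 < m ∧ m < n ∧ n < p * N ∧
    s = g.O j + pt (δ.step * n) 0 ∧ z = g.O j + pt (δ.step * m) 0

/-- In the projection where the horizontal arc from `O j` runs in the direction `dir j`, the
vertical arc to `O i` passes over the horizontal arc from `O j` in the cell `z`. Since vertical
arcs run upwards and pass over, the crossing is positive if the horizontal arc runs to the left
and negative if it runs to the right. -/
def IsCrossing (g : Markings N p q ι) (dir : ι → Direction) (i j : ι) (z : Torus N p q) : Prop :=
  g.OnVerticalArc i z ∧ g.OnHorizontalArc (dir j) j z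

/-- The standard picture at a crossing in the cell `z` whose horizontal arc runs in the direction
`δ`: the cell just below `z`, from which the vertical arc comes, and the cell next to `z`, to which
the horizontal arc goes, carry an `X`. -/
def IsStandardAt (g : Markings N p q ι) (δ : Direction) (z : Torus N p q) : Prop :=
  z + pt 0 (-1) ∈ g.X ∧ z + pt δ.step 0 ∈ g.X

/-- The diagram of the smoothing: the two `X`s of the standard picture are moved to the two other
cells of the `2 × 2` block formed by the crossing square and these `X`s. -/
def smoothing (g : Markings N p q ι) (δ : Direction) (z : Torus N p q) : Markings N p q ι where
  O := g.O
  X := (g.X \ {z + pt 0 (-1), z + pt δ.step 0}) ∪ {z, z + pt δ.step (-1)}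
  XX := g.XX

end Markings

/-- The lower left cell of the `2 × 2` block of the standard picture. -/
def blockCorner {N p : ℕ} {q : ℤ} (δ : Direction) (z : Torus N p q) : Torus N p q :=
  match δ with
  | .left => z + pt (-1) (-1)
  | .right => z + pt 0 (-1)

/-- Merging columns `0` and `1` and rows `0` and `1` of the grid of size `N + 1`, on cells: one
`α`-curve and one `β`-curve are erased. Column `m` goes to column `⌊m N / (N + 1)⌋`, so
`0, 1, 2, …, N` go to `0, 0, 1, …, N - 1`. -/
def merge {N p : ℕ} {q : ℤ} : Torus (N + 1) p q → Torus N p q :=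
  Quotient.lift (fun v : ℤ × ℤ => pt (v.1 * N / (N + 1)) (v.2 * N / (N + 1))) (by
    intro v w h
    have h : -v + w ∈ lattice (N + 1) p q := QuotientAddGroup.leftRel_apply.mp h
    obtain ⟨s, t, h1, h2⟩ := mem_lattice h
    have hN : ((N : ℤ) + 1) ≠ 0 := by positivity
    have e1 : w.1 * N = v.1 * N + ((s * p + t * q) * N) * ((N : ℤ) + 1) := by
      simp only [Prod.fst_add, Prod.fst_neg] at h1
      push_cast at h1
      linear_combination (N : ℤ) * h1
    have e2 : w.2 * N = v.2 * N + (t * N) * ((N : ℤ) + 1) := by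
      simp only [Prod.snd_add, Prod.snd_neg] at h2
      push_cast at h2
      linear_combination (N : ℤ) * h2
    refine QuotientAddGroup.eq.mpr ?_
    rw [e1, e2, Int.add_mul_ediv_right _ _ hN, Int.add_mul_ediv_right _ _ hN]
    convert lattice_mem (N := N) (p := p) (q := q) s t using 1
    ext <;> simp)

/-- Merging on grid lines: the intersection points of the grid of size `N`, seen in the grid of size
`N + 1`. Line `k` of the small grid is line `⌈k (N + 1) / N⌉` of the large one, so
`0, 1, …, N - 1` are `0, 2, …, N`. -/
def unmerge {N p : ℕ} {q : ℤ} [NeZero N] : Torus N p q → Torus (N + 1) p q :=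
  Quotient.lift (fun v : ℤ × ℤ => pt (-(-(v.1 * (N + 1)) / N)) (-(-(v.2 * (N + 1)) / N))) (by
    intro v w h
    have h : -v + w ∈ lattice N p q := QuotientAddGroup.leftRel_apply.mp h
    obtain ⟨s, t, h1, h2⟩ := mem_lattice h
    have hN : (N : ℤ) ≠ 0 := by exact_mod_cast NeZero.ne N
    have e1 : -(w.1 * ((N : ℤ) + 1)) =
        -(v.1 * ((N : ℤ) + 1)) + (-((s * p + t * q) * ((N : ℤ) + 1))) * N := by
      simp only [Prod.fst_add, Prod.fst_neg] at h1
      linear_combination (-((N : ℤ) + 1)) * h1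
    have e2 : -(w.2 * ((N : ℤ) + 1)) = -(v.2 * ((N : ℤ) + 1)) + (-(t * ((N : ℤ) + 1))) * N := by
      simp only [Prod.snd_add, Prod.snd_neg] at h2
      linear_combination (-((N : ℤ) + 1)) * h2
    refine QuotientAddGroup.eq.mpr ?_
    rw [e1, e2, Int.add_mul_ediv_right _ _ hN, Int.add_mul_ediv_right _ _ hN]
    convert lattice_mem (N := N + 1) (p := p) (q := q) s t using 1
    ext <;> simp)

/-- The diagram of the singularization: the two rows and the two columns of the block are merged,
and the two `X`s of the standard picture are replaced by one `XX` in the merged cell, which becomes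
the cell `0`. -/
def Markings.singularization {N p : ℕ} {q : ℤ} {ι : Type*} (g : Markings (N + 1) p q ι)
    (δ : Direction) (z : Torus (N + 1) p q) : Markings N p q ι where
  O := fun i => merge (g.O i - blockCorner δ z)
  X := (fun x => merge (x - blockCorner δ z)) '' (g.X \ {z + pt 0 (-1), z + pt δ.step 0})
  XX := insert 0 ((fun x => merge (x - blockCorner δ z)) '' g.XX)

/-- The signs `Ss` on the small grid are induced by the signs `S` on the large one. A generator `x`
of the small grid is identified with the generator `x'` of the large grid that consists of the
points of `x` and the centre of the block, and a rectangle is identified with the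
rectangle that covers the same region of the torus. -/
def IsInduced {N p : ℕ} {q : ℤ} [NeZero N] (δ : Direction) (z : Torus (N + 1) p q)
    (S : Signs (N + 1) p q) (Ss : Signs N p q) : Prop :=
  ∀ (x y : State N p q) (x' y' : State (N + 1) p q)
    (r : Rectangle N p q) (r' : Rectangle (N + 1) p q),
    r.IsFromTo x y → r'.IsFromTo x' y' →
    x'.1 = insert (blockCorner δ z + pt 1 1) ((fun v => blockCorner δ z + unmerge v) '' x.1) →
    y'.1 = insert (blockCorner δ z + pt 1 1) ((fun v => blockCorner δ z + unmerge v) '' y.1) →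
    (∀ c, r'.mult c = r.mult (merge (c - blockCorner δ z))) →
    Ss x y r = S x' y' r'

/-! ### The skein exact sequence -/

/-- The skein exact sequence over the base ring `R`, for a diagram `g` with a crossing in the cell
`z` whose horizontal arc runs in the direction `δ` (`left`: positive crossing, `right`: negative
crossing), with signs `S` on the grid of `g` and of its smoothing and signs `Ss` on the grid of its
singularization. The first three clauses say that the homologies are those of chain complexes. -/
def SkeinExactSequence (R : Type*) [CommRing R] {N p : ℕ} [NeZero N] [NeZero p] {q : ℤ}
    {ι : Type*} [Fintype ι] (g : Markings (N + 1) p q ι) (δ : Direction) (z : Torus (N + 1) p q)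
    (S : Signs (N + 1) p q) (Ss : Signs N p q) (u : MvPolynomial ι R) : Prop :=
  boundary R g S ∘ₗ boundary R g S = 0 ∧
  boundary R (g.smoothing δ z) S ∘ₗ boundary R (g.smoothing δ z) S = 0 ∧
  boundary R (g.singularization δ z) Ss ∘ₗ boundary R (g.singularization δ z) Ss = 0 ∧
  (δ = .left → ExactTriangle (MvPolynomial ι R)
    (Homology (boundary R g S))
    (Homology (quotientDifferential (boundary R (g.singularization δ z) Ss) u))
    (Homology (boundary R (g.smoothing δ z) S))) ∧
  (δ = .right → ExactTriangle (MvPolynomial ι R)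
    (Homology (boundary R g S))
    (Homology (boundary R (g.smoothing δ z) S))
    (Homology (quotientDifferential (boundary R (g.singularization δ z) Ss) u)))

end LensGrid

end

/-!
The proof rests on one identity for the grid torus with arbitrary weights on the cells. If `D` is
the matrix which counts empty rectangles with signs and with the products of the weights of their
cells, then `D ^ 2` is scalar: the sum over all rows of the product of the weights in the row, minus
the same sum for columns (`sum_coeff_mul_coeff`). Two consecutive empty rectangles have another
decomposition with another intermediate generator, unless they form a horizontal or a vertical
annulus (`Frame.isExchange_exchange`). The two terms cancel by the sign rule. An annulus of empty
rectangles has width one, is determined by its row or column, and leads back to the generator at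
which it starts (`Frame.Annulus.eq`, `Frame.exists_annulus`, `Frame.Annulus.unique`). On the torus,
the pairs of rectangles that share two corners need care: they may form an annulus bounded by
staircases, which closes up only after a translation in both directions
(`Frame.Good.exchange_annulus_tall`). For the other pairs with a common corner there is only one
case up to symmetry (`Frame.Good.cut`). The symmetries of the square do not preserve the lattice of
the torus, so the argument is carried out for a group with two distinguished elements, a `Frame`.

Blocking a cell means giving it the weight `0`. If each row and each column contains an `X` or `XX`,
all of them blocked, the identity says that the differential has square zero.

Let `P` be the centre of the `2 × 2` block at the crossing, and let `A` and `B` be the free modules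
on the generators that contain `P` and on those that do not. The diagram `g` and its smoothing block
the two pairs of opposite cells of the block, and agree elsewhere. A rectangle from `A` to `B`
contains a cell of one of these pairs and none of the other, and the other way round for a rectangle
from `B` to `A`. Hence the two differentials are block triangular: they have the same diagonal
blocks, one has in addition a block `φ : A → B`, and the other one a block `ψ : B → A`. In other
words, they are the cones of `φ` and of `ψ`. If no cell of the block is blocked, the identity applied
to the entries in `A` gives `ψ φ = -u`, where `u = U_a + U_b - U_c - U_d`: the lines which are then
free are the two columns of the block, which contain `O_a` and `O_b`, and its two rows, which contain
`O_c` and `O_d`. Since `u` is regular, the octahedral axiom for `ψ φ` gives an exact triangle between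
the homologies of the cone of `φ`, of `A / u A` and of the cone of `ψ`
(`exactTriangle_of_factorization`, `exactTriangle_of_point`).

Finally, `A` is the complex of the singularization: its generators and rectangles are those of the
large grid that remain when the two lines through `P` are erased (`liftState`, `liftRect`,
`coeff_liftState`). For a positive crossing, `g` is the cone of `φ` and its smoothing is the cone of
`ψ`. For a negative crossing it is the other way round, and the triangle is rotated.
-/

noncomputable section

namespace LensGrid

/-! ### Frames and empty rectangles -/

/-- An abelian group with two unit steps `e₁` (to the right) and `e₂` (upwards), together with the
column and the row of each point modulo `M`. Besides the grid torus itself this covers its images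
under the symmetries of the square. -/
structure Frame (T : Type*) [AddCommGroup T] (M : ℕ) where
  e₁ : T
  e₂ : T
  col : T →+ ZMod M
  row : T →+ ZMod M
  col_e₁ : col e₁ = 1
  col_e₂ : col e₂ = 0
  row_e₁ : row e₁ = 0
  row_e₂ : row e₂ = 1

namespace Frame

variable {T : Type*} [AddCommGroup T] {M : ℕ} (F : Frame T M)

/-- The translation by `a` steps to the right and `b` steps up. -/
def tr (a b : ℤ) : T := a • F.e₁ + b • F.e₂

theorem col_tr (a b : ℤ) : F.col (F.tr a b) = a := by
  simp [tr, F.col_e₁, F.col_e₂]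

theorem row_tr (a b : ℤ) : F.row (F.tr a b) = b := by
  simp [tr, F.row_e₁, F.row_e₂]

theorem tr_zero : F.tr 0 0 = 0 := by simp [tr]

theorem tr_add (a b a' b' : ℤ) : F.tr a b + F.tr a' b' = F.tr (a + a') (b + b') := by
  simp only [tr]; module

/-- The reflection in the diagonal. -/
def transpose : Frame T M where
  e₁ := F.e₂
  e₂ := F.e₁
  col := F.row
  row := F.col
  col_e₁ := F.row_e₂
  col_e₂ := F.row_e₁
  row_e₁ := F.col_e₂
  row_e₂ := F.col_e₁

/-- The rotation by a half turn. -/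
def rotate : Frame T M where
  e₁ := -F.e₁
  e₂ := -F.e₂
  col := -F.col
  row := -F.row
  col_e₁ := by simp [F.col_e₁]
  col_e₂ := by simp [F.col_e₂]
  row_e₁ := by simp [F.row_e₁]
  row_e₂ := by simp [F.row_e₂]

/-- The reflection in a vertical line. -/
def reflect : Frame T M where
  e₁ := -F.e₁
  e₂ := F.e₂
  col := -F.col
  row := F.row
  col_e₁ := by simp [F.col_e₁]
  col_e₂ := by simp [F.col_e₂]
  row_e₁ := by simp [F.row_e₁]
  row_e₂ := by simp [F.row_e₂]

theorem transpose_tr (a b : ℤ) : F.transpose.tr a b = F.tr b a := by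
  simp only [tr, transpose]; module

theorem rotate_tr (a b : ℤ) : F.rotate.tr a b = F.tr (-a) (-b) := by
  simp only [tr, rotate]; module

theorem reflect_tr (a b : ℤ) : F.reflect.tr a b = F.tr (-a) b := by
  simp only [tr, reflect]; module

/-- At most one point in each row and each column. -/
structure Generic (x : Set T) : Prop where
  col_inj : ∀ u ∈ x, ∀ v ∈ x, F.col u = F.col v → u = v
  row_inj : ∀ u ∈ x, ∀ v ∈ x, F.row u = F.row v → u = v

/-- The rectangle with lower left corner `c`, width `w` and height `h` is an empty embedded
rectangle from `x` to `y`. Embeddedness is expressed by `sep`: no period of the torus moves the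
rectangle to an overlapping one. With it, only the points of `x` other than the corners have to be
kept off the interior. -/
structure Good (x y : Set T) (c : T) (w h : ℤ) : Prop where
  w_pos : 0 < w
  h_pos : 0 < h
  ll : c ∈ x
  ur : c + F.tr w h ∈ x
  w_ne : (w : ZMod M) ≠ 0
  h_ne : (h : ZMod M) ≠ 0
  mem : ∀ v, v ∈ y ↔ (v ∈ x ∧ v ≠ c ∧ v ≠ c + F.tr w h) ∨ v = c + F.tr w 0 ∨ v = c + F.tr 0 h
  sep : ∀ a b : ℤ, |a| < w → |b| < h → F.tr a b = 0 → a = 0 ∧ b = 0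
  off : ∀ v ∈ x, v ≠ c → v ≠ c + F.tr w h →
    ∀ i j : ℤ, 0 < i → i < w → 0 < j → j < h → v ≠ c + F.tr i j

variable {F} {x y z : Set T} {c c' : T} {w h w' h' : ℤ}

theorem col_ne_of {u v : T} (h : F.col u ≠ F.col v) : u ≠ v := fun e => h (by rw [e])

theorem Generic.transpose (hx : F.Generic x) : F.transpose.Generic x := ⟨hx.2, hx.1⟩

theorem Generic.rotate (hx : F.Generic x) : F.rotate.Generic x :=
  ⟨fun u hu v hv e => hx.1 u hu v hv (neg_injective e),
    fun u hu v hv e => hx.2 u hu v hv (neg_injective e)⟩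

theorem Generic.reflect (hx : F.Generic x) : F.reflect.Generic x :=
  ⟨fun u hu v hv e => hx.1 u hu v hv (neg_injective e), hx.2⟩

namespace Good

theorem lr_notMem (H : F.Good x y c w h) (hx : F.Generic x) : c + F.tr w 0 ∉ x := by
  intro hm
  have := hx.1 _ hm _ H.ur (by simp [col_tr])
  have := congrArg F.row this
  simp [row_tr] at this
  exact H.h_ne this

theorem ul_notMem (H : F.Good x y c w h) (hx : F.Generic x) : c + F.tr 0 h ∉ x := by
  intro hm
  have := hx.1 _ hm _ H.ll (by simp [col_tr])
  have := congrArg F.row this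
  simp [row_tr] at this
  exact H.h_ne this

theorem generic (H : F.Good x y c w h) (hx : F.Generic x) : F.Generic y := by
  have hw := H.w_ne
  have hh := H.h_ne
  refine ⟨fun u hu v hv e => ?_, fun u hu v hv e => ?_⟩
  · rw [H.mem] at hu hv
    have key : ∀ u v, F.col u = F.col v → (u ∈ x ∧ u ≠ c ∧ u ≠ c + F.tr w h) →
        (v = c + F.tr w 0 ∨ v = c + F.tr 0 h) → False := by
      rintro u v e ⟨h1, h2, h3⟩ (rfl | rfl)
      · exact h3 (hx.1 _ h1 _ H.ur (by rw [e]; simp [col_tr]))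
      · exact h2 (hx.1 _ h1 _ H.ll (by rw [e]; simp [col_tr]))
    rcases hu with hu | hu <;> rcases hv with hv | hv
    · exact hx.1 _ hu.1 _ hv.1 e
    · exact (key _ _ e hu hv).elim
    · exact (key _ _ e.symm hv hu).elim
    · rcases hu with rfl | rfl <;> rcases hv with rfl | rfl
      · rfl
      · simp [col_tr] at e; exact absurd e hw
      · simp [col_tr] at e; exact absurd e hw
      · rfl
  · rw [H.mem] at hu hv
    have key : ∀ u v, F.row u = F.row v → (u ∈ x ∧ u ≠ c ∧ u ≠ c + F.tr w h) →
        (v = c + F.tr w 0 ∨ v = c + F.tr 0 h) → False := by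
      rintro u v e ⟨h1, h2, h3⟩ (rfl | rfl)
      · exact h2 (hx.2 _ h1 _ H.ll (by rw [e]; simp [row_tr]))
      · exact h3 (hx.2 _ h1 _ H.ur (by rw [e]; simp [row_tr]))
    rcases hu with hu | hu <;> rcases hv with hv | hv
    · exact hx.2 _ hu.1 _ hv.1 e
    · exact (key _ _ e hu hv).elim
    · exact (key _ _ e.symm hv hu).elim
    · rcases hu with rfl | rfl <;> rcases hv with rfl | rfl
      · rfl
      · simp [row_tr] at e; exact absurd e hh
      · simp [row_tr] at e; exact absurd e hh
      · rfl

theorem ll_notMem (H : F.Good x y c w h) : c ∉ y := by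
  rw [H.mem]
  rintro (⟨-, h1, -⟩ | h1 | h1)
  · exact h1 rfl
  · have := congrArg F.col h1
    simp [col_tr] at this; exact H.w_ne this
  · have := congrArg F.row h1
    simp [row_tr] at this; exact H.h_ne this

theorem ur_notMem (H : F.Good x y c w h) : c + F.tr w h ∉ y := by
  rw [H.mem]
  rintro (⟨-, -, h1⟩ | h1 | h1)
  · exact h1 rfl
  · have := congrArg F.row h1
    simp [row_tr] at this; exact H.h_ne this
  · have := congrArg F.col h1
    simp [col_tr] at this; exact H.w_ne this

theorem transpose (H : F.Good x y c w h) : F.transpose.Good x y c h w where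
  w_pos := H.h_pos
  h_pos := H.w_pos
  ll := H.ll
  ur := by rw [transpose_tr]; exact H.ur
  w_ne := H.h_ne
  h_ne := H.w_ne
  mem v := by rw [H.mem]; simp only [transpose_tr]; tauto
  sep a b ha hb e := (H.sep b a hb ha (by rw [← transpose_tr, e])).symm
  off v hv h1 h2 i j hi hi' hj hj' := by
    rw [transpose_tr] at h2 ⊢
    exact H.off v hv h1 h2 j i hj hj' hi hi'

theorem rotate (H : F.Good x y c w h) : F.rotate.Good x y (c + F.tr w h) w h where
  w_pos := H.w_pos
  h_pos := H.h_pos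
  ll := H.ur
  ur := by
    rw [rotate_tr, add_assoc, tr_add]; simpa [tr_zero] using H.ll
  w_ne := H.w_ne
  h_ne := H.h_ne
  mem v := by
    rw [H.mem]; simp only [rotate_tr, add_assoc, tr_add]
    simp only [add_neg_cancel, neg_zero, add_zero, tr_zero]; tauto
  sep a b ha hb e := by
    have := H.sep (-a) (-b) (by rwa [abs_neg]) (by rwa [abs_neg]) (by rw [← rotate_tr, e])
    omega
  off v hv h1 h2 i j hi hi' hj hj' := by
    simp only [rotate_tr, add_assoc, tr_add, add_neg_cancel, add_zero, tr_zero] at h2 ⊢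
    exact H.off v hv h2 h1 _ _ (by omega) (by omega) (by omega) (by omega)

/-- A reflection reverses the direction of a rectangle. -/
theorem reflect (H : F.Good x y c w h) (hx : F.Generic x) :
    F.reflect.Good y x (c + F.tr w 0) w h where
  w_pos := H.w_pos
  h_pos := H.h_pos
  ll := by rw [H.mem]; tauto
  ur := by
    rw [reflect_tr, add_assoc, tr_add, H.mem]; simp
  w_ne := H.w_ne
  h_ne := H.h_ne
  mem v := by
    have e1 : c + F.tr w 0 + F.reflect.tr w h = c + F.tr 0 h := by
      rw [reflect_tr, add_assoc, tr_add]; simp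
    have e2 : c + F.tr w 0 + F.reflect.tr w 0 = c := by
      rw [reflect_tr, add_assoc, tr_add]; simp [tr_zero]
    have e3 : c + F.tr w 0 + F.reflect.tr 0 h = c + F.tr w h := by
      rw [reflect_tr, add_assoc, tr_add]; simp
    rw [e1, e2, e3, H.mem]
    have h1 := H.lr_notMem hx
    have h2 := H.ul_notMem hx
    have h3 := H.ll
    have h4 := H.ur
    constructor
    · intro hv
      by_cases a1 : v = c
      · tauto
      by_cases a2 : v = c + F.tr w h
      · tauto
      exact Or.inl ⟨Or.inl ⟨hv, a1, a2⟩, fun e => h1 (e ▸ hv), fun e => h2 (e ▸ hv)⟩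
    · rintro (⟨h5 | h5, h6⟩ | rfl | rfl)
      · exact h5.1
      · tauto
      · exact h3
      · exact h4
  sep a b ha hb e := by
    have := H.sep (-a) b (by rwa [abs_neg]) hb (by rw [← reflect_tr, e])
    omega
  off v hv h1 h2 i j hi hi' hj hj' := by
    simp only [reflect_tr, add_assoc, tr_add, add_neg_cancel, zero_add] at h2 ⊢
    rw [H.mem] at hv
    rcases hv with hv | rfl | rfl
    · exact H.off v hv.1 hv.2.1 hv.2.2 _ _ (by omega) (by omega) (by omega) (by omega)
    · exact absurd rfl h1
    · exact absurd rfl h2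

/-- Two rectangles that form an `L`: cutting along the other line through the reentrant corner
`c + F.tr w h`. All other positions of two rectangles with exactly one common corner are images of
this one under the symmetries of frames. -/
theorem cut (hx : F.Generic x) (H : F.Good x y c w h) (H' : F.Good y z (c + F.tr w 0) w' h')
    (hlt : h < h') (hne : c + F.tr w 0 + F.tr w' h' ≠ c + F.tr 0 h) :
    ∃ y', y' ≠ y ∧ F.Good x y' (c + F.tr w h) w' (h' - h) ∧ F.Good y' z c (w + w') h := by
  have hy := H.generic hx
  have w0 := H.w_pos
  have h0 := H.h_pos
  have w0' := H'.w_pos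
  have h0' := H'.h_pos
  have nw := H.w_ne
  have nh := H.h_ne
  have nw' := H'.w_ne
  have nh' := H'.h_ne
  obtain ⟨p, hp⟩ : ∃ p, p = c + F.tr w 0 := ⟨_, rfl⟩
  obtain ⟨q, hq⟩ : ∃ q, q = c + F.tr 0 h := ⟨_, rfl⟩
  obtain ⟨u₂, hu₂⟩ : ∃ u, u = c + F.tr w h := ⟨_, rfl⟩
  obtain ⟨u₃, hu₃⟩ : ∃ u, u = c + F.tr (w + w') h' := ⟨_, rfl⟩
  have eu₃ : p + F.tr w' h' = u₃ := by rw [hp, hu₃, add_assoc, tr_add, zero_add]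
  have ez₁ : p + F.tr w' 0 = c + F.tr (w + w') 0 := by rw [hp, add_assoc, tr_add, zero_add]
  have ez₂ : p + F.tr 0 h' = c + F.tr w h' := by rw [hp, add_assoc, tr_add, zero_add, add_zero]
  have mem := H.mem
  have mem' := H'.mem
  have ll := H.ll
  have ur := H.ur
  have ur' := H'.ur
  have off := H.off
  have off' := H'.off
  have pnx := H.lr_notMem hx
  have qnx := H.ul_notMem hx
  rw [← hp] at H' mem' mem off' pnx ur' hne
  rw [← hq] at mem qnx hne
  rw [← hu₂] at mem ur off
  rw [eu₃] at mem' off' ur' hne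
  rw [ez₁, ez₂] at mem'
  have qy : q ∈ y := (mem q).2 (by tauto)
  have py : p ∈ y := (mem p).2 (by tauto)
  have u₃p : u₃ ≠ p := col_ne_of (F := F) (by rw [hu₃, hp]; simpa [col_tr] using nw')
  have u₃x : u₃ ∈ x ∧ u₃ ≠ c ∧ u₃ ≠ u₂ := by
    have := (mem u₃).1 ur'
    tauto
  have nww : ((w + w' : ℤ) : ZMod M) ≠ 0 := fun e =>
    u₃x.2.1 (hx.1 _ u₃x.1 _ ll (by rw [hu₃]; simpa [col_tr] using e))
  have nhh : ((h' - h : ℤ) : ZMod M) ≠ 0 := fun e =>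
    u₃x.2.2 (hx.2 _ u₃x.1 _ ur (by
      rw [hu₃, hu₂]; simp only [map_add, row_tr]
      push_cast at e; rw [sub_eq_zero.1 e]))
  have u₂c : u₂ ≠ c := col_ne_of (F := F) (by rw [hu₂]; simpa [col_tr] using nw)
  have e1 : u₂ + F.tr w' (h' - h) = u₃ := by
    rw [hu₂, hu₃, add_assoc, tr_add]; congr 2; ring
  have e2 : u₂ + F.tr w' 0 = c + F.tr (w + w') h := by
    rw [hu₂, add_assoc, tr_add, add_zero]
  have e3 : u₂ + F.tr 0 (h' - h) = c + F.tr w h' := by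
    rw [hu₂, add_assoc, tr_add]; congr 2 <;> ring
  -- no translate of the lower left corner lies in the interior of the new upper rectangle
  have main1 : ∀ i j, 0 < i → i < w' → 0 < j → j < h' - h → F.tr (w + i) (h + j) ≠ 0 := by
    intro i j hi hi' hj hj' hμ
    have hc0 : ((w + i : ℤ) : ZMod M) = 0 := by rw [← F.col_tr _ (h + j), hμ, map_zero]
    have hr0 : ((h + j : ℤ) : ZMod M) = 0 := by rw [← F.row_tr (w + i), hμ, map_zero]
    by_cases hcase : w + i < w'
    · have := H'.sep (w + i) (h + j) (by rw [abs_of_pos (by omega)]; omega)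
        (by rw [abs_of_pos (by omega)]; omega) hμ
      omega
    have hwi : w + i ≠ w' := fun e => nw' (by rw [← e, hc0])
    have hhj : h + j ≠ h' - h := fun e => nhh (by rw [← e, hr0])
    by_cases hcase2 : j + 2 * h < h'
    · refine off' q qy ?_ (Ne.symm hne) i (j + 2 * h) hi hi' (by omega) hcase2 ?_
      · exact fun e => nw (by
          have := congrArg F.col e; rw [hp, hq] at this; simpa [col_tr] using this.symm)
      · rw [hq, hp]; unfold tr at hμ ⊢; linear_combination (norm := module) -hμ
    · refine off u₃ u₃x.1 u₃x.2.1 u₃x.2.2 (w' - i) (h' - h - j) (by omega) (by omega) (by omega)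
        (by omega) ?_
      rw [hu₃]; unfold tr at hμ ⊢; linear_combination (norm := module) hμ
  -- no period moves the new lower rectangle to an overlapping one
  have main2 : ∀ a b : ℤ, 0 ≤ a → a < w + w' → |b| < h → F.tr a b = 0 → a = 0 ∧ b = 0 := by
    intro a b ha ha' hb hμ
    have hc0 : (a : ZMod M) = 0 := by rw [← F.col_tr a b, hμ, map_zero]
    have hr0 : (b : ZMod M) = 0 := by rw [← F.row_tr a b, hμ, map_zero]
    have hb' := abs_lt.1 hb
    by_cases h1 : a < w
    · exact H.sep a b (by rwa [abs_of_nonneg ha]) hb hμ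
    by_cases h2 : a < w'
    · exact H'.sep a b (by rwa [abs_of_nonneg ha]) (by omega) hμ
    have aw : a ≠ w := fun e => nw (by rw [← e, hc0])
    have aw' : a ≠ w' := fun e => nw' (by rw [← e, hc0])
    have bh : b ≠ h' - h := fun e => nhh (by rw [← e, hr0])
    exfalso
    by_cases h3 : h + b < h'
    · refine off' q qy ?_ (Ne.symm hne) (a - w) (h + b) (by omega) (by omega) (by omega) h3 ?_
      · exact fun e => nw (by
          have := congrArg F.col e; rw [hp, hq] at this; simpa [col_tr] using this.symm)
      · rw [hq, hp]; unfold tr at hμ ⊢; linear_combination (norm := module) -hμ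
    · refine off u₃ u₃x.1 u₃x.2.1 u₃x.2.2 (w + w' - a) (h' - b) (by omega) (by omega) (by omega)
        (by omega) ?_
      rw [hu₃]; unfold tr at hμ ⊢; linear_combination (norm := module) hμ
  -- the new corner `c + F.tr w h'` does not lie in the interior of the new lower rectangle
  have main3 : ∀ i j, 0 < i → i < w + w' → 0 < j → j < h → F.tr (i - w) (j - h') ≠ 0 := by
    intro i j hi hi' hj hj' hμ
    have hc0 : ((i - w : ℤ) : ZMod M) = 0 := by rw [← F.col_tr _ (j - h'), hμ, map_zero]
    by_cases h1 : |i - w| < w'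
    · have := H'.sep _ (j - h') h1 (by rw [abs_lt]; omega) hμ
      omega
    rw [abs_lt] at h1
    have h2 : i + w' ≠ w := fun e => nw' (by
      rw [show i - w = -w' by omega] at hc0; simpa using hc0)
    refine off u₃ u₃x.1 u₃x.2.1 u₃x.2.2 (i + w') j (by omega) (by omega) (by omega) hj' ?_
    rw [hu₃]; unfold tr at hμ ⊢; linear_combination (norm := module) -hμ
  let y' : Set T := {v | (v ∈ x ∧ v ≠ u₂ ∧ v ≠ u₃) ∨ v = c + F.tr (w + w') h ∨ v = c + F.tr w h'}
  have hcy' : c ∈ y' := Or.inl ⟨ll, u₂c.symm, u₃x.2.1.symm⟩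
  refine ⟨y', fun e => H.ll_notMem (e ▸ hcy'), ⟨w0', by omega, ?_, ?_, nw', nhh, ?_, ?_, ?_⟩,
    ⟨by omega, h0, hcy', Or.inr (Or.inl rfl), nww, nh, ?_, ?_, ?_⟩⟩
  · rwa [← hu₂]
  · rw [← hu₂, e1]; exact u₃x.1
  · intro v; rw [← hu₂, e1, e2, e3]; rfl
  · intro a b ha hb hμ; exact H'.sep a b ha (by omega) hμ
  · intro v hv h1 h2 i j hi hi' hj hj'
    rw [← hu₂, e1] at h2
    rw [← hu₂] at h1
    by_cases hvc : v = c
    · rintro e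
      refine main1 i j hi hi' hj hj' ?_
      rw [hvc] at e; unfold tr at e ⊢; linear_combination (norm := module) -e
    · have := off' v ((mem v).2 (by tauto)) (fun e => pnx (e ▸ hv)) h2 i (j + h) hi hi' (by omega)
        (by omega)
      rwa [hp, add_assoc, tr_add, zero_add, add_comm j h, ← add_zero w, ← add_zero w, add_zero w,
        add_assoc w 0 i, zero_add, ← tr_add, ← add_assoc] at this
  · intro v
    have a1 : q ≠ p := col_ne_of (F := F) (by rw [hq, hp]; simpa [col_tr] using nw)
    have a2 : c + F.tr w h' ≠ c := col_ne_of (F := F) (by simpa [col_tr] using nw)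
    have a3 : c + F.tr w h' ≠ c + F.tr (w + w') h :=
      col_ne_of (F := F) (by simpa [col_tr] using nw')
    have a4 : c + F.tr (w + w') h ∉ x := fun e => by
      have := hx.2 _ e _ ur (by rw [hu₂]; simp [row_tr])
      rw [hu₂] at this
      have := congrArg F.col this
      simp [col_tr] at this; exact nw' this
    rw [mem', ← hq]
    change _ ↔ ((v ∈ x ∧ v ≠ u₂ ∧ v ≠ u₃) ∨ v = c + F.tr (w + w') h ∨ v = c + F.tr w h') ∧ _ ∨ _
    rw [mem]
    constructor
    · rintro (⟨⟨h1, h2, h3⟩ | h1 | h1, h4, h5⟩ | h1 | h1)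
      · exact Or.inl ⟨Or.inl ⟨h1, h3, h5⟩, h2, fun e => a4 (e ▸ h1)⟩
      · exact absurd h1 h4
      · exact Or.inr (Or.inr h1)
      · exact Or.inr (Or.inl h1)
      · exact Or.inl ⟨Or.inr (Or.inr h1), h1 ▸ a2, h1 ▸ a3⟩
    · rintro (⟨⟨h1, h2, h3⟩ | h1 | h1, h4, h5⟩ | h1 | h1)
      · exact Or.inl ⟨Or.inl ⟨h1, h4, h2⟩, fun e => pnx (e ▸ h1), h3⟩
      · exact absurd h1 h5
      · exact Or.inr (Or.inr h1)
      · exact Or.inr (Or.inl h1)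
      · exact Or.inl ⟨Or.inr (Or.inr h1), h1 ▸ a1, h1 ▸ (Ne.symm hne)⟩
  · intro a b ha hb hμ
    rcases le_total 0 a with h1 | h1
    · exact main2 a b h1 (by rwa [abs_of_nonneg h1] at ha) hb hμ
    · have := main2 (-a) (-b) (by omega) (by rwa [abs_of_nonpos h1] at ha) (by rwa [abs_neg])
        (by unfold tr at hμ ⊢; linear_combination (norm := module) -hμ)
      omega
  · intro v hv h1 h2 i j hi hi' hj hj' e
    rcases hv with ⟨h3, h4, h5⟩ | h3 | h3
    · rcases lt_trichotomy i w with h6 | h6 | h6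
      · exact off v h3 h1 h4 i j hi h6 hj hj' e
      · exact h4 (hx.1 _ h3 _ ur (by rw [e, hu₂, h6]; simp [col_tr]))
      · refine off' v ((mem v).2 (by tauto)) (fun e => pnx (e ▸ h3)) h5 (i - w) j (by omega)
          (by omega) (by omega) (by omega) ?_
        rw [e, hp, add_assoc, tr_add]; congr 2 <;> ring
    · exact h2 h3
    · refine main3 i j hi hi' hj hj' ?_
      rw [h3] at e; unfold tr at e ⊢; linear_combination (norm := module) -e

end Good
end Frame

/-! ### Consecutive rectangles that do not form an annulus -/

namespace Frame

variable {T : Type*} [AddCommGroup T] {M : ℕ} (F : Frame T M)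

theorem rotate_rotate : F.rotate.rotate = F := by
  cases F; simp [rotate]

theorem reflect_reflect : F.reflect.reflect = F := by
  cases F; simp [reflect]

variable {F} {x y z : Set T} {c c' : T} {w h w' h' : ℤ}

theorem tr_neg_of_eq {u v : T} {a b : ℤ} (e : u + F.tr a b = v) : u = v + F.tr (-a) (-b) := by
  rw [← e, add_assoc, tr_add]; simp [tr_zero]

/-- The conclusion shared by all exchanges of two consecutive rectangles: there is another
intermediate generator, reached by the first of the two given rectangles and left by the second. -/
def Exchange (F : Frame T M) (x y z : Set T) (c : T) (w h : ℤ) (c' : T) (w' h' : ℤ) : Prop :=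
  ∃ y', y' ≠ y ∧ F.Good x y' c w h ∧ F.Good y' z c' w' h'

theorem Exchange.transpose (E : F.Exchange x y z c w h c' w' h') :
    F.transpose.Exchange x y z c h w c' h' w' := by
  obtain ⟨y', h1, h2, h3⟩ := E
  exact ⟨y', h1, h2.transpose, h3.transpose⟩

theorem Exchange.rotate (E : F.Exchange x y z c w h c' w' h') :
    F.rotate.Exchange x y z (c + F.tr w h) w h (c' + F.tr w' h') w' h' := by
  obtain ⟨y', h1, h2, h3⟩ := E
  exact ⟨y', h1, h2.rotate, h3.rotate⟩

theorem Exchange.reflect (hx : F.Generic x) (E : F.Exchange x y z c w h c' w' h') :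
    F.reflect.Exchange z y x (c' + F.tr w' 0) w' h' (c + F.tr w 0) w h := by
  obtain ⟨y', h1, h2, h3⟩ := E
  exact ⟨y', h1, h3.reflect (h2.generic hx), h2.reflect hx⟩

namespace Good

/-- The four lemmas `exchange_right_tall`, `exchange_right_short`, `exchange_left_tall` and
`exchange_left_short` treat the second rectangle to the right or to the left of the first one, with
one common corner, and taller or shorter than the first one. The last three are obtained from this
one by a reflection and a rotation. -/
theorem exchange_right_tall (hx : F.Generic x) (H : F.Good x y c w h) (H' : F.Good y z c' w' h')
    (hc : c' = c + F.tr w 0) (hne : c' + F.tr w' h' ≠ c + F.tr 0 h) (hlt : h < h') :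
    F.Exchange x y z (c + F.tr w h) w' (h' - h) c (w + w') h := by
  subst hc
  exact H.cut hx H' hlt hne

/-- A reflection in a vertical line interchanges the roles of the two rectangles. -/
theorem exchange_right_short (hx : F.Generic x) (H : F.Good x y c w h) (H' : F.Good y z c' w' h')
    (hc : c' = c + F.tr w 0) (hne : c' + F.tr w' h' ≠ c + F.tr 0 h) (hlt : h' < h) :
    F.Exchange x y z c (w + w') h' (c + F.tr 0 h') w (h - h') := by
  have hy := H.generic hx
  have hz := H'.generic hy
  have E := (H'.reflect hy).exchange_right_tall hz.reflect (H.reflect hx)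
    (by rw [hc, reflect_tr, add_assoc, tr_add]; simp [tr_zero])
    (by simpa only [reflect_tr, add_assoc, tr_add, add_neg_cancel, zero_add, add_zero, neg_zero]
      using hne.symm) hlt
  have E' := E.reflect hz.reflect
  rw [reflect_reflect] at E'
  subst hc
  convert E' using 1
  · simp only [reflect_tr, add_assoc, tr_add]
    rw [left_eq_add, ← F.tr_zero]; congr 1; ring
  · ring
  · simp only [reflect_tr, add_assoc, tr_add]
    congr 2 <;> ring

theorem exchange_left_tall (hx : F.Generic x) (H : F.Good x y c w h) (H' : F.Good y z c' w' h')
    (hne : c' ≠ c + F.tr w 0) (hc : c' + F.tr w' h' = c + F.tr 0 h) (hlt : h < h') :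
    F.Exchange x y z c' w' (h' - h) (c' + F.tr 0 (h' - h)) (w + w') h := by
  have E := H.rotate.exchange_right_tall hx.rotate H'.rotate
    (by rw [hc, rotate_tr, add_assoc, tr_add]; simp)
    (by simpa only [rotate_tr, add_assoc, tr_add, add_neg_cancel, zero_add, add_zero, neg_zero,
      tr_zero] using hne) hlt
  have E' := E.rotate
  rw [rotate_rotate] at E'
  have hc := tr_neg_of_eq hc
  subst hc
  convert E' using 1
  all_goals simp only [rotate_tr, add_assoc, tr_add]
  all_goals congr 2 <;> ring

theorem exchange_left_short (hx : F.Generic x) (H : F.Good x y c w h) (H' : F.Good y z c' w' h')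
    (hne : c' ≠ c + F.tr w 0) (hc : c' + F.tr w' h' = c + F.tr 0 h) (hlt : h' < h) :
    F.Exchange x y z c' (w + w') h' c w (h - h') := by
  have E := H.rotate.exchange_right_short hx.rotate H'.rotate
    (by rw [hc, rotate_tr, add_assoc, tr_add]; simp)
    (by simpa only [rotate_tr, add_assoc, tr_add, add_neg_cancel, zero_add, add_zero, neg_zero,
      tr_zero] using hne) hlt
  have E' := E.rotate
  rw [rotate_rotate] at E'
  have hc := tr_neg_of_eq hc
  subst hc
  convert E' using 1
  all_goals simp only [rotate_tr, add_assoc, tr_add]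
  · congr 2 ; ring
  · rw [left_eq_add, ← F.tr_zero]; congr 1 <;> ring

/-- Two rectangles without a common corner can be interchanged. -/
theorem exchange_disjoint (hx : F.Generic x) (H : F.Good x y c w h) (H' : F.Good y z c' w' h')
    (h1 : c' ≠ c + F.tr w 0) (h2 : c' ≠ c + F.tr 0 h)
    (h3 : c' + F.tr w' h' ≠ c + F.tr w 0) (h4 : c' + F.tr w' h' ≠ c + F.tr 0 h) :
    F.Exchange x y z c' w' h' c w h := by
  have hy := H.generic hx
  have w0 := H.w_pos
  have h0 := H.h_pos
  have w0' := H'.w_pos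
  have h0' := H'.h_pos
  have nw := H.w_ne
  have nh := H.h_ne
  have nw' := H'.w_ne
  have nh' := H'.h_ne
  obtain ⟨p, hp⟩ : ∃ p, p = c + F.tr w 0 := ⟨_, rfl⟩
  obtain ⟨q, hq⟩ : ∃ q, q = c + F.tr 0 h := ⟨_, rfl⟩
  obtain ⟨p', hp'⟩ : ∃ p, p = c' + F.tr w' 0 := ⟨_, rfl⟩
  obtain ⟨q', hq'⟩ : ∃ q, q = c' + F.tr 0 h' := ⟨_, rfl⟩
  obtain ⟨u₂, hu₂⟩ : ∃ u, u = c + F.tr w h := ⟨_, rfl⟩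
  obtain ⟨u₄, hu₄⟩ : ∃ u, u = c' + F.tr w' h' := ⟨_, rfl⟩
  have mem := H.mem
  have mem' := H'.mem
  have ll := H.ll
  have ur := H.ur
  have ll' := H'.ll
  have ur' := H'.ur
  have off := H.off
  have off' := H'.off
  have pnx := H.lr_notMem hx
  have qnx := H.ul_notMem hx
  have pny' := H'.lr_notMem hy
  have qny' := H'.ul_notMem hy
  rw [← hp] at mem h1 h3 pnx
  rw [← hq] at mem h2 h4 qnx
  rw [← hu₂] at mem ur off
  rw [← hu₄] at mem' ur' off' h3 h4
  rw [← hp'] at mem' pny'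
  rw [← hq'] at mem' qny'
  have qy : q ∈ y := (mem q).2 (by tauto)
  have py : p ∈ y := (mem p).2 (by tauto)
  have u₃x : c' ∈ x ∧ c' ≠ c ∧ c' ≠ u₂ := by
    have := (mem c').1 ll'
    tauto
  have u₄x : u₄ ∈ x ∧ u₄ ≠ c ∧ u₄ ≠ u₂ := by
    have := (mem u₄).1 ur'
    tauto
  have cx : ∀ u ∈ x, ∀ v ∈ x, u ≠ v → F.col u ≠ F.col v := fun u hu v hv h e =>
    h (hx.1 u hu v hv e)
  have rx : ∀ u ∈ x, ∀ v ∈ x, u ≠ v → F.row u ≠ F.row v := fun u hu v hv h e =>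
    h (hx.2 u hu v hv e)
  have c31 := cx _ u₃x.1 _ ll u₃x.2.1
  have c32 := cx _ u₃x.1 _ ur u₃x.2.2
  have c41 := cx _ u₄x.1 _ ll u₄x.2.1
  have c42 := cx _ u₄x.1 _ ur u₄x.2.2
  have r31 := rx _ u₃x.1 _ ll u₃x.2.1
  have r32 := rx _ u₃x.1 _ ur u₃x.2.2
  have r41 := rx _ u₄x.1 _ ll u₄x.2.1
  have r42 := rx _ u₄x.1 _ ur u₄x.2.2
  have p'x : p' ∉ x := fun e => H'.w_ne (by
    have := hx.2 _ e _ u₃x.1 (by rw [hp']; simp [row_tr])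
    rw [hp'] at this
    simpa [col_tr] using congrArg F.col this)
  have q'x : q' ∉ x := fun e => H'.h_ne (by
    have := hx.1 _ e _ u₃x.1 (by rw [hq']; simp [col_tr])
    rw [hq'] at this
    simpa [row_tr] using congrArg F.row this)
  let y' : Set T := {v | (v ∈ x ∧ v ≠ c' ∧ v ≠ u₄) ∨ v = p' ∨ v = q'}
  have hcy' : c ∈ y' := Or.inl ⟨ll, u₃x.2.1.symm, u₄x.2.1.symm⟩
  refine ⟨y', fun e => H.ll_notMem (e ▸ hcy'), ⟨w0', h0', u₃x.1, hu₄ ▸ u₄x.1, nw', nh', ?_,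
    H'.sep, ?_⟩, ⟨w0, h0, hcy', ?_, nw, nh, ?_, H.sep, ?_⟩⟩
  · intro v; rw [← hp', ← hq', ← hu₄]; rfl
  · intro v hv hv1 hv2 i j hi hi' hj hj' e
    rw [← hu₄] at hv2
    by_cases e1 : v = c
    · have a1 : i + w ≠ w' := fun e' => c42 (by
        rw [hu₄, hu₂, ← e', ← e1, e]; simp [col_tr, add_assoc])
      have a2 : j + h ≠ h' := fun e' => r42 (by
        rw [hu₄, hu₂, ← e', ← e1, e]; simp [row_tr, add_assoc])
      have a3 : ¬ i + w < w' := fun e' =>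
        off' p py (Ne.symm h1) (Ne.symm h3) (i + w) j (by omega) e' hj hj' (by
          rw [hp, ← e1, e, add_assoc, tr_add, add_zero])
      have a4 : ¬ j + h < h' := fun e' =>
        off' q qy (Ne.symm h2) (Ne.symm h4) i (j + h) hi hi' (by omega) e' (by
          rw [hq, ← e1, e, add_assoc, tr_add, add_zero])
      refine off u₄ u₄x.1 u₄x.2.1 u₄x.2.2 (w' - i) (h' - j) (by omega) (by omega) (by omega)
        (by omega) ?_
      rw [hu₄, ← e1, e, add_assoc, tr_add]; congr 2 <;> ring
    by_cases e2 : v = u₂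
    · have e3 : c + F.tr w h = c' + F.tr i j := by rw [← hu₂, ← e2, e]
      have a1 : i ≠ w := fun e' => c31 (by
        have := congrArg F.col e3; rw [e'] at this; simpa [col_tr] using this.symm)
      have a2 : j ≠ h := fun e' => r31 (by
        have := congrArg F.row e3; rw [e'] at this; simpa [row_tr] using this.symm)
      have a3 : ¬ h < j := fun e' =>
        off' p py (Ne.symm h1) (Ne.symm h3) i (j - h) hi hi' (by omega) (by omega) (by
          rw [hp]; unfold tr at e3 ⊢; linear_combination (norm := module) e3)
      have a4 : ¬ w < i := fun e' =>
        off' q qy (Ne.symm h2) (Ne.symm h4) (i - w) j (by omega) (by omega) hj hj' (by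
          rw [hq]; unfold tr at e3 ⊢; linear_combination (norm := module) e3)
      refine off c' u₃x.1 u₃x.2.1 u₃x.2.2 (w - i) (h - j) (by omega) (by omega) (by omega)
        (by omega) ?_
      unfold tr at e3 ⊢; linear_combination (norm := module) -e3
    · exact off' v ((mem v).2 (by tauto)) hv1 hv2 i j hi hi' hj hj' e
  · rw [← hu₂]; exact Or.inl ⟨ur, u₃x.2.2.symm, u₄x.2.2.symm⟩
  · intro v
    have b1 : p' ≠ c := fun e => p'x (e ▸ ll)
    have b2 : q' ≠ c := fun e => q'x (e ▸ ll)
    have b3 : p' ≠ u₂ := fun e => p'x (e ▸ ur)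
    have b4 : q' ≠ u₂ := fun e => q'x (e ▸ ur)
    rw [mem', mem, ← hu₂, ← hp, ← hq]
    change _ ↔ ((v ∈ x ∧ v ≠ c' ∧ v ≠ u₄) ∨ v = p' ∨ v = q') ∧ _ ∨ _
    constructor
    · rintro (⟨⟨g1, g2, g3⟩ | g1 | g1, g4, g5⟩ | g1 | g1)
      · exact Or.inl ⟨Or.inl ⟨g1, g4, g5⟩, g2, g3⟩
      · exact Or.inr (Or.inl g1)
      · exact Or.inr (Or.inr g1)
      · exact Or.inl ⟨Or.inr (Or.inl g1), g1 ▸ b1, g1 ▸ b3⟩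
      · exact Or.inl ⟨Or.inr (Or.inr g1), g1 ▸ b2, g1 ▸ b4⟩
    · rintro (⟨⟨g1, g2, g3⟩ | g1 | g1, g4, g5⟩ | g1 | g1)
      · exact Or.inl ⟨Or.inl ⟨g1, g4, g5⟩, g2, g3⟩
      · exact Or.inr (Or.inl g1)
      · exact Or.inr (Or.inr g1)
      · exact Or.inl ⟨Or.inr (Or.inl g1), g1 ▸ (Ne.symm h1), g1 ▸ (Ne.symm h3)⟩
      · exact Or.inl ⟨Or.inr (Or.inr g1), g1 ▸ (Ne.symm h2), g1 ▸ (Ne.symm h4)⟩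
  · intro v hv hv1 hv2 i j hi hi' hj hj' e
    rw [← hu₂] at hv2
    rcases hv with hv | hv | hv
    · exact off v hv.1 hv1 hv2 i j hi hi' hj hj' e
    · have e3 : c' + F.tr w' 0 = c + F.tr i j := by rw [← hp', ← hv, e]
      have a1 : i ≠ w' := fun e' => c31 (by
        have := congrArg F.col e3; rw [e'] at this; simpa [col_tr] using this)
      have a2 : j + h' ≠ h := fun e' => r42 (by
        have := congrArg F.row e3; rw [hu₄, hu₂, ← e']
        simp only [map_add, row_tr, Int.cast_zero, add_zero] at this ⊢
        rw [this]; push_cast; ring)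
      have a3 : ¬ w' < i := fun e' =>
        off c' u₃x.1 u₃x.2.1 u₃x.2.2 (i - w') j (by omega) (by omega) hj hj' (by
          unfold tr at e3 ⊢; linear_combination (norm := module) e3)
      have a4 : ¬ j + h' < h := fun e' =>
        off u₄ u₄x.1 u₄x.2.1 u₄x.2.2 i (j + h') hi hi' (by omega) (by omega) (by
          rw [hu₄]; unfold tr at e3 ⊢; linear_combination (norm := module) e3)
      refine off' q qy (Ne.symm h2) (Ne.symm h4) (w' - i) (h - j) (by omega) (by omega) (by omega)
        (by omega) ?_
      rw [hq]; unfold tr at e3 ⊢; linear_combination (norm := module) -e3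
    · have e3 : c' + F.tr 0 h' = c + F.tr i j := by rw [← hq', ← hv, e]
      have a1 : j ≠ h' := fun e' => r31 (by
        have := congrArg F.row e3; rw [e'] at this; simpa [row_tr] using this)
      have a2 : i + w' ≠ w := fun e' => c42 (by
        have := congrArg F.col e3; rw [hu₄, hu₂, ← e']
        simp only [map_add, col_tr, Int.cast_zero, add_zero] at this ⊢
        rw [this]; push_cast; ring)
      have a3 : ¬ h' < j := fun e' =>
        off c' u₃x.1 u₃x.2.1 u₃x.2.2 i (j - h') hi hi' (by omega) (by omega) (by
          unfold tr at e3 ⊢; linear_combination (norm := module) e3)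
      have a4 : ¬ i + w' < w := fun e' =>
        off u₄ u₄x.1 u₄x.2.1 u₄x.2.2 (i + w') j (by omega) (by omega) hj hj' (by
          rw [hu₄]; unfold tr at e3 ⊢; linear_combination (norm := module) e3)
      refine off' p py (Ne.symm h1) (Ne.symm h3) (w - i) (h' - j) (by omega) (by omega) (by omega)
        (by omega) ?_
      rw [hp]; unfold tr at e3 ⊢; linear_combination (norm := module) -e3

end Good
end Frame

/-! ### Annuli bounded by staircases -/

namespace Frame

variable {T : Type*} [AddCommGroup T] {M : ℕ} {F : Frame T M}
  {x y z : Set T} {c c' : T} {w h w' h' : ℤ}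

theorem tr_mul (n a b : ℤ) : F.tr (n * a) (n * b) = n • F.tr a b := by
  simp only [tr]; module

/-- Periods of a staircase. The rectangles of sizes `w × h` and `w' × (h + l₂)` alternate along the
period `(w + w', l₂)`; if no other period moves one of them to an overlapping position, then
neither does it for a rectangle of width `K (w + w') + w'` whose height `B` fits in the
staircase. -/
theorem staircase_sep {l₂ K B : ℤ} (w0 : 0 < w) (w0' : 0 < w')
    (nw : (w : ZMod M) ≠ 0)
    (s1 : ∀ a b : ℤ, |a| < w → |b| < h → F.tr a b = 0 → a = 0 ∧ b = 0)
    (s2 : ∀ a b : ℤ, |a| < w' → |b| < h + l₂ → F.tr a b = 0 → a = 0 ∧ b = 0)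
    (l0 : 0 < l₂) (hl : F.tr (w + w') l₂ = 0) (K0 : 0 ≤ K)
    (hB : B ≤ l₂) (hBK : B + K * l₂ ≤ h + l₂) (a b : ℤ) (ha : |a| < K * (w + w') + w')
    (hb : |b| < B) (hab : F.tr a b = 0) : a = 0 ∧ b = 0 := by
  have hcl : ((w + w' : ℤ) : ZMod M) = 0 := by rw [← F.col_tr _ l₂, hl, map_zero]
  -- by symmetry the second coordinate may be assumed nonnegative
  have main : ∀ a b : ℤ, |a| < K * (w + w') + w' → 0 ≤ b → b < B → F.tr a b = 0 →
      a = 0 ∧ b = 0 := by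
    intro a b ha b0 hb hab
    have hca : (a : ZMod M) = 0 := by rw [← F.col_tr a b, hab, map_zero]
    have L0 : 0 < w + w' := by omega
    have hn := Int.emod_add_mul_ediv |a| (w + w')
    have hρ0 := Int.emod_nonneg |a| L0.ne'
    have hρ1 := Int.emod_lt_of_pos |a| L0
    have hn0 : 0 ≤ |a| / (w + w') := Int.ediv_nonneg (abs_nonneg a) L0.le
    generalize |a| / (w + w') = n at *
    generalize |a| % (w + w') = ρ at *
    have nK : n ≤ K := by
      by_contra hc
      have : (K + 1) * (w + w') ≤ n * (w + w') := by
        apply mul_le_mul_of_nonneg_right (by omega) L0.le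
      nlinarith
    -- it suffices to hit an overlap after a shift by `j` periods
    have step : ∀ j : ℤ, 0 ≤ j → j ≤ K →
        ((|(|a| - j * (w + w'))| < w' ) ∨ (|(|a| - j * (w + w'))| < w ∧ j + 1 ≤ K)) →
        a = 0 ∧ b = 0 := by
      intro j j0 jK hj
      have m1 : j * l₂ ≤ K * l₂ := mul_le_mul_of_nonneg_right jK l0.le
      have m0 : 0 ≤ j * l₂ := mul_nonneg j0 l0.le
      have conv : ∀ s : ℤ, F.tr (a + s * (w + w')) (b + s * l₂) = 0 := by
        intro s; rw [← tr_add, hab, tr_mul, hl, smul_zero, add_zero]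
      have m2 : j + 1 ≤ K → (j + 1) * l₂ ≤ K * l₂ := fun h =>
        mul_le_mul_of_nonneg_right h l0.le
      rcases le_total a 0 with a0 | a0
      · have e : |(|a| - j * (w + w'))| = |a + j * (w + w')| := by
          rw [abs_of_nonpos a0, ← abs_neg]; congr 1; ring
        rw [e] at hj
        have : a + j * (w + w') = 0 ∧ b + j * l₂ = 0 := by
          rcases hj with hj | ⟨hj, hj'⟩
          · exact s2 _ _ hj (by rw [abs_lt]; constructor <;> nlinarith) (conv j)
          · exact s1 _ _ hj (by rw [abs_lt]; have := m2 hj'; constructor <;> nlinarith) (conv j)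
        have hj0 : j * l₂ = 0 := by omega
        rcases mul_eq_zero.1 hj0 with h1 | h1
        · subst h1; omega
        · omega
      · have e : |(|a| - j * (w + w'))| = |a + (-j) * (w + w')| := by
          rw [abs_of_nonneg a0]; congr 1; ring
        rw [e] at hj
        have : a + (-j) * (w + w') = 0 ∧ b + (-j) * l₂ = 0 := by
          rcases hj with hj | ⟨hj, hj'⟩
          · exact s2 _ _ hj (by rw [abs_lt]; constructor <;> nlinarith) (conv (-j))
          · exact s1 _ _ hj (by rw [abs_lt]; have := m2 hj'; constructor <;> nlinarith)
              (conv (-j))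
        have hj0 : j < 1 := by
          by_contra hc
          have : 1 * l₂ ≤ j * l₂ := mul_le_mul_of_nonneg_right (by omega) l0.le
          nlinarith
        obtain rfl : j = 0 := by omega
        omega
    have hr : |a| - n * (w + w') = ρ := by rw [← hn]; ring
    by_cases c1 : ρ < w'
    · exact step n hn0 nK (Or.inl (by rwa [hr, abs_of_nonneg hρ0]))
    have nK' : n + 1 ≤ K := by
      by_contra hc
      obtain rfl : n = K := by omega
      nlinarith
    by_cases c2 : ρ < w
    · exact step n hn0 nK (Or.inr ⟨by rwa [hr, abs_of_nonneg hρ0], nK'⟩)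
    have c3 : ρ ≠ w := by
      rintro rfl
      apply nw
      have : ((|a| : ℤ) : ZMod M) = 0 := by
        rcases abs_choice a with e | e <;> rw [e] <;> simp [hca]
      rw [← hn] at this
      push_cast at this hcl
      simpa [hcl] using this
    have hr' : |a| - (n + 1) * (w + w') = ρ - (w + w') := by rw [← hn]; ring
    exact step (n + 1) (by omega) nK' (Or.inl (by rw [hr', abs_lt]; constructor <;> omega))
  have hb' := abs_lt.1 hb
  rcases le_total 0 b with h1 | h1
  · exact main a b ha h1 hb'.2 hab
  · have := main (-a) (-b) (by rwa [abs_neg]) (by omega) (by omega)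
      (by unfold tr at hab ⊢; linear_combination (norm := module) -hab)
    omega

/-- A point which lies in neither of the two rectangles of a staircase, nor on their vertical
sides, avoids the staircase. -/
theorem staircase_off {l₂ K : ℤ} {v : T} (w0 : 0 < w) (w0' : 0 < w')
    (l0 : 0 < l₂) (hl : F.tr (w + w') l₂ = 0)
    (o1 : ∀ i j : ℤ, 0 < i → i < w → 0 < j → j < h → v ≠ c + F.tr i j)
    (o2 : ∀ i j : ℤ, w < i → i < w + w' → 0 < j → j < h + l₂ → v ≠ c + F.tr i j)
    (v1 : F.col v ≠ F.col c) (v2 : F.col v ≠ F.col (c + F.tr w h)) (a b : ℤ)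
    (ha : w < a) (ha' : a < (K + 1) * (w + w')) (hb : K * l₂ < b) (hb' : b < h + l₂) :
    v ≠ c + F.tr a b := by
  intro e
  have hcl : ((w + w' : ℤ) : ZMod M) = 0 := by rw [← F.col_tr _ l₂, hl, map_zero]
  push_cast at hcl
  have L0 : 0 < w + w' := by omega
  have hn := Int.emod_add_mul_ediv a (w + w')
  have hρ0 := Int.emod_nonneg a L0.ne'
  have hρ1 := Int.emod_lt_of_pos a L0
  have hn0 : 0 ≤ a / (w + w') := Int.ediv_nonneg (by omega) L0.le
  generalize a / (w + w') = n at *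
  generalize a % (w + w') = ρ at *
  have nK : n ≤ K := by
    by_contra hc
    have : (K + 1) * (w + w') ≤ n * (w + w') := by
      apply mul_le_mul_of_nonneg_right (by omega) L0.le
    nlinarith
  have m1 : n * l₂ ≤ K * l₂ := mul_le_mul_of_nonneg_right nK l0.le
  have m0 : 0 ≤ n * l₂ := mul_nonneg hn0 l0.le
  have hcv : F.col v = F.col c + ρ := by
    rw [e, ← hn]; simp [col_tr, hcl]
  have ρ0 : ρ ≠ 0 := by rintro rfl; exact v1 (by rw [hcv]; simp)
  have ρw : ρ ≠ w := by rintro rfl; exact v2 (by rw [hcv]; simp [col_tr])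
  have key : v = c + F.tr ρ (b - n * l₂) := by
    have h0 := F.tr_mul n (w + w') l₂
    rw [hl, smul_zero] at h0
    rw [e, ← hn, ← add_zero (F.tr ρ (b - n * l₂)), ← h0, tr_add]; congr 2 <;> ring
  rcases lt_or_gt_of_ne ρw with h1 | h1
  · have n1 : 1 ≤ n := by
      by_contra hc
      obtain rfl : n = 0 := by omega
      omega
    have : 1 * l₂ ≤ n * l₂ := mul_le_mul_of_nonneg_right n1 l0.le
    exact o1 _ _ (by omega) h1 (by omega) (by omega) key
  · exact o2 _ _ h1 hρ1 (by omega) (by omega) key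

namespace Good

/-- Two rectangles which share both corners form an annulus, bounded by two staircases. If it is
not horizontal, it can be cut horizontally instead of vertically. The period of the staircases is
`(w + w', h' - h)`, and `k` is the number of periods after which the translates of `c` lie above
the upper right corner of the first rectangle. The horizontal cut starts at this corner, so the
opposite corner of the new first rectangle is the translate of `c` by `k` periods. -/
theorem exchange_annulus_tall (hx : F.Generic x) (H : F.Good x y c w h)
    (H' : F.Good y z c' w' h') (hc : c' = c + F.tr w 0) (hc2 : c' + F.tr w' h' = c + F.tr 0 h)
    (hlt : h < h') {k : ℤ} (hk1 : (k - 1) * (h' - h) < h) (hk2 : h < k * (h' - h)) :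
    F.Exchange x y z (c + F.tr w h) (k * (w + w') - w) (k * (h' - h) - h)
      (c + F.tr w (k * (h' - h))) ((k + 1) * (w + w') - w) (h' - k * (h' - h)) := by
  subst hc
  have hy := H.generic hx
  have w0 := H.w_pos
  have h0 := H.h_pos
  have w0' := H'.w_pos
  have h0' := H'.h_pos
  have nw := H.w_ne
  have nh := H.h_ne
  have nw' := H'.w_ne
  have nh' := H'.h_ne
  obtain ⟨l, hl⟩ : ∃ l, l = h' - h := ⟨_, rfl⟩
  rw [← hl] at hk1 hk2 ⊢
  obtain rfl : h' = h + l := by omega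
  have l0 : 0 < l := by omega
  have k1 : 1 ≤ k := by
    by_contra hc
    have : k * l ≤ 0 * l := mul_le_mul_of_nonneg_right (by omega) l0.le
    omega
  have hper : F.tr (w + w') l = 0 := by
    unfold tr at hc2 ⊢; linear_combination (norm := module) hc2
  have hkper : ∀ n : ℤ, F.tr (n * (w + w')) (n * l) = 0 := fun n => by
    rw [tr_mul, hper, smul_zero]
  have cl1 : ((w + w' : ℤ) : ZMod M) = 0 := by rw [← F.col_tr _ l, hper, map_zero]
  have cl2 : (l : ZMod M) = 0 := by rw [← F.row_tr (w + w') l, hper, map_zero]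
  have cl1' : (w : ZMod M) + w' = 0 := by simpa using cl1
  obtain ⟨p, hp⟩ : ∃ p, p = c + F.tr w 0 := ⟨_, rfl⟩
  obtain ⟨q, hq⟩ : ∃ q, q = c + F.tr 0 h := ⟨_, rfl⟩
  obtain ⟨u₂, hu₂⟩ : ∃ u, u = c + F.tr w h := ⟨_, rfl⟩
  obtain ⟨p', hp'⟩ : ∃ p, p = c + F.tr (k * (w + w')) h := ⟨_, rfl⟩
  obtain ⟨q', hq'⟩ : ∃ q, q = c + F.tr w (k * l) := ⟨_, rfl⟩
  have mem := H.mem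
  have mem' := H'.mem
  have ll := H.ll
  have ur := H.ur
  have off := H.off
  have off' := H'.off
  have pnx := H.lr_notMem hx
  have qnx := H.ul_notMem hx
  have ez₁ : p + F.tr w' 0 = c + F.tr (w + w') 0 := by rw [hp, add_assoc, tr_add, zero_add]
  have ez₂ : p + F.tr 0 (h + l) = c + F.tr w (h + l) := by
    rw [hp, add_assoc, tr_add, zero_add, add_zero]
  rw [← hp] at H' mem' mem off' pnx hc2
  rw [← hq] at mem qnx hc2
  rw [← hu₂] at mem ur off
  rw [hc2] at mem' off'
  rw [ez₁, ez₂] at mem'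
  have p'x : p' ∉ x := fun e => nw (by
    have := hx.2 _ e _ ur (by rw [hu₂, hp']; simp [row_tr])
    rw [hu₂, hp'] at this
    simpa [col_tr, cl1'] using congrArg F.col this)
  have q'x : q' ∉ x := fun e => nh (by
    have := hx.1 _ e _ ur (by rw [hu₂, hq']; simp [col_tr])
    rw [hu₂, hq'] at this
    simpa [row_tr, cl2] using congrArg F.row this)
  have u₂c : u₂ ≠ c := col_ne_of (F := F) (by rw [hu₂]; simpa [col_tr] using nw)
  have c12 : F.col u₂ ≠ F.col c := by rw [hu₂]; simpa [col_tr] using nw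
  have e1 : u₂ + F.tr (k * (w + w') - w) (k * l - h) = c := by
    rw [hu₂, add_assoc, tr_add, add_eq_left, ← hkper k]; congr 1 <;> ring
  have e2 : u₂ + F.tr (k * (w + w') - w) 0 = p' := by
    rw [hu₂, hp', add_assoc, tr_add]; congr 2 <;> ring
  have e3 : u₂ + F.tr 0 (k * l - h) = q' := by
    rw [hu₂, hq', add_assoc, tr_add]; congr 2 <;> ring
  have e4 : q' + F.tr ((k + 1) * (w + w') - w) (h + l - k * l) = p' := by
    rw [hq', hp', add_assoc, tr_add, ← add_zero (F.tr (k * (w + w')) h), ← hper, tr_add]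
    congr 2 <;> ring
  have e5 : q' + F.tr ((k + 1) * (w + w') - w) 0 = c + F.tr (w + w') 0 := by
    rw [hq', add_assoc, tr_add, ← add_zero (F.tr (w + w') 0), ← hkper k, tr_add]
    congr 2 <;> ring
  have e6 : q' + F.tr 0 (h + l - k * l) = c + F.tr w (h + l) := by
    rw [hq', add_assoc, tr_add]; congr 2 <;> ring
  -- no other point lies in the staircase
  have offs : ∀ v ∈ x, v ≠ c → v ≠ u₂ → ∀ K a b : ℤ, w < a → a < (K + 1) * (w + w') →
      K * l < b → b < h + l → v ≠ c + F.tr a b := by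
    intro v hv hv1 hv2 K a b
    refine staircase_off w0 w0' l0 hper (off v hv hv1 hv2) ?_
      (fun e => hv1 (hx.1 _ hv _ ll e)) (fun e => hv2 (hx.1 _ hv _ ur (hu₂ ▸ e))) a b
    intro i j hi hi' hj hj' e
    refine off' v ((mem v).2 (by tauto)) (fun e => pnx (e ▸ hv)) (fun e => qnx (e ▸ hv))
      (i - w) j (by omega) (by omega) hj hj' ?_
    rw [e, hp, add_assoc, tr_add]; congr 2 <;> ring
  let y' : Set T := {v | (v ∈ x ∧ v ≠ u₂ ∧ v ≠ c) ∨ v = p' ∨ v = q'}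
  have hpy' : p ∉ y' := by
    rintro (h1 | h1 | h1)
    · exact pnx h1.1
    · rw [hp, hp'] at h1
      exact nh (by simpa [row_tr] using congrArg F.row h1)
    · have h2 : F.tr 0 (k * l) = 0 := by
        rw [hp, hq'] at h1
        unfold tr at h1 ⊢; linear_combination (norm := module) -h1
      have := H'.sep 0 (k * l) (by simpa using w0') (by rw [abs_lt]; constructor <;> linarith) h2
      omega
  have hpy : p ∈ y := (mem p).2 (by tauto)
  have mL : 0 < (k - 1) * (w + w') + w' := by
    have : 0 ≤ (k - 1) * (w + w') := mul_nonneg (by omega) (by omega)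
    omega
  have nw2 : (((k * (w + w') - w : ℤ)) : ZMod M) ≠ 0 := by
    push_cast; rw [cl1']; simpa using nw
  have nh2 : (((k * l - h : ℤ)) : ZMod M) ≠ 0 := by
    push_cast; rw [cl2]; simpa using nh
  refine ⟨y', fun e => hpy' (e ▸ hpy), ⟨by linarith, by linarith, ?_, ?_, nw2, nh2, ?_, ?_, ?_⟩,
    ⟨by linarith, by linarith, ?_, ?_, ?_, ?_, ?_, ?_, ?_⟩⟩
  · rwa [← hu₂]
  · rw [← hu₂, e1]; exact ll
  · intro v; rw [← hu₂, e1, e2, e3]; rfl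
  · intro a b ha hb
    refine staircase_sep (K := k - 1) (B := k * l - h) w0 w0' nw H.sep H'.sep l0 hper (by omega)
      (by linarith) (by linarith) a b ?_ hb
    linarith
  · intro v hv hv1 hv2 i j hi hi' hj hj'
    rw [← hu₂] at hv1
    rw [← hu₂, e1] at hv2
    rw [add_assoc, tr_add]
    exact offs v hv hv2 hv1 (k - 1) _ _ (by linarith) (by linarith) (by linarith) (by linarith)
  · rw [← hq']; exact Or.inr (Or.inr rfl)
  · rw [← hq', e4]; exact Or.inr (Or.inl rfl)
  · push_cast; rw [cl1']; simpa using nw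
  · push_cast; rw [cl2]; simpa using nh
  · intro v
    rw [mem', mem, ← hq', e4, e5, e6]
    change _ ↔ ((v ∈ x ∧ v ≠ u₂ ∧ v ≠ c) ∨ v = p' ∨ v = q') ∧ _ ∨ _
    constructor
    · rintro (⟨⟨h1, h2, h3⟩ | h1 | h1, h4, h5⟩ | h1)
      · exact Or.inl ⟨Or.inl ⟨h1, h3, h2⟩, fun e => q'x (e ▸ h1), fun e => p'x (e ▸ h1)⟩
      · exact absurd h1 h4
      · exact absurd h1 h5
      · exact Or.inr h1
    · rintro (⟨⟨h1, h2, h3⟩ | h1 | h1, h4, h5⟩ | h1)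
      · exact Or.inl ⟨Or.inl ⟨h1, h3, h2⟩, fun e => pnx (e ▸ h1), fun e => qnx (e ▸ h1)⟩
      · exact absurd h1 h5
      · exact absurd h1 h4
      · exact Or.inr h1
  · intro a b ha hb
    refine staircase_sep (K := k) (B := h + l - k * l) w0 w0' nw H.sep H'.sep l0 hper (by omega)
      (by linarith) (by linarith) a b ?_ hb
    linarith
  · intro v hv hv1 hv2 i j hi hi' hj hj'
    rw [← hq'] at hv1 hv2
    rw [e4] at hv2
    rw [add_assoc, tr_add]
    rcases hv with hv | hv | hv
    · exact offs v hv.1 hv.2.2 hv.2.1 k _ _ (by linarith) (by linarith) (by linarith)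
        (by linarith)
    · exact absurd hv hv2
    · exact absurd hv hv1

/-- The mirror image of `exchange_annulus_tall`: the staircases descend to the right. -/
theorem exchange_annulus_short (hx : F.Generic x) (H : F.Good x y c w h)
    (H' : F.Good y z c' w' h') (hc : c' = c + F.tr w 0) (hc2 : c' + F.tr w' h' = c + F.tr 0 h)
    (hlt : h' < h) {k : ℤ} (hk1 : k * (h - h') < h) (hk2 : h < (k + 1) * (h - h')) :
    F.Exchange x y z c (k * (w + w') + w) (h - k * (h - h'))
      (c + F.tr 0 (h - k * (h - h'))) ((k - 1) * (w + w') + w) ((k + 1) * (h - h') - h) := by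
  have hy := H.generic hx
  have hz := H'.generic hy
  have hper : F.tr (w + w') (h' - h) = 0 := by
    rw [hc] at hc2
    unfold tr at hc2 ⊢; linear_combination (norm := module) hc2
  have hkper : ∀ n : ℤ, F.tr (n * (w + w')) (n * (h' - h)) = 0 := fun n => by
    rw [tr_mul, hper, smul_zero]
  have E := (H'.reflect hy).exchange_annulus_tall (k := k) hz.reflect (H.reflect hx)
    (by rw [hc, reflect_tr, add_assoc, tr_add]; simp [tr_zero])
    (by
      rw [hc, reflect_tr, reflect_tr]
      unfold tr at hper ⊢; linear_combination (norm := module) -hper) hlt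
      (by linarith) (by linarith)
  have E' := E.reflect hz.reflect
  rw [reflect_reflect] at E'
  subst hc
  convert E' using 1
  · have := hkper k
    simp only [reflect_tr]
    unfold tr at this ⊢; linear_combination (norm := module) this
  · ring
  · have := hkper (k - 1)
    simp only [reflect_tr]
    unfold tr at this ⊢; linear_combination (norm := module) this
  · ring
  · ring

end Good
end Frame

/-! ### Exchanging two consecutive rectangles -/

/-- A rectangle with integral sides in a group `T` with a frame. -/
@[ext]
structure Box (T : Type*) where
  corner : T
  w : ℤ
  h : ℤ

/-- The same rectangle after a reflection in the diagonal. -/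
def Box.transpose {T : Type*} (b : Box T) : Box T := ⟨b.corner, b.h, b.w⟩

namespace Frame

variable {T : Type*} [AddCommGroup T] {M : ℕ} (F : Frame T M)

/-- `b` is an empty rectangle from `x` to `y`. -/
abbrev GoodBox (x y : Set T) (b : Box T) : Prop := F.Good x y b.corner b.w b.h

open Classical in
/-- The multiplicity of a box at a cell. -/
def count (b : Box T) (v : T) : ℕ :=
  ∑ i ∈ Finset.range b.w.toNat, ∑ j ∈ Finset.range b.h.toNat,
    if b.corner + F.tr i j = v then 1 else 0

theorem count_transpose (b : Box T) (v : T) : F.transpose.count b.transpose v = F.count b v := by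
  unfold count
  rw [Finset.sum_comm]
  refine Finset.sum_congr rfl fun i _ => Finset.sum_congr rfl fun j _ => ?_
  have : F.transpose.tr j i = F.tr i j := F.transpose_tr j i
  classical exact if_congr (by rw [← this]; rfl) rfl rfl

/-- The second box starts at the lower right corner of the first one. -/
def IsRight (b b' : Box T) : Prop := b'.corner = b.corner + F.tr b.w 0

/-- The second box ends at the upper left corner of the first one. -/
def IsLeft (b b' : Box T) : Prop := b'.corner + F.tr b'.w b'.h = b.corner + F.tr 0 b.h

/-- Two boxes side by side, sharing a corner. -/
def Beside (b b' : Box T) : Prop := F.IsRight b b' ∨ F.IsLeft b b'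

/-- Two boxes above each other, sharing a corner. -/
def Stacked (b b' : Box T) : Prop := F.transpose.Beside b.transpose b'.transpose

/-- The two boxes form a horizontal annulus. -/
def Annulus (b b' : Box T) : Prop := F.IsRight b b' ∧ F.IsLeft b b' ∧ b.h = b'.h

open Classical in
/-- The other decomposition of the union of two boxes that are side by side. Boxes sharing both
corners form an annulus bounded by staircases, with period `(l₁, l₂)` up to the sign of `l₂`, and
`k` counts the periods that the horizontal cut passes. -/
def exchangeBeside (b b' : Box T) : Box T × Box T :=
  if F.IsLeft b b' then
    if F.IsRight b b' then
      if b.h < b'.h then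
        let l₁ := b.w + b'.w
        let l₂ := b'.h - b.h
        let k := b.h / l₂ + 1
        (⟨b.corner + F.tr b.w b.h, k * l₁ - b.w, k * l₂ - b.h⟩,
          ⟨b.corner + F.tr b.w (k * l₂), (k + 1) * l₁ - b.w, b'.h - k * l₂⟩)
      else
        let l₁ := b.w + b'.w
        let l₂ := b.h - b'.h
        let k := b.h / l₂
        (⟨b.corner, k * l₁ + b.w, b.h - k * l₂⟩,
          ⟨b.corner + F.tr 0 (b.h - k * l₂), (k - 1) * l₁ + b.w, (k + 1) * l₂ - b.h⟩)
    else
      if b.h < b'.h then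
        (⟨b'.corner, b'.w, b'.h - b.h⟩, ⟨b'.corner + F.tr 0 (b'.h - b.h), b.w + b'.w, b.h⟩)
      else
        (⟨b'.corner, b.w + b'.w, b'.h⟩, ⟨b.corner, b.w, b.h - b'.h⟩)
  else
    if b.h < b'.h then
      (⟨b.corner + F.tr b.w b.h, b'.w, b'.h - b.h⟩, ⟨b.corner, b.w + b'.w, b.h⟩)
    else
      (⟨b.corner, b.w + b'.w, b'.h⟩, ⟨b.corner + F.tr 0 b'.h, b.w, b.h - b'.h⟩)

open Classical in
/-- The other decomposition of the union of two consecutive boxes. Boxes above each other are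
reflected in the diagonal, and boxes without a common corner are applied in the opposite order. -/
def exchange (b b' : Box T) : Box T × Box T :=
  if F.Beside b b' then F.exchangeBeside b b'
  else if F.Stacked b b' then
    let e := F.transpose.exchangeBeside b.transpose b'.transpose
    (e.1.transpose, e.2.transpose)
  else (b', b)

/-- A discrete indefinite integral. -/
theorem exists_antidifference (f : ℤ → ℤ) : ∃ P : ℤ → ℤ, ∀ n, P (n + 1) = P n + f n := by
  refine ⟨fun n => ∑ i ∈ Finset.Ico 0 n, f i - ∑ i ∈ Finset.Ico n 0, f i, fun n => ?_⟩
  beta_reduce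
  rcases le_or_gt 0 n with hn | hn
  · rw [← Finset.insert_Ico_right_eq_Ico_add_one hn, Finset.sum_insert (by simp)]
    rw [Finset.Ico_eq_empty (by omega : ¬ n + 1 < 0), Finset.Ico_eq_empty (by omega : ¬ n < 0)]
    ring
  · rw [Finset.Ico_eq_empty (by omega : ¬ (0:ℤ) < n + 1),
      Finset.Ico_eq_empty (by omega : ¬ (0:ℤ) < n),
      ← Finset.insert_Ico_add_one_left_eq_Ico hn, Finset.sum_insert (by simp)]
    ring

/-- The multiplicities of boxes at a fixed cell are mixed second differences of one function. -/
theorem exists_potential (c v : T) : ∃ G : ℤ → ℤ → ℤ, ∀ a b a' b' : ℤ, a ≤ a' → b ≤ b' →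
    (F.count ⟨c + F.tr a b, a' - a, b' - b⟩ v : ℤ) = G a' b' - G a b' - G a' b + G a b := by
  classical
  choose P hP using fun i : ℤ =>
    exists_antidifference (fun j => if c + F.tr i j = v then 1 else 0)
  choose Q hQ using fun j : ℤ => exists_antidifference (fun i => P i j)
  have sum_eq : ∀ (f p : ℤ → ℤ), (∀ n, p (n + 1) = p n + f n) → ∀ (a : ℤ) (n : ℕ),
      ∑ i ∈ Finset.range n, f (a + i) = p (a + n) - p a := by
    intro f p hp a n
    induction n with
    | zero => simp
    | succ n ih =>
      rw [Finset.sum_range_succ, ih, Nat.cast_succ, ← add_assoc, hp]; ring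
  refine ⟨fun a b => Q b a, fun a b a' b' ha hb => ?_⟩
  obtain ⟨w, rfl⟩ : ∃ w : ℕ, a' = a + w := ⟨(a' - a).toNat, by omega⟩
  obtain ⟨h, rfl⟩ : ∃ h : ℕ, b' = b + h := ⟨(b' - b).toNat, by omega⟩
  unfold count
  simp only [add_sub_cancel_left, Int.toNat_natCast, add_assoc c, tr_add]
  push_cast
  have : ∀ i : ℕ, ∑ j ∈ Finset.range h, (if c + F.tr (a + i) (b + j) = v then (1 : ℤ) else 0) =
      P (a + i) (b + h) - P (a + i) b := fun i => sum_eq _ _ (hP (a + i)) b h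
  rw [Finset.sum_congr rfl fun i _ => this i, Finset.sum_sub_distrib,
    sum_eq _ _ (hQ (b + h)) a w, sum_eq _ _ (hQ b) a w]
  ring

variable {F} {x y z : Set T} {b b' : Box T}

theorem not_beside_of_stacked (hx : F.Generic x) (H : F.GoodBox x y b) (H' : F.GoodBox y z b')
    (hs : F.Stacked b b') : ¬ F.Beside b b' := by
  have hy := H.generic hx
  have nw := H.w_ne
  have nh := H.h_ne
  have nw' := H'.w_ne
  have nh' := H'.h_ne
  simp only [Stacked, Beside, IsRight, IsLeft, transpose_tr, Box.transpose] at hs ⊢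
  rintro (h1 | h1) <;> rcases hs with h2 | h2
  · rw [h1] at h2
    exact nw (by simpa [col_tr] using congrArg F.col h2)
  · rw [← h1] at h2
    exact nw' (by simpa [col_tr] using congrArg F.col h2)
  · rw [h2] at h1
    exact nw' (by simpa [col_tr] using congrArg F.col h1)
  · rw [h2] at h1
    exact nw (by simpa [col_tr] using congrArg F.col h1)

/-- The definition of `exchange` prefers boxes side by side to boxes above each other, so it commutes
with the transposition only if the boxes are not both. -/
theorem exchange_transpose (hn : F.Stacked b b' → ¬ F.Beside b b') :
    F.transpose.exchange b.transpose b'.transpose =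
      ((F.exchange b b').1.transpose, (F.exchange b b').2.transpose) := by
  unfold exchange
  have e1 : F.transpose.Stacked b.transpose b'.transpose = F.Beside b b' := rfl
  have e2 : F.transpose.Beside b.transpose b'.transpose = F.Stacked b b' := rfl
  rw [e1, e2]
  by_cases h1 : F.Stacked b b'
  · rw [if_pos h1, if_neg (hn h1), if_pos h1]; rfl
  · rw [if_neg h1, if_neg h1]
    by_cases h2 : F.Beside b b'
    · rw [if_pos h2, if_pos h2]; rfl
    · rw [if_neg h2, if_neg h2]

end Frame

/-! ### Properties of the exchange -/

namespace Frame

variable {T : Type*} [AddCommGroup T] {M : ℕ} {F : Frame T M} {x y z : Set T} {b b' : Box T}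

/-- The two ways to cut an annulus bounded by ascending staircases cover the same cells. In terms of
the potential, the cut can be moved along the annulus one period at a time. -/
theorem count_annulus_tall (c v : T) {w h L l k : ℤ} (w0 : 0 ≤ w) (h0 : 0 ≤ h) (wL : w ≤ L)
    (l0 : 0 < l) (hper : F.tr L l = 0) (hk1 : (k - 1) * l < h) (hk2 : h < k * l) :
    F.count ⟨c, w, h⟩ v + F.count ⟨c + F.tr w 0, L - w, h + l⟩ v =
      F.count ⟨c + F.tr w h, k * L - w, k * l - h⟩ v +
        F.count ⟨c + F.tr w (k * l), (k + 1) * L - w, h + l - k * l⟩ v := by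
  obtain ⟨G, hG⟩ := F.exists_potential c v
  have k1 : 1 ≤ k := by
    by_contra hc
    have : k * l ≤ 0 * l := mul_le_mul_of_nonneg_right (by omega) l0.le
    omega
  have kL : L ≤ k * L := by nlinarith
  -- the mixed differences of `G` are invariant under the period
  have shift : ∀ a b a' b' : ℤ, a ≤ a' → b ≤ b' →
      G (a' + L) (b' + l) - G (a + L) (b' + l) - G (a' + L) (b + l) + G (a + L) (b + l) =
        G a' b' - G a b' - G a' b + G a b := by
    intro a b a' b' ha hb
    rw [← hG _ _ _ _ ha hb, ← hG _ _ _ _ (by omega) (by omega), ← F.tr_add, hper, add_zero]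
    congr 3 <;> ring
  have ind : ∀ n : ℕ, ((n : ℤ) - 1) * l < h →
      G (n * L) (n * l) - G (n * L) h - G ((n + 1) * L) (n * l) + G ((n + 1) * L) (h + l) =
        G 0 0 - G 0 h - G L 0 + G L (h + l) := by
    intro n
    induction n with
    | zero => simp
    | succ n ih =>
      intro hn
      push_cast at hn ⊢
      rw [← ih (by nlinarith)]
      have := shift (n * L) (n * l) ((n + 1) * L) h (by nlinarith) (by nlinarith)
      rw [show (n : ℤ) * L + L = (n + 1) * L by ring, show (n : ℤ) * l + l = (n + 1) * l by ring,
        show ((n : ℤ) + 1) * L + L = (n + 1 + 1) * L by ring] at this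
      linarith
  have i1 := ind k.toNat (by rwa [Int.toNat_of_nonneg (by omega)])
  rw [Int.toNat_of_nonneg (by omega)] at i1
  have g1 := hG 0 0 w h w0 h0
  have g2 := hG w 0 L (h + l) wL (by omega)
  have g3 := hG w h (k * L) (k * l) (by omega) (by omega)
  have g4 := hG w (k * l) ((k + 1) * L) (h + l) (by linarith) (by linarith)
  rw [F.tr_zero, add_zero, sub_zero, sub_zero] at g1
  rw [sub_zero] at g2
  zify
  linarith

/-- The two ways to cut an annulus bounded by descending staircases cover the same cells. -/
theorem count_annulus_short (c v : T) {w h L l k : ℤ} (w0 : 0 ≤ w) (wL : w ≤ L)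
    (l0 : 0 < l) (lh : l < h) (hper : F.tr L (-l) = 0) (hk1 : k * l < h)
    (hk2 : h < (k + 1) * l) :
    F.count ⟨c, w, h⟩ v + F.count ⟨c + F.tr w 0, L - w, h - l⟩ v =
      F.count ⟨c, k * L + w, h - k * l⟩ v +
        F.count ⟨c + F.tr 0 (h - k * l), (k - 1) * L + w, (k + 1) * l - h⟩ v := by
  obtain ⟨G, hG⟩ := F.exists_potential c v
  have k1 : 1 ≤ k := by
    by_contra hc
    have : (k + 1) * l ≤ 1 * l := mul_le_mul_of_nonneg_right (by omega) l0.le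
    omega
  have kL : 0 ≤ (k - 1) * L := mul_nonneg (by omega) (by omega)
  -- the mixed differences of `G` are invariant under the period
  have shift : ∀ a b a' b' : ℤ, a ≤ a' → b ≤ b' →
      G (a' + L) (b' - l) - G (a + L) (b' - l) - G (a' + L) (b - l) + G (a + L) (b - l) =
        G a' b' - G a b' - G a' b + G a b := by
    intro a b a' b' ha hb
    rw [← hG _ _ _ _ ha hb, ← hG _ _ _ _ (by omega) (by omega), sub_eq_add_neg b l, ← F.tr_add,
      hper, add_zero]
    congr 3 <;> ring
  have ind : ∀ n : ℕ, ((n : ℤ) + 1) * l < h →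
      G ((n + 1) * L + w) (h - (n + 1) * l) - G ((n + 1) * L + w) 0 + G (n * L + w) l -
        G (n * L + w) (h - (n + 1) * l) =
      G (L + w) (h - l) - G (L + w) 0 + G w l - G w (h - l) := by
    intro n
    induction n with
    | zero => simp
    | succ n ih =>
      intro hn
      push_cast at hn ⊢
      rw [← ih (by nlinarith)]
      have := shift (n * L + w) l ((n + 1) * L + w) (h - (n + 1) * l) (by nlinarith)
        (by nlinarith)
      rw [show (n : ℤ) * L + w + L = (n + 1) * L + w by ring,
        show h - ((n : ℤ) + 1) * l - l = h - (n + 1 + 1) * l by ring,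
        show ((n : ℤ) + 1) * L + w + L = (n + 1 + 1) * L + w by ring, sub_self] at this
      linarith
  have i1 := ind (k - 1).toNat (by rw [Int.toNat_of_nonneg (by omega)]; linarith)
  rw [Int.toNat_of_nonneg (by omega), sub_add_cancel] at i1
  have i0 := shift 0 l w h w0 lh.le
  rw [zero_add, sub_self, add_comm w L] at i0
  have g1 := hG 0 0 w h w0 (by omega)
  have g2 := hG w 0 L (h - l) wL (by omega)
  have g3 := hG 0 0 (k * L + w) (h - k * l) (by nlinarith) (by omega)
  have g4 := hG 0 (h - k * l) ((k - 1) * L + w) l (by omega) (by linarith)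
  rw [F.tr_zero, add_zero, sub_zero, sub_zero] at g1 g3
  rw [sub_zero] at g2 g4
  rw [show l - (h - k * l) = (k + 1) * l - h by ring] at g4
  zify
  linarith

/-- The properties of an exchange: it gives another decomposition, with another intermediate
generator, of the same domain, it is involutive and does not lead to annuli. -/
structure IsExchange (F : Frame T M) (x y z : Set T) (b b' e e' : Box T) : Prop where
  exchange : F.Exchange x y z e.corner e.w e.h e'.corner e'.w e'.h
  eq : F.exchange e e' = (b, b')
  annulus : ¬ F.Annulus e e'
  annulus_transpose : ¬ F.transpose.Annulus e.transpose e'.transpose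
  count : ∀ v, F.count b v + F.count b' v = F.count e v + F.count e' v

/-- The exchange of two boxes side by side yields boxes above each other, for which the exchange is
defined by transposition. -/
theorem isExchange_of_stacked (hx : F.Generic x) {e e' : Box T}
    (E : F.Exchange x y z e.corner e.w e.h e'.corner e'.w e'.h)
    (hs : F.Stacked e e') (hne : e.w ≠ e'.w)
    (eq : F.transpose.exchangeBeside e.transpose e'.transpose = (b.transpose, b'.transpose))
    (count : ∀ v, F.count b v + F.count b' v = F.count e v + F.count e' v) :
    F.IsExchange x y z b b' e e' := by
  obtain ⟨y', h1, h2, h3⟩ := id E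
  have hnb := not_beside_of_stacked hx h2 h3 hs
  refine ⟨E, ?_, fun h => hnb (Or.inl h.1), fun h => hne h.2.2, count⟩
  rw [Frame.exchange, if_neg hnb, if_pos hs, eq]
  rfl

/-- Boxes side by side, by cases: they share both corners or only one, which lies on the right or on
the left, and the second box is taller or shorter. -/
theorem isExchange_exchangeBeside (hx : F.Generic x) (H : F.GoodBox x y b)
    (H' : F.GoodBox y z b') (hb : F.Beside b b') (hna : ¬ F.Annulus b b') :
    F.IsExchange x y z b b' (F.exchangeBeside b b').1 (F.exchangeBeside b b').2 := by
  have hy := H.generic hx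
  obtain ⟨c, w, h⟩ := b
  obtain ⟨c', w', h'⟩ := b'
  have w0 : 0 < w := H.w_pos
  have h0 : 0 < h := H.h_pos
  have w0' : 0 < w' := H'.w_pos
  have h0' : 0 < h' := H'.h_pos
  have nw : (w : ZMod M) ≠ 0 := H.w_ne
  have nh : (h : ZMod M) ≠ 0 := H.h_ne
  have nw' : (w' : ZMod M) ≠ 0 := H'.w_ne
  have nh' : (h' : ZMod M) ≠ 0 := H'.h_ne
  change F.Good x y c w h at H
  change F.Good y z c' w' h' at H'
  unfold exchangeBeside
  by_cases hl : F.IsLeft ⟨c, w, h⟩ ⟨c', w', h'⟩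
  · rw [if_pos hl]
    by_cases hr : F.IsRight ⟨c, w, h⟩ ⟨c', w', h'⟩
    · rw [if_pos hr]
      have hne : h ≠ h' := fun e => hna ⟨hr, hl, e⟩
      change c' = c + F.tr w 0 at hr
      change c' + F.tr w' h' = c + F.tr 0 h at hl
      have hper : F.tr (w + w') (h' - h) = 0 := by
        rw [hr] at hl
        unfold tr at hl ⊢; linear_combination (norm := module) hl
      have cl2 : ((h' - h : ℤ) : ZMod M) = 0 := by rw [← F.row_tr (w + w'), hper, map_zero]
      by_cases hlt : h < h'
      · rw [if_pos hlt]
        simp only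
        have l0 : 0 < h' - h := by omega
        have hn := Int.emod_add_mul_ediv h (h' - h)
        have hρ0 := Int.emod_nonneg h l0.ne'
        have hρ1 := Int.emod_lt_of_pos h l0
        have hρ2 : h % (h' - h) ≠ 0 := by
          intro e
          rw [e, zero_add] at hn
          exact nh (by rw [← hn]; push_cast at cl2 ⊢; rw [cl2, zero_mul])
        obtain ⟨k, hk⟩ : ∃ k, k = h / (h' - h) + 1 := ⟨_, rfl⟩
        rw [← hk]
        obtain ⟨n, hnk⟩ : ∃ n, n = h / (h' - h) := ⟨_, rfl⟩
        rw [← hnk] at hk hn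
        have hρ3 := lt_of_le_of_ne hρ0 (Ne.symm hρ2)
        have hk1 : (k - 1) * (h' - h) < h := by rw [hk]; linarith [hn, mul_comm n (h' - h)]
        have hk2 : h < k * (h' - h) := by rw [hk]; linarith [hn, mul_comm n (h' - h)]
        refine isExchange_of_stacked hx (H.exchange_annulus_tall hx H' hr hl hlt hk1 hk2) ?_ ?_
          ?_ ?_
        · refine Or.inl ?_
          simp only [IsRight, Box.transpose, transpose_tr, add_assoc, tr_add]
          congr 2 <;> ring
        · intro e; linarith
        · rw [exchangeBeside, if_pos, if_pos, if_pos]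
          · have ek : (k * (w + w') - w) / ((k + 1) * (w + w') - w - (k * (w + w') - w)) + 1 = k := by
              rw [show (k + 1) * (w + w') - w - (k * (w + w') - w) = w + w' by ring]
              have : (k * (w + w') - w) / (w + w') = k - 1 := by
                rw [Int.ediv_eq_iff_of_pos (by omega)]
                constructor <;> linarith
              rw [this]; ring
            simp only [Box.transpose, transpose_tr, ek]
            ext
            · simp only [add_assoc, tr_add]
              rw [add_eq_left, ← smul_zero k, ← hper, ← tr_mul]
              congr 1 <;> ring
            · simp only; ring
            · simp only; ring
            · rw [hr]
              simp only [add_assoc, tr_add]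
              have := F.tr_mul k (w + w') (h' - h)
              rw [hper, smul_zero] at this
              rw [← add_zero (F.tr w 0), ← this, tr_add]
              congr 2 <;> ring
            · simp only; ring
            · simp only; ring
          · simp only [Box.transpose]; linarith
          · simp only [IsRight, Box.transpose, transpose_tr, add_assoc, tr_add]
            congr 2 <;> ring
          · simp only [IsLeft, Box.transpose, transpose_tr, add_assoc, tr_add]
            symm
            rw [← add_zero (F.tr (w + _) _), ← hper, tr_add]
            congr 2 <;> ring
        · intro v
          have := count_annulus_tall (F := F) c v (k := k) w0.le h0.le (by omega : w ≤ w + w') l0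
            hper hk1 hk2
          rw [hr]
          convert this using 4 <;> ring
      · rw [if_neg hlt]
        simp only
        have l0 : 0 < h - h' := by omega
        have hn := Int.emod_add_mul_ediv h (h - h')
        have hρ0 := Int.emod_nonneg h l0.ne'
        have hρ1 := Int.emod_lt_of_pos h l0
        have hρ2 : h % (h - h') ≠ 0 := by
          intro e
          rw [e, zero_add] at hn
          push_cast at cl2
          have cl3 : (h : ZMod M) - h' = 0 := by rw [← neg_sub, cl2, neg_zero]
          exact nh (by rw [← hn]; push_cast; rw [cl3, zero_mul])
        obtain ⟨k, hk⟩ : ∃ k, k = h / (h - h') := ⟨_, rfl⟩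
        rw [← hk] at hn ⊢
        have hρ3 := lt_of_le_of_ne hρ0 (Ne.symm hρ2)
        have hk1 : k * (h - h') < h := by linarith [hn, mul_comm k (h - h')]
        have hk2 : h < (k + 1) * (h - h') := by linarith [hn, mul_comm k (h - h')]
        refine isExchange_of_stacked hx
          (H.exchange_annulus_short hx H' hr hl (by omega) hk1 hk2) ?_ ?_ ?_ ?_
        · refine Or.inl ?_
          simp only [IsRight, Box.transpose, transpose_tr]
        · intro e; linarith
        · rw [exchangeBeside, if_pos, if_pos, if_neg]
          · have ek : (k * (w + w') + w) / (k * (w + w') + w - ((k - 1) * (w + w') + w)) = k := by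
              rw [show k * (w + w') + w - ((k - 1) * (w + w') + w) = w + w' by ring]
              rw [Int.ediv_eq_iff_of_pos (by omega)]
              constructor <;> linarith
            simp only [Box.transpose, transpose_tr, ek]
            ext
            · rfl
            · simp only; ring
            · simp only; ring
            · rw [hr]
              simp only
              congr 2; ring
            · simp only; ring
            · simp only; ring
          · simp only [Box.transpose]; linarith
          · simp only [IsRight, Box.transpose, transpose_tr]
          · simp only [IsLeft, Box.transpose, transpose_tr, add_assoc, tr_add]
            rw [← add_zero (F.tr (0 + _) _), ← hper, tr_add]
            congr 2 <;> ring
        · intro v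
          have := count_annulus_short (F := F) c v (k := k) w0.le (by omega : w ≤ w + w') l0
            (by omega) (by rw [neg_sub]; exact hper) hk1 hk2
          rw [hr]
          convert this using 4 <;> ring
    · rw [if_neg hr]
      change c' ≠ c + F.tr w 0 at hr
      change c' + F.tr w' h' = c + F.tr 0 h at hl
      have hl' : c = c' + F.tr w' (h' - h) := by
        unfold tr at hl ⊢; linear_combination (norm := module) -hl
      have hhne : h ≠ h' := by
        rintro rfl
        refine hr (hy.2 _ H'.ll _ ((H.mem _).2 (Or.inr (Or.inl rfl))) ?_)
        have := congrArg F.row hl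
        simp only [map_add, row_tr] at this ⊢
        simpa using this
      by_cases hlt : h < h'
      · rw [if_pos hlt]
        refine isExchange_of_stacked hx (H.exchange_left_tall hx H' hr hl hlt) ?_ ?_ ?_ ?_
        · refine Or.inl ?_
          simp only [IsRight, Box.transpose, transpose_tr]
        · simp only; omega
        · rw [exchangeBeside, if_neg, if_pos]
          · simp only [Box.transpose, transpose_tr]
            ext <;> simp [hl']
          · simp only [Box.transpose]; omega
          · simp only [IsLeft, Box.transpose, transpose_tr, add_assoc, tr_add]
            intro e
            have := congrArg F.col e
            simp [col_tr] at this
            exact nw this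
        · intro v
          obtain ⟨G, hG⟩ := F.exists_potential c' v
          have g1 := hG w' (h' - h) (w' + w) h' (by omega) (by omega)
          have g2 := hG 0 0 w' h' (by omega) (by omega)
          have g3 := hG 0 0 w' (h' - h) (by omega) (by omega)
          have g4 := hG 0 (h' - h) (w' + w) h' (by omega) (by omega)
          rw [F.tr_zero, add_zero, sub_zero, sub_zero] at g2 g3
          rw [← hl', add_sub_cancel_left, sub_sub_cancel] at g1
          rw [sub_zero, sub_sub_cancel, add_comm w' w] at g4
          rw [add_comm w' w] at g1
          zify; linarith
      · rw [if_neg hlt]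
        have hgt : h' < h := by omega
        refine isExchange_of_stacked hx (H.exchange_left_short hx H' hr hl hgt) ?_ ?_ ?_ ?_
        · refine Or.inr ?_
          simp only [IsLeft, Box.transpose, transpose_tr]
          unfold tr at hl ⊢; linear_combination (norm := module) -hl
        · simp only; omega
        · rw [exchangeBeside, if_pos, if_neg, if_neg]
          · simp only [Box.transpose]
            ext <;> simp
          · simp only [Box.transpose]; omega
          · simp only [IsRight, Box.transpose, transpose_tr]
            intro e
            rw [hl'] at e
            have := congrArg F.col e
            simp [col_tr] at this
            exact nw' this
          · simp only [IsLeft, Box.transpose, transpose_tr]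
            unfold tr at hl ⊢; linear_combination (norm := module) -hl
        · intro v
          obtain ⟨G, hG⟩ := F.exists_potential c v
          have g1 := hG 0 0 w h (by omega) (by omega)
          have g2 := hG (-w') (h - h') 0 h (by omega) (by omega)
          have g3 := hG (-w') (h - h') w h (by omega) (by omega)
          have g4 := hG 0 0 w (h - h') (by omega) (by omega)
          have e : c + F.tr (-w') (h - h') = c' := by
            unfold tr at hl ⊢; linear_combination (norm := module) -hl
          rw [F.tr_zero, add_zero, sub_zero, sub_zero] at g1 g4
          rw [e, sub_sub_cancel, sub_neg_eq_add] at g2 g3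
          rw [zero_add] at g2
          zify; linarith
  · rw [if_neg hl]
    have hr : F.IsRight ⟨c, w, h⟩ ⟨c', w', h'⟩ := hb.resolve_right hl
    change c' = c + F.tr w 0 at hr
    change c' + F.tr w' h' ≠ c + F.tr 0 h at hl
    have hhne : h ≠ h' := by
      rintro rfl
      refine hl (hy.2 _ H'.ur _ ((H.mem _).2 (Or.inr (Or.inr rfl))) ?_)
      simp [row_tr, hr]
    by_cases hlt : h < h'
    · rw [if_pos hlt]
      refine isExchange_of_stacked hx (H.exchange_right_tall hx H' hr hl hlt) ?_ ?_ ?_ ?_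
      · refine Or.inr ?_
        simp only [IsLeft, Box.transpose, transpose_tr, add_assoc, tr_add]
        congr 2; ring
      · simp only; omega
      · rw [exchangeBeside, if_pos, if_neg, if_pos]
        · simp only [Box.transpose, transpose_tr, hr]
          ext <;> simp
        · simp only [Box.transpose]; omega
        · simp only [IsRight, Box.transpose, transpose_tr, add_assoc, tr_add]
          intro e
          have := congrArg F.col e
          simp [col_tr] at this
          exact nw this
        · simp only [IsLeft, Box.transpose, transpose_tr, add_assoc, tr_add]
          congr 2; ring
      · intro v
        obtain ⟨G, hG⟩ := F.exists_potential c v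
        have g1 := hG 0 0 w h (by omega) (by omega)
        have g2 := hG w 0 (w + w') h' (by omega) (by omega)
        have g3 := hG w h (w + w') h' (by omega) (by omega)
        have g4 := hG 0 0 (w + w') h (by omega) (by omega)
        rw [F.tr_zero, add_zero, sub_zero, sub_zero] at g1 g4
        rw [← hr, add_sub_cancel_left, sub_zero] at g2
        rw [add_sub_cancel_left] at g3
        zify; linarith
    · rw [if_neg hlt]
      have hgt : h' < h := by omega
      refine isExchange_of_stacked hx (H.exchange_right_short hx H' hr hl hgt) ?_ ?_ ?_ ?_
      · refine Or.inl ?_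
        simp only [IsRight, Box.transpose, transpose_tr]
      · simp only; omega
      · rw [exchangeBeside, if_neg, if_neg]
        · simp only [Box.transpose, transpose_tr, hr]
          ext <;> simp
        · simp only [Box.transpose]; omega
        · simp only [IsLeft, Box.transpose, transpose_tr, add_assoc, tr_add]
          intro e
          have := congrArg F.col e
          simp [col_tr] at this
          exact nw' this
      · intro v
        obtain ⟨G, hG⟩ := F.exists_potential c v
        have g1 := hG 0 0 w h (by omega) (by omega)
        have g2 := hG w 0 (w + w') h' (by omega) (by omega)
        have g3 := hG 0 0 (w + w') h' (by omega) (by omega)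
        have g4 := hG 0 h' w h (by omega) (by omega)
        rw [F.tr_zero, add_zero, sub_zero, sub_zero] at g1 g3
        rw [← hr, add_sub_cancel_left, sub_zero] at g2
        rw [sub_zero] at g4
        zify; linarith

/-- Two consecutive empty rectangles which form neither a horizontal nor a vertical annulus can be
exchanged. -/
theorem isExchange_exchange (hx : F.Generic x) (H : F.GoodBox x y b) (H' : F.GoodBox y z b')
    (h1 : ¬ F.Annulus b b') (h2 : ¬ F.transpose.Annulus b.transpose b'.transpose) :
    F.IsExchange x y z b b' (F.exchange b b').1 (F.exchange b b').2 := by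
  by_cases hb : F.Beside b b'
  · rw [exchange, if_pos hb]
    exact isExchange_exchangeBeside hx H H' hb h1
  by_cases hs : F.Stacked b b'
  · rw [exchange, if_neg hb, if_pos hs]
    have E := isExchange_exchangeBeside hx.transpose H.transpose H'.transpose hs h2
    obtain ⟨e, he⟩ : ∃ e, e = F.transpose.exchangeBeside b.transpose b'.transpose := ⟨_, rfl⟩
    rw [← he] at E ⊢
    obtain ⟨E1, E2, E3, E4, E5⟩ := E
    have E1' := E1.transpose
    refine ⟨E1', ?_, E4, E3, fun v => ?_⟩
    · obtain ⟨y', -, g1, g2⟩ := E1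
      have := exchange_transpose (F := F.transpose) (b := e.1) (b' := e.2)
        (not_beside_of_stacked hx.transpose g1 g2)
      rw [E2] at this
      exact this
    · have := E5 v
      rw [← F.count_transpose b, ← F.count_transpose b', ← F.count_transpose e.1.transpose,
        ← F.count_transpose e.2.transpose]
      exact this
  · rw [exchange, if_neg hb, if_neg hs]
    have h3 : b'.corner ≠ b.corner + F.tr b.w 0 := fun e => hb (Or.inl e)
    have h4 : b'.corner + F.tr b'.w b'.h ≠ b.corner + F.tr 0 b.h := fun e => hb (Or.inr e)
    have h5 : b'.corner ≠ b.corner + F.tr 0 b.h := fun e =>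
      hs (Or.inl (by simp only [IsRight, Box.transpose, transpose_tr]; exact e))
    have h6 : b'.corner + F.tr b'.w b'.h ≠ b.corner + F.tr b.w 0 := fun e =>
      hs (Or.inr (by simp only [IsLeft, Box.transpose, transpose_tr]; exact e))
    have E := H.exchange_disjoint hx H' h3 h5 h6 h4
    obtain ⟨y', hy', g1, g2⟩ := id E
    -- the corners of `b'` lie in `x`, the new corners of `b` do not
    have key : ¬ F.Beside b' b ∧ ¬ F.Stacked b' b := by
      have n1 := g1.ll_notMem
      have n2 := g1.ur_notMem
      have l1 := (g1.mem (b'.corner + F.tr b'.w 0)).2 (Or.inr (Or.inl rfl))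
      have l2 := (g1.mem (b'.corner + F.tr 0 b'.h)).2 (Or.inr (Or.inr rfl))
      have hx1 := g1.lr_notMem hx
      have hx2 := g1.ul_notMem hx
      have m1 := H.ll
      have m2 := H.ur
      constructor
      · rintro (e | e)
        · exact hx1 (e ▸ m1)
        · exact hx2 (e ▸ m2)
      · rintro (e | e)
        · simp only [IsRight, Box.transpose, transpose_tr] at e
          exact hx2 (e ▸ m1)
        · simp only [IsLeft, Box.transpose, transpose_tr] at e
          exact hx1 (e ▸ m2)
    refine ⟨E, ?_, fun h => key.1 (Or.inl h.1), fun h => key.2 (Or.inl h.1), fun v => ?_⟩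
    · rw [exchange, if_neg key.1, if_neg key.2]
    · exact add_comm _ _

end Frame

/-! ### Annuli -/

namespace Frame

variable {T : Type*} [AddCommGroup T] {M : ℕ}

/-- Horizontal and vertical lines close up after exactly `n` steps, and two points on the same
horizontal or vertical line of the grid differ by a step along it. -/
structure IsClosed (F : Frame T M) (n : ℕ) : Prop where
  tr_left : ∀ a : ℤ, F.tr a 0 = 0 ↔ (n : ℤ) ∣ a
  tr_right : ∀ b : ℤ, F.tr 0 b = 0 ↔ (n : ℤ) ∣ b
  row_ker : ∀ v, F.row v = 0 → ∃ a, v = F.tr a 0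
  col_ker : ∀ v, F.col v = 0 → ∃ b, v = F.tr 0 b

theorem IsClosed.transpose {F : Frame T M} {n : ℕ} (hF : F.IsClosed n) :
    F.transpose.IsClosed n where
  tr_left a := by rw [transpose_tr]; exact hF.tr_right a
  tr_right a := by rw [transpose_tr]; exact hF.tr_left a
  row_ker v hv := by
    obtain ⟨b, hb⟩ := hF.col_ker v hv
    exact ⟨b, by rwa [transpose_tr]⟩
  col_ker v hv := by
    obtain ⟨b, hb⟩ := hF.row_ker v hv
    exact ⟨b, by rwa [transpose_tr]⟩

variable {F : Frame T M} {n : ℕ} {x y z : Set T} {b b' : Box T}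

theorem IsClosed.exists_of_row_eq (hF : F.IsClosed n) (hn : 0 < n) {u v : T}
    (h : F.row v = F.row u) : ∃ a : ℤ, 0 ≤ a ∧ a < n ∧ v = u + F.tr a 0 := by
  obtain ⟨a, ha⟩ := hF.row_ker (v - u) (by rw [map_sub, h, sub_self])
  have hn' : (0 : ℤ) < n := by exact_mod_cast hn
  refine ⟨a % n, Int.emod_nonneg _ hn'.ne', Int.emod_lt_of_pos _ hn', ?_⟩
  have h1 : F.tr (n * (a / n)) 0 = 0 := (hF.tr_left _).2 (dvd_mul_right _ _)
  rw [← sub_eq_iff_eq_add', ha, ← add_zero (F.tr (a % n) 0), ← h1, tr_add,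
    Int.emod_add_mul_ediv, add_zero]

theorem IsClosed.cast_eq_zero (hF : F.IsClosed n) : (n : ZMod M) = 0 := by
  have h := (hF.tr_left n).2 dvd_rfl
  have := congrArg F.col h
  simpa [col_tr] using this

/-- A horizontal annulus formed by empty rectangles has height one. -/
theorem Annulus.eq (hF : F.IsClosed n) (hx : F.Generic x)
    (hrow : ∀ r, ∃ v ∈ x, F.row v = r) (H : F.GoodBox x y b) (H' : F.GoodBox y z b')
    (hw : b.w < n) (hw' : b'.w < n) (ha : F.Annulus b b') :
    b.h = 1 ∧ b.w + b'.w = n ∧ z = x := by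
  have hy := H.generic hx
  obtain ⟨c, w, h⟩ := b
  obtain ⟨c', w', h'⟩ := b'
  obtain ⟨hr, hl, rfl⟩ := ha
  have w0 : 0 < w := H.w_pos
  have h0 : 0 < h := H.h_pos
  have w0' : 0 < w' := H'.w_pos
  have nh : (h : ZMod M) ≠ 0 := H.h_ne
  change F.Good x y c w h at H
  change F.Good y z c' w' h at H'
  change c' = c + F.tr w 0 at hr
  change c' + F.tr w' h = c + F.tr 0 h at hl
  change w < n at hw
  change w' < n at hw'
  change h = 1 ∧ w + w' = n ∧ z = x
  have hper : F.tr (w + w') 0 = 0 := by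
    rw [hr] at hl; unfold tr at hl ⊢; linear_combination (norm := module) hl
  have hsum : w + w' = n := by
    obtain ⟨k, hk⟩ := (hF.tr_left _).1 hper
    have : k = 1 := by
      have h1 : 0 < k := by
        by_contra hc
        have : (n : ℤ) * k ≤ 0 := mul_nonpos_of_nonneg_of_nonpos (by omega) (by omega)
        omega
      have h2 : k < 2 := by
        by_contra hc
        have : (n : ℤ) * 2 ≤ n * k := mul_le_mul_of_nonneg_left (by omega) (by omega)
        omega
      omega
    rw [this, mul_one] at hk; exact hk
  have ez1 : c' + F.tr w' 0 = c := by
    rw [hr, add_assoc, tr_add, add_zero, hper, add_zero]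
  have ez2 : c' + F.tr 0 h = c + F.tr w h := by
    rw [hr, add_assoc, tr_add, zero_add, add_zero]
  have one : (1 : ZMod M) ≠ 0 := fun e => nh (by rw [← mul_one (h : ZMod M), e, mul_zero])
  refine ⟨?_, hsum, ?_⟩
  -- otherwise the point of `x` in the row above `c` lies in the interior of one of the rectangles
  · by_contra h1
    obtain ⟨v, hv, hvr⟩ := hrow (F.row (c + F.tr 0 1))
    obtain ⟨a, a0, an, hva⟩ := hF.exists_of_row_eq (by omega) hvr
    rw [add_assoc, tr_add, zero_add, add_zero] at hva
    have vc : v ≠ c := fun e => one (by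
      rw [e] at hvr; simpa [row_tr] using hvr)
    have vu : a ≠ 0 := by
      rintro rfl
      exact vc (hx.1 _ hv _ H.ll (by rw [hva]; simp [col_tr]))
    have va : a ≠ w := by
      rintro rfl
      have e := hx.1 _ hv _ H.ur (by rw [hva]; simp [col_tr])
      have : F.tr 0 (h - 1) = 0 := by
        rw [hva] at e; unfold tr at e ⊢; linear_combination (norm := module) -e
      have := (H.sep 0 (h - 1) (by simpa using w0) (by rw [abs_lt]; omega) this).2
      omega
    rcases lt_or_gt_of_ne va with h2 | h2
    · refine H.off v hv vc ?_ a 1 (by omega) h2 (by omega) (by omega) hva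
      intro e
      have : F.tr (w - a) (h - 1) = 0 := by
        rw [hva] at e; unfold tr at e ⊢; linear_combination (norm := module) -e
      have := (H.sep _ _ (by rw [abs_lt]; omega) (by rw [abs_lt]; omega) this).2
      omega
    · have vc2 : v ≠ c + F.tr w h := by
        intro e
        have : F.tr (w - a) (h - 1) = 0 := by
          rw [hva] at e; unfold tr at e ⊢; linear_combination (norm := module) -e
        have := (H'.sep _ _ (by rw [abs_lt]; omega) (by rw [abs_lt]; omega) this).2
        omega
      refine H'.off v ((H.mem v).2 (Or.inl ⟨hv, vc, vc2⟩)) ?_ ?_ (a - w) 1 (by omega) (by omega)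
        (by omega) (by omega) ?_
      · exact fun e => H.lr_notMem hx (hr ▸ e ▸ hv)
      · exact fun e => H.ul_notMem hx (hl ▸ e ▸ hv)
      · rw [hva, hr, add_assoc, tr_add]; congr 2; ring
  · ext v
    rw [H'.mem, H.mem, ez1, ez2, hl, ← hr]
    have h1 := H.ll
    have h2 := H.ur
    have h3 := H.lr_notMem hx
    have h4 := H.ul_notMem hx
    rw [← hr] at h3
    constructor
    · rintro (⟨⟨h5, -⟩ | h5, h6⟩ | rfl | rfl)
      · exact h5
      · tauto
      · exact h1
      · exact h2
    · intro hv
      by_cases e1 : v = c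
      · tauto
      by_cases e2 : v = c + F.tr w h
      · tauto
      exact Or.inl ⟨Or.inl ⟨hv, e1, e2⟩, fun e => h3 (e ▸ hv), fun e => h4 (e ▸ hv)⟩

/-- In each row there is a horizontal annulus. -/
theorem exists_annulus (hF : F.IsClosed n) (hn : 0 < n) (one : (1 : ZMod M) ≠ 0)
    (hx : F.Generic x) (hrow : ∀ r, ∃ v ∈ x, F.row v = r) (r : ZMod M) :
    ∃ (y : Set T) (b b' : Box T), F.GoodBox x y b ∧ F.GoodBox y x b' ∧ F.Annulus b b' ∧
      F.row b.corner = r ∧ b.w < n ∧ b'.w < n ∧ b.h = 1 := by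
  obtain ⟨c, hc, hcr⟩ := hrow r
  obtain ⟨u, hu, hur⟩ := hrow (F.row (c + F.tr 0 1))
  obtain ⟨w, w0, wn, hw⟩ := hF.exists_of_row_eq hn hur
  rw [add_assoc, tr_add, zero_add, add_zero] at hw
  have nw : (w : ZMod M) ≠ 0 := by
    intro e
    have := hx.1 _ hu _ hc (by rw [hw]; simp [col_tr, e])
    rw [this] at hur
    exact one (by simpa [row_tr] using hur)
  have w1 : 0 < w := lt_of_le_of_ne w0 (by rintro rfl; simp at nw)
  have h0 : F.tr n 0 = 0 := (hF.tr_left n).2 dvd_rfl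
  have sep : ∀ m : ℤ, m < n → ∀ a b : ℤ, |a| < m → |b| < 1 → F.tr a b = 0 → a = 0 ∧ b = 0 := by
    intro m hm a b ha hb e
    rw [Int.abs_lt_one_iff] at hb
    subst hb
    refine ⟨Int.eq_zero_of_abs_lt_dvd ((hF.tr_left a).1 e) (by omega), rfl⟩
  have e1 : c + F.tr w 0 + F.tr (n - w) 1 = c + F.tr 0 1 := by
    rw [add_assoc, tr_add, ← add_zero (F.tr 0 1), ← h0, tr_add]; congr 2; ring
  have e2 : c + F.tr w 0 + F.tr (n - w) 0 = c := by
    rw [add_assoc, tr_add, add_eq_left, ← h0]; congr 1; ring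
  have e3 : c + F.tr w 0 + F.tr 0 1 = c + F.tr w 1 := by
    rw [add_assoc, tr_add, zero_add, add_zero]
  let y : Set T := {v | (v ∈ x ∧ v ≠ c ∧ v ≠ c + F.tr w 1) ∨ v = c + F.tr w 0 ∨ v = c + F.tr 0 1}
  have H : F.Good x y c w 1 := ⟨w1, one_pos, hc, hw ▸ hu, nw, by simpa using one, fun v => Iff.rfl,
    sep w wn, fun _ _ _ _ _ _ _ _ _ _ => by omega⟩
  refine ⟨y, ⟨c, w, 1⟩, ⟨c + F.tr w 0, n - w, 1⟩, H, ⟨?_, one_pos, ?_, ?_, ?_, ?_, ?_,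
    sep _ ?_, fun _ _ _ _ _ _ _ _ hj hj' => ?_⟩, ⟨rfl, e1, rfl⟩, hcr, wn, ?_, rfl⟩
  · simp only; omega
  · exact Or.inr (Or.inl rfl)
  · rw [e1]; exact Or.inr (Or.inr rfl)
  · push_cast; rw [hF.cast_eq_zero]; simpa using nw
  · simpa using one
  · intro v
    simp only [e1, e2, e3]
    rw [H.mem]
    have h1 := H.ll
    have h2 := H.ur
    have h3 := H.lr_notMem hx
    have h4 := H.ul_notMem hx
    constructor
    · intro hv
      by_cases e1 : v = c
      · tauto
      by_cases e2 : v = c + F.tr w 1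
      · tauto
      exact Or.inl ⟨Or.inl ⟨hv, e1, e2⟩, fun e => h3 (e ▸ hv), fun e => h4 (e ▸ hv)⟩
    · rintro (⟨⟨h5, -⟩ | h5, h6⟩ | rfl | rfl)
      · exact h5
      · tauto
      · exact h1
      · exact h2
  · simp only; omega
  · change _ < (1 : ℤ) at hj'; omega
  · simp only; omega

/-- A horizontal annulus is determined by its row. -/
theorem Annulus.unique (hF : F.IsClosed n) (hx : F.Generic x)
    (hrow : ∀ r, ∃ v ∈ x, F.row v = r) {y₂ : Set T} {b₂ b₂' : Box T}
    (H : F.GoodBox x y b) (H' : F.GoodBox y x b')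
    (H₂ : F.GoodBox x y₂ b₂) (H₂' : F.GoodBox y₂ x b₂')
    (hw : b.w < n) (hw' : b'.w < n) (hw₂ : b₂.w < n) (hw₂' : b₂'.w < n)
    (ha : F.Annulus b b') (ha₂ : F.Annulus b₂ b₂') (hr : F.row b.corner = F.row b₂.corner) :
    b = b₂ ∧ b' = b₂' := by
  obtain ⟨h1, h2, -⟩ := ha.eq hF hx hrow H H' hw hw'
  obtain ⟨g1, g2, -⟩ := ha₂.eq hF hx hrow H₂ H₂' hw₂ hw₂'
  have hc := hx.2 _ H.ll _ H₂.ll hr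
  have hu := hx.2 _ H.ur _ H₂.ur (by rw [map_add, map_add, row_tr, row_tr, hr, h1, g1])
  have hww : b.w = b₂.w := by
    have : F.tr (b.w - b₂.w) 0 = 0 := by
      rw [hc, h1, g1] at hu
      unfold tr at hu ⊢; linear_combination (norm := module) hu
    have h3 := (hF.tr_left _).1 this
    have := Int.eq_zero_of_abs_lt_dvd h3 (by
      have := H.w_pos
      have := H₂.w_pos
      rw [abs_lt]; omega)
    omega
  refine ⟨Box.ext hc hww (by rw [h1, g1]), Box.ext ?_ (by omega) ?_⟩
  · rw [ha.1, ha₂.1, hc, hww]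
  · rw [← ha.2.2, ← ha₂.2.2, h1, g1]

/-- A horizontal annulus of height one covers each cell of its row once. -/
theorem Annulus.count (hF : F.IsClosed n) (ha : F.Annulus b b') (hh : b.h = 1)
    (hn : 0 < n) (w0 : 0 ≤ b.w) (w0' : 0 ≤ b'.w) (hw : b.w + b'.w = n) (v : T)
    [Decidable (F.row v = F.row b.corner)] :
    F.count b v + F.count b' v = if F.row v = F.row b.corner then 1 else 0 := by
  classical
  obtain ⟨G, hG⟩ := F.exists_potential b.corner v
  have g1 := hG 0 0 b.w b.h w0 (by omega)
  have g2 := hG b.w 0 n b.h (by omega) (by omega)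
  have g3 := hG 0 0 n b.h (by omega) (by omega)
  rw [F.tr_zero, add_zero, sub_zero, sub_zero] at g1 g3
  have e2 : (⟨b.corner + F.tr b.w 0, n - b.w, b.h - 0⟩ : Box T) = b' :=
    Box.ext ha.1.symm (by simp only; omega) (by rw [sub_zero, ha.2.2])
  rw [e2] at g2
  have e3 : F.count b v + F.count b' v = F.count ⟨b.corner, n, b.h⟩ v := by
    zify; rw [g1, g2, g3]; ring
  rw [e3]
  unfold Frame.count
  simp only [hh, Int.toNat_natCast, Int.toNat_one, Finset.sum_range_one, Nat.cast_zero]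
  split_ifs with hr
  · obtain ⟨a, a0, an, e⟩ := hF.exists_of_row_eq hn hr
    rw [Finset.sum_eq_single a.toNat]
    · rw [Int.toNat_of_nonneg a0, if_pos e.symm]
    · intro i hi hia
      rw [if_neg]
      intro hiv
      rw [Finset.mem_range] at hi
      have : F.tr (i - a) 0 = 0 := by
        rw [e] at hiv; unfold tr at hiv ⊢; linear_combination (norm := module) hiv
      have := Int.eq_zero_of_abs_lt_dvd ((hF.tr_left _).1 this) (by rw [abs_lt]; omega)
      omega
    · intro hi
      rw [Finset.mem_range] at hi
      omega
  · refine Finset.sum_eq_zero fun i _ => if_neg fun e => hr ?_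
    rw [← e]; simp [row_tr]

end Frame

/-! ### The frame of the grid torus -/

section Torus

variable {N p : ℕ} {q : ℤ}

theorem pt_add (a b a' b' : ℤ) : (pt a b : Torus N p q) + pt a' b' = pt (a + a') (b + b') := rfl

theorem pt_eq_zero {a b : ℤ} :
    (pt a b : Torus N p q) = 0 ↔ ∃ s t : ℤ, a = (s * p + t * q) * N ∧ b = t * N := by
  unfold pt
  rw [QuotientAddGroup.eq_zero_iff]
  constructor
  · intro h
    exact mem_lattice h
  · rintro ⟨s, t, rfl, rfl⟩
    exact lattice_mem s t

theorem row_pt (a b : ℤ) : row (pt a b : Torus N p q) = b := rfl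

theorem col_pt (a b : ℤ) : col (pt a b : Torus N p q) = a := rfl

variable (N p q) in
/-- The standard frame of the grid torus. -/
def torusFrame : Frame (Torus N p q) N where
  e₁ := pt 1 0
  e₂ := pt 0 1
  col := col
  row := row
  col_e₁ := by rw [col_pt]; simp
  col_e₂ := by rw [col_pt]; simp
  row_e₁ := by rw [row_pt]; simp
  row_e₂ := by rw [row_pt]; simp

theorem torusFrame_tr (a b : ℤ) : (torusFrame N p q).tr a b = pt a b := by
  change a • QuotientAddGroup.mk _ + b • QuotientAddGroup.mk _ = _
  rw [← QuotientAddGroup.mk_zsmul, ← QuotientAddGroup.mk_zsmul, ← QuotientAddGroup.mk_add]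
  simp [pt]

theorem exists_pt (v : Torus N p q) : ∃ a b, v = pt a b := by
  obtain ⟨⟨a, b⟩, rfl⟩ := QuotientAddGroup.mk_surjective v
  exact ⟨a, b, rfl⟩

/-- Coprimality of `p` and `q` makes the vertical lines close up after `p N` steps, as the horizontal
ones do, and makes each column a single vertical circle. -/
theorem isClosed_torusFrame [NeZero N] (hpq : IsCoprime (p : ℤ) q) :
    (torusFrame N p q).IsClosed (p * N) where
  tr_left a := by
    rw [torusFrame_tr, pt_eq_zero]
    constructor
    · rintro ⟨s, t, h1, h2⟩
      have : t = 0 := by simpa [NeZero.ne N] using h2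
      refine ⟨s, ?_⟩
      rw [h1, this]; push_cast; ring
    · rintro ⟨s, rfl⟩
      exact ⟨s, 0, by push_cast; ring, by ring⟩
  tr_right b := by
    rw [torusFrame_tr, pt_eq_zero]
    have hN : (N : ℤ) ≠ 0 := by exact_mod_cast NeZero.ne N
    constructor
    · rintro ⟨s, t, h1, h2⟩
      have h3 : s * p + t * q = 0 := by
        rcases mul_eq_zero.1 h1.symm with h | h
        · exact h
        · exact absurd h hN
      have : (p : ℤ) ∣ t * q := ⟨-s, by linarith⟩
      obtain ⟨k, hk⟩ := hpq.dvd_of_dvd_mul_right this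
      exact ⟨k, by rw [h2, hk]; push_cast; ring⟩
    · rintro ⟨k, rfl⟩
      exact ⟨-k * q, p * k, by ring, by push_cast; ring⟩
  row_ker v hv := by
    obtain ⟨a, b, rfl⟩ := exists_pt v
    change ((b : ℤ) : ZMod N) = 0 at hv
    rw [ZMod.intCast_zmod_eq_zero_iff_dvd] at hv
    obtain ⟨t, rfl⟩ := hv
    refine ⟨a - t * q * N, ?_⟩
    rw [torusFrame_tr, ← sub_eq_zero]
    change (pt (a - (a - t * q * N)) (N * t - 0) : Torus N p q) = 0
    rw [pt_eq_zero]
    exact ⟨0, t, by ring, by ring⟩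
  col_ker v hv := by
    obtain ⟨a, b, rfl⟩ := exists_pt v
    change ((a : ℤ) : ZMod N) = 0 at hv
    rw [ZMod.intCast_zmod_eq_zero_iff_dvd] at hv
    obtain ⟨m, rfl⟩ := hv
    obtain ⟨s, t, hst⟩ := hpq
    refine ⟨b - m * t * N, ?_⟩
    rw [torusFrame_tr, ← sub_eq_zero]
    change (pt (N * m - 0) (b - (b - m * t * N)) : Torus N p q) = 0
    rw [pt_eq_zero]
    exact ⟨m * s, m * t, by linear_combination -(N * m : ℤ) * hst, by ring⟩

theorem State.generic (x : State N p q) : (torusFrame N p q).Generic x.1 :=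
  ⟨fun _ hu v hv h => (x.2.2 (col v)).unique ⟨hu, h⟩ ⟨hv, rfl⟩,
    fun _ hu v hv h => (x.2.1 (row v)).unique ⟨hu, h⟩ ⟨hv, rfl⟩⟩

theorem State.exists_row (x : State N p q) (r : ZMod N) : ∃ v ∈ x.1, row v = r := by
  obtain ⟨v, h, -⟩ := x.2.1 r
  exact ⟨v, h⟩

theorem State.exists_col (x : State N p q) (r : ZMod N) : ∃ v ∈ x.1, col v = r := by
  obtain ⟨v, h, -⟩ := x.2.2 r
  exact ⟨v, h⟩

/-- A rectangle of the grid torus as a box. -/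
def Rectangle.box (r : Rectangle N p q) : Box (Torus N p q) := ⟨r.corner, r.width, r.height⟩

theorem Rectangle.box_injective : Function.Injective (Rectangle.box (N := N) (p := p) (q := q)) := by
  intro r r' h
  have h1 := congrArg Box.corner h
  have h2 := congrArg Box.w h
  have h3 := congrArg Box.h h
  simp only [Rectangle.box, Rectangle.width, Rectangle.height, Nat.cast_inj] at h1 h2 h3
  exact Prod.ext h1 (Prod.ext (Fin.ext h2) (Fin.ext h3))

theorem Rectangle.mult_eq_count (r : Rectangle N p q) (v : Torus N p q) :
    r.mult v = (torusFrame N p q).count r.box v := by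
  classical
  have : {u : ℕ × ℕ | u.1 < r.width ∧ u.2 < r.height ∧ r.corner + pt u.1 u.2 = v} =
      ((Finset.range r.width ×ˢ Finset.range r.height).filter
        fun u : ℕ × ℕ => r.corner + pt u.1 u.2 = v : Set (ℕ × ℕ)) := by
    ext u; simp [and_assoc]
  rw [Rectangle.mult, this, Set.ncard_coe_finset, Finset.card_filter, Finset.sum_product]
  unfold Frame.count
  simp only [Rectangle.box, Int.toNat_natCast, torusFrame_tr]

theorem good_of_isFromTo {r : Rectangle N p q} {x y : State N p q} (h : r.IsFromTo x y)
    (he : r.IsEmpty x y) : (torusFrame N p q).GoodBox x.1 y.1 r.box := by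
  obtain ⟨w0, h0, emb, ll, ur, hy⟩ := h
  have hne : r.corner ≠ r.corner + pt r.width r.height := by
    intro e
    have : ((0, 0) : ℕ × ℕ) = (r.width, r.height) := emb ⟨Nat.zero_le _, Nat.zero_le _⟩
      ⟨le_rfl, le_rfl⟩ (by
        simp only [Nat.cast_zero]; rw [← e]
        exact add_zero _)
    simp only [Prod.mk.injEq] at this
    omega
  have hg := x.generic
  refine ⟨by simpa [Rectangle.box] using w0, by simpa [Rectangle.box] using h0, ll, ?_, ?_, ?_,
    ?_, ?_, ?_⟩
  · rw [torusFrame_tr]; exact ur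
  · intro e
    refine hne (hg.1 _ ll _ ur ?_)
    change col _ = col _
    rw [map_add, col_pt]
    change ((r.width : ℤ) : ZMod N) = 0 at e
    rw [e, add_zero]
  · intro e
    refine hne (hg.2 _ ll _ ur ?_)
    change row _ = row _
    rw [map_add, row_pt]
    change ((r.height : ℤ) : ZMod N) = 0 at e
    rw [e, add_zero]
  · intro v
    rw [hy]
    simp only [torusFrame_tr, Rectangle.box, Set.mem_union, Set.mem_sdiff, Set.mem_insert_iff,
      Set.mem_singleton_iff, not_or, ne_eq]
  · intro a b ha hb e
    change |a| < (r.width : ℤ) at ha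
    change |b| < (r.height : ℤ) at hb
    rw [torusFrame_tr] at e
    rw [abs_lt] at ha hb
    have := emb (x₁ := (a.toNat, b.toNat)) (x₂ := ((-a).toNat, (-b).toNat))
      ⟨by simp only; omega, by simp only; omega⟩ ⟨by simp only; omega, by simp only; omega⟩ (by
        simp only
        rw [add_right_inj, ← sub_eq_zero]
        change (pt ((a.toNat : ℤ) - ((-a).toNat : ℤ)) ((b.toNat : ℤ) - ((-b).toNat : ℤ)) :
          Torus N p q) = 0
        rw [← e]; congr 1 <;> omega)
    simp only [Prod.mk.injEq] at this
    omega
  · intro v hv _ _ i j hi hi' hj hj' e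
    change i < (r.width : ℤ) at hi'
    change j < (r.height : ℤ) at hj'
    have := (he i.toNat j.toNat (by omega) (by omega) (by omega) (by omega)).1
    rw [Int.toNat_of_nonneg (by omega), Int.toNat_of_nonneg (by omega), ← torusFrame_tr] at this
    exact this (e ▸ hv)

theorem isFromTo_of_good {r : Rectangle N p q} {x y : State N p q}
    (H : (torusFrame N p q).GoodBox x.1 y.1 r.box) : r.IsFromTo x y ∧ r.IsEmpty x y := by
  have w0 : (0 : ℤ) < r.width := H.w_pos
  have h0 : (0 : ℤ) < r.height := H.h_pos
  have tr0 : ∀ i j i' j' : ℤ, r.corner + pt i j = r.corner + pt i' j' →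
      (torusFrame N p q).tr (i - i') (j - j') = 0 := by
    intro i j i' j' e
    rw [torusFrame_tr]
    rw [add_right_inj, ← sub_eq_zero] at e
    exact e
  constructor
  · refine ⟨by omega, by omega, ?_, H.ll, ?_, ?_⟩
    · rintro ⟨i, j⟩ ⟨hi, hj⟩ ⟨i', j'⟩ ⟨hi', hj'⟩ e
      simp only at hi hj hi' hj' e
      have e' := tr0 _ _ _ _ e
      have ec : (((i : ℤ) - i' : ℤ) : ZMod N) = 0 := by
        rw [← Frame.col_tr (torusFrame N p q) _ ((j : ℤ) - j'), e', map_zero]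
      have er : (((j : ℤ) - j' : ℤ) : ZMod N) = 0 := by
        rw [← Frame.row_tr (torusFrame N p q) ((i : ℤ) - i'), e', map_zero]
      have nw : ((r.width : ℤ) : ZMod N) ≠ 0 := H.w_ne
      have nh : ((r.height : ℤ) : ZMod N) ≠ 0 := H.h_ne
      have a1 : (i : ℤ) - i' ≠ r.width := fun e => nw (by rw [← e, ec])
      have a2 : (i : ℤ) - i' ≠ -r.width := fun e => nw (by
        rw [e] at ec; simpa using ec)
      have b1 : (j : ℤ) - j' ≠ r.height := fun e => nh (by rw [← e, er])
      have b2 : (j : ℤ) - j' ≠ -r.height := fun e => nh (by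
        rw [e] at er; simpa using er)
      have := H.sep ((i : ℤ) - i') ((j : ℤ) - j')
        (by change _ < (r.width : ℤ); rw [abs_lt]; omega)
        (by change _ < (r.height : ℤ); rw [abs_lt]; omega) e'
      simp only [Prod.mk.injEq]
      omega
    · have := H.ur
      rwa [torusFrame_tr] at this
    · ext v
      have := H.mem v
      simp only [torusFrame_tr, Rectangle.box] at this
      simp only [Set.mem_union, Set.mem_sdiff, Set.mem_insert_iff,
        Set.mem_singleton_iff, not_or]
      exact this
  · intro i j hi hi' hj hj'
    have key : ∀ i₀ j₀ : ℤ, |(i : ℤ) - i₀| < r.width → |(j : ℤ) - j₀| < r.height →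
        (i : ℤ) ≠ i₀ → r.corner + pt i j ≠ r.corner + pt i₀ j₀ := by
      intro i₀ j₀ h1 h2 h3 e
      have := H.sep _ _ h1 h2 (tr0 _ _ _ _ e)
      omega
    have hc : r.corner + pt i j ≠ r.corner := by
      have := key 0 0 (by rw [abs_lt]; omega) (by rw [abs_lt]; omega) (by omega)
      rwa [show (pt 0 0 : Torus N p q) = 0 from rfl, add_zero] at this
    have hx : r.corner + pt i j ∉ x.1 := by
      intro hv
      refine H.off _ hv hc ?_ i j (by omega) ?_ (by omega) ?_ ?_
      · rw [torusFrame_tr]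
        exact key r.width r.height (by rw [abs_lt]; omega) (by rw [abs_lt]; omega) (by omega)
      · change (i : ℤ) < r.width; omega
      · change (j : ℤ) < r.height; omega
      · rw [torusFrame_tr]; rfl
    refine ⟨hx, fun hv => ?_⟩
    rw [H.mem] at hv
    rcases hv with hv | hv | hv
    · exact hx hv.1
    · rw [torusFrame_tr] at hv
      exact key r.width 0 (by rw [abs_lt]; omega) (by rw [abs_lt]; omega) (by omega) hv
    · rw [torusFrame_tr] at hv
      exact key 0 r.height (by rw [abs_lt]; omega) (by rw [abs_lt]; omega) (by omega) hv

/-- An empty rectangle is smaller than the circles of the grid, so its sides fit in the bounds in the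
definition of a rectangle. -/
theorem exists_rectangle [NeZero N] [NeZero p] (hpq : IsCoprime (p : ℤ) q)
    {x y : Set (Torus N p q)} {b : Box (Torus N p q)} (H : (torusFrame N p q).GoodBox x y b) :
    ∃ r : Rectangle N p q, r.box = b := by
  have hF := isClosed_torusFrame (N := N) hpq
  have w0 := H.w_pos
  have h0 := H.h_pos
  have hn : ((p * N : ℕ) : ℤ) ≠ 0 := by
    exact_mod_cast mul_ne_zero (NeZero.ne p) (NeZero.ne N)
  have hw : b.w < ((p * N : ℕ) : ℤ) := by
    by_contra hc
    have hne : b.w ≠ ((p * N : ℕ) : ℤ) := fun e => H.w_ne (by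
      rw [e]; exact_mod_cast hF.cast_eq_zero)
    exact hn (H.sep _ 0 (by rw [Nat.abs_cast]; omega) (by simpa using h0)
      ((hF.tr_left _).2 dvd_rfl)).1
  have hh : b.h < ((p * N : ℕ) : ℤ) := by
    by_contra hc
    have hne : b.h ≠ ((p * N : ℕ) : ℤ) := fun e => H.h_ne (by
      rw [e]; exact_mod_cast hF.cast_eq_zero)
    exact hn (H.sep 0 _ (by simpa using w0) (by rw [Nat.abs_cast]; omega)
      ((hF.tr_right _).2 dvd_rfl)).2
  exact ⟨(b.corner, ⟨b.w.toNat, by omega⟩, ⟨b.h.toNat, by omega⟩),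
    Box.ext rfl (Int.toNat_of_nonneg w0.le) (Int.toNat_of_nonneg h0.le)⟩

/-- The result of an empty rectangle is again a generator. -/
theorem exists_state {x : State N p q} {Y : Set (Torus N p q)} {b : Box (Torus N p q)}
    (H : (torusFrame N p q).GoodBox x.1 Y b) : ∃ y : State N p q, y.1 = Y := by
  have hY := H.generic x.generic
  have h1 := (H.mem (b.corner + (torusFrame N p q).tr b.w 0)).2 (Or.inr (Or.inl rfl))
  have h2 := (H.mem (b.corner + (torusFrame N p q).tr 0 b.h)).2 (Or.inr (Or.inr rfl))
  refine ⟨⟨Y, fun r => ?_, fun c => ?_⟩, rfl⟩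
  · obtain ⟨v, hv, hr⟩ := x.exists_row r
    have : ∃ u ∈ Y, row u = r := by
      by_cases e1 : v = b.corner
      · exact ⟨_, h1, by rw [map_add, torusFrame_tr, row_pt, ← e1, hr]; simp⟩
      by_cases e2 : v = b.corner + (torusFrame N p q).tr b.w b.h
      · refine ⟨_, h2, ?_⟩
        rw [← hr, e2, map_add, map_add, torusFrame_tr, torusFrame_tr, row_pt, row_pt]
      · exact ⟨v, (H.mem v).2 (Or.inl ⟨hv, e1, e2⟩), hr⟩
    obtain ⟨u, hu, hur⟩ := this
    exact ⟨u, ⟨hu, hur⟩, fun u' hu' => hY.2 _ hu'.1 _ hu (hu'.2.trans hur.symm)⟩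
  · obtain ⟨v, hv, hr⟩ := x.exists_col c
    have : ∃ u ∈ Y, col u = c := by
      by_cases e1 : v = b.corner
      · exact ⟨_, h2, by rw [map_add, torusFrame_tr, col_pt, ← e1, hr]; simp⟩
      by_cases e2 : v = b.corner + (torusFrame N p q).tr b.w b.h
      · refine ⟨_, h1, ?_⟩
        rw [← hr, e2, map_add, map_add, torusFrame_tr, torusFrame_tr, col_pt, col_pt]
      · exact ⟨v, (H.mem v).2 (Or.inl ⟨hv, e1, e2⟩), hr⟩
    obtain ⟨u, hu, hur⟩ := this
    exact ⟨u, ⟨hu, hur⟩, fun u' hu' => hY.1 _ hu'.1 _ hu (hu'.2.trans hur.symm)⟩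

end Torus

/-! ### The square of the differential -/

section Square

theorem Frame.Good.unique {T : Type*} [AddCommGroup T] {M : ℕ} {F : Frame T M} {x y y' : Set T}
    {c : T} {w h : ℤ} (H : F.Good x y c w h) (H' : F.Good x y' c w h) : y = y' := by
  ext v; rw [H.mem, H'.mem]

/-- A sum vanishes if its terms cancel in pairs; the pairs are given by a relation. -/
theorem sum_eq_zero_of_pairing {α β : Type*} [AddCommGroup β] (s : Finset α) (f : α → β)
    (rel : α → α → Prop)
    (hex : ∀ a ∈ s, ∃ b ∈ s, rel a b ∧ rel b a ∧ f a + f b = 0 ∧ b ≠ a)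
    (huniq : ∀ a ∈ s, ∀ b ∈ s, ∀ b' ∈ s, rel a b → rel a b' → b = b') :
    ∑ a ∈ s, f a = 0 := by
  choose! g hg using hex
  refine Finset.sum_involution (fun a _ => g a) (fun a ha => (hg a ha).2.2.2.1)
    (fun a ha _ => (hg a ha).2.2.2.2) (fun a ha => (hg a ha).1) (fun a ha => ?_)
  obtain ⟨h1, h2, h3, -, -⟩ := hg a ha
  obtain ⟨g1, g2, -, -, -⟩ := hg (g a) h1
  exact huniq (g a) h1 _ g1 _ ha g2 h3

variable {N p : ℕ} {q : ℤ}

/-- The sign rules, with values in a commutative ring. -/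
structure SignLaw {A : Type*} [CommRing A]
    (σ : State N p q → State N p q → Rectangle N p q → A) : Prop where
  alternative : ∀ (x w y z : State N p q) (r₁ r₂ s₁ s₂ : Rectangle N p q),
    r₁.IsFromTo x w → r₂.IsFromTo w z → s₁.IsFromTo x y → s₂.IsFromTo y z → y ≠ w →
    (∀ c, r₁.mult c + r₂.mult c = s₁.mult c + s₂.mult c) →
    σ x w r₁ * σ w z r₂ = -(σ x y s₁ * σ y z s₂)
  horizontal : ∀ (x y : State N p q) (r₁ r₂ : Rectangle N p q),
    r₁.IsFromTo x y → r₂.IsFromTo y x → r₂.corner = r₁.corner + pt r₁.width 0 →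
    r₂.height = r₁.height → r₁.width + r₂.width = p * N → σ x y r₁ * σ y x r₂ = 1
  vertical : ∀ (x y : State N p q) (r₁ r₂ : Rectangle N p q),
    r₁.IsFromTo x y → r₂.IsFromTo y x → r₂.corner = r₁.corner + pt 0 r₁.height →
    r₂.width = r₁.width → r₁.height + r₂.height = p * N → σ x y r₁ * σ y x r₂ = -1

/-- Empty embedded rectangles. -/
def Rectangle.IsGood (r : Rectangle N p q) (x y : State N p q) : Prop :=
  r.IsFromTo x y ∧ r.IsEmpty x y

theorem isGood_iff {r : Rectangle N p q} {x y : State N p q} :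
    r.IsGood x y ↔ (torusFrame N p q).GoodBox x.1 y.1 r.box :=
  ⟨fun h => good_of_isFromTo h.1 h.2, isFromTo_of_good⟩

variable [NeZero N] [NeZero p] {A : Type*} [CommRing A]

/-- The weight of a rectangle, for given weights of the cells: their product over the rectangle. -/
def weight (ω : Torus N p q → A) (r : Rectangle N p q) : A := ∏ v, ω v ^ r.mult v

open Classical in
/-- The matrix coefficients of the differential with signs `σ` and weights `ω` of the cells. -/
def coeff (σ : State N p q → State N p q → Rectangle N p q → A) (ω : Torus N p q → A)
    (x y : State N p q) : A :=
  ∑ r : Rectangle N p q with r.IsGood x y, σ x y r * weight ω r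

open Classical in
/-- The annuli from `x` to `z`, for one of the two directions: `β` regards a rectangle as a box in
the frame `F`. -/
theorem sum_annuli {n : ℕ} (hn : 0 < n) (one : (1 : ZMod N) ≠ 0) (F : Frame (Torus N p q) N)
    (hF : F.IsClosed n) (β : Rectangle N p q → Box (Torus N p q)) (hβ : Function.Injective β)
    (hG : ∀ x y : State N p q, ∀ r, r.IsGood x y ↔ F.GoodBox x.1 y.1 (β r))
    (hex : ∀ (x : State N p q) (Y : Set (Torus N p q)) (b : Box (Torus N p q)),
      F.GoodBox x.1 Y b → ∃ (y : State N p q) (r : Rectangle N p q), y.1 = Y ∧ β r = b)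
    (hcount : ∀ r v, r.mult v = F.count (β r) v) (hw : ∀ r, (β r).w < n)
    (hgen : ∀ x : State N p q, F.Generic x.1)
    (hrow : ∀ (x : State N p q) r, ∃ v ∈ x.1, F.row v = r)
    (ω : Torus N p q → A) (ε : A) (x z : State N p q)
    (f : State N p q × Rectangle N p q × Rectangle N p q → A)
    (hf : z = x → ∀ y r r', r.IsGood x y → r'.IsGood y x → F.Annulus (β r) (β r') →
      (β r).w + (β r').w = n →
      f (y, r, r') = ε * ∏ v, ω v ^ (r.mult v + r'.mult v)) :
    ∑ t : State N p q × Rectangle N p q × Rectangle N p q with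
      (t.2.1.IsGood x t.1 ∧ t.2.2.IsGood t.1 z) ∧ F.Annulus (β t.2.1) (β t.2.2), f t =
      if x = z then ε * ∑ r : ZMod N, ∏ v : Torus N p q with F.row v = r, ω v else 0 := by
  have key : ∀ t : State N p q × Rectangle N p q × Rectangle N p q,
      t.2.1.IsGood x t.1 → t.2.2.IsGood t.1 z → F.Annulus (β t.2.1) (β t.2.2) →
      (β t.2.1).h = 1 ∧ (β t.2.1).w + (β t.2.2).w = n ∧ z = x := by
    rintro ⟨y, r, r'⟩ h1 h2 h3
    obtain ⟨e1, e2, e3⟩ := h3.eq hF (hgen x) (hrow x) ((hG _ _ _).1 h1) ((hG _ _ _).1 h2)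
      (hw _) (hw _)
    exact ⟨e1, e2, Subtype.ext e3⟩
  split_ifs with hxz
  · subst hxz
    rw [Finset.mul_sum]
    refine Finset.sum_nbij (fun t => F.row (β t.2.1).corner) (fun _ _ => Finset.mem_univ _)
      ?_ ?_ ?_
    · rintro ⟨y, r, r'⟩ ht ⟨y₂, r₂, r₂'⟩ ht₂ e
      simp only [Finset.coe_filter, Finset.mem_univ, true_and, Set.mem_ofPred_eq] at ht ht₂ e
      have g1 := (hG _ _ _).1 ht.1.1
      have g2 := (hG _ _ _).1 ht₂.1.1
      obtain ⟨e1, e2⟩ := ht.2.unique hF (hgen x) (hrow x) g1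
        ((hG _ _ _).1 ht.1.2) g2 ((hG _ _ _).1 ht₂.1.2) (hw _) (hw _)
        (hw _) (hw _) ht₂.2 e
      rw [e1] at g1
      rw [Subtype.ext (g1.unique g2), hβ e1, hβ e2]
    · intro r _
      obtain ⟨Y, b, b', h1, h2, h3, h4, -⟩ :=
        F.exists_annulus hF hn one (hgen x) (hrow x) r
      obtain ⟨y, s, rfl, rfl⟩ := hex _ _ _ h1
      obtain ⟨-, s', -, rfl⟩ := hex _ _ _ h2
      refine ⟨(y, s, s'), ?_, h4⟩
      simp only [Finset.coe_filter, Finset.mem_univ, true_and, Set.mem_ofPred_eq]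
      exact ⟨⟨(hG _ _ _).2 h1, (hG _ _ _).2 h2⟩, h3⟩
    · rintro ⟨y, r, r'⟩ ht
      simp only [Finset.mem_filter, Finset.mem_univ, true_and] at ht
      obtain ⟨e1, e2, -⟩ := key (y, r, r') ht.1.1 ht.1.2 ht.2
      rw [hf rfl y r r' ht.1.1 ht.1.2 ht.2 e2, Finset.prod_filter]
      congr 1
      refine Finset.prod_congr rfl fun v _ => ?_
      rw [hcount, hcount, ht.2.count hF e1 hn ((hG _ _ _).1 ht.1.1).w_pos.le
        ((hG _ _ _).1 ht.1.2).w_pos.le e2 v]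
      split_ifs <;> simp
  · rw [Finset.filter_eq_empty_iff.2, Finset.sum_empty]
    rintro t - ⟨⟨h1, h2⟩, h3⟩
    exact hxz (key t h1 h2 h3).2.2.symm

open Classical in
/-- The square of the differential counts the thin annuli: all other pairs of rectangles cancel
with their exchanges. -/
theorem sum_coeff_mul_coeff (hpq : IsCoprime (p : ℤ) q) (hN : 1 < N)
    {σ : State N p q → State N p q → Rectangle N p q → A} (hσ : SignLaw σ)
    (ω : Torus N p q → A) (x z : State N p q) :
    ∑ y, coeff σ ω x y * coeff σ ω y z =
      if x = z then ∑ r : ZMod N, ∏ v : Torus N p q with row v = r, ω v -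
        ∑ c : ZMod N, ∏ v : Torus N p q with col v = c, ω v else 0 := by
  have hF := isClosed_torusFrame (N := N) hpq
  have hn : 0 < p * N := Nat.mul_pos (Nat.pos_of_ne_zero (NeZero.ne p)) (by omega)
  have one : (1 : ZMod N) ≠ 0 := by
    have := Fact.mk hN
    exact one_ne_zero
  let f : State N p q × Rectangle N p q × Rectangle N p q → A := fun t =>
    σ x t.1 t.2.1 * weight ω t.2.1 * (σ t.1 z t.2.2 * weight ω t.2.2)
  have hf : ∀ y r r', f (y, r, r') =
      (σ x y r * σ y z r') * ∏ v, ω v ^ (r.mult v + r'.mult v) := by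
    intro y r r'
    simp only [f, weight, pow_add, Finset.prod_mul_distrib]
    ring
  have e1 : ∑ y, coeff σ ω x y * coeff σ ω y z =
      ∑ t : State N p q × Rectangle N p q × Rectangle N p q with
        t.2.1.IsGood x t.1 ∧ t.2.2.IsGood t.1 z, f t := by
    rw [Finset.sum_filter, Fintype.sum_prod_type]
    refine Finset.sum_congr rfl fun y _ => ?_
    rw [coeff, coeff, Finset.sum_mul_sum, Fintype.sum_prod_type, Finset.sum_filter]
    refine Finset.sum_congr rfl fun r _ => ?_
    split_ifs with h1
    · rw [Finset.sum_filter]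
      refine Finset.sum_congr rfl fun r' _ => ?_
      simp only [h1, true_and, f]
    · simp [h1]
  rw [e1, ← Finset.sum_filter_add_sum_filter_not _
      (fun t => (torusFrame N p q).Annulus t.2.1.box t.2.2.box),
    ← Finset.sum_filter_add_sum_filter_not (Finset.filter (fun t => ¬ _) _)
      (fun t => (torusFrame N p q).transpose.Annulus t.2.1.box.transpose t.2.2.box.transpose)]
  have e2 : ∑ t : State N p q × Rectangle N p q × Rectangle N p q with
      (t.2.1.IsGood x t.1 ∧ t.2.2.IsGood t.1 z) ∧
        (torusFrame N p q).Annulus t.2.1.box t.2.2.box, f t =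
      if x = z then 1 * ∑ r : ZMod N, ∏ v : Torus N p q with row v = r, ω v else 0 := by
    refine sum_annuli hn one (torusFrame N p q) hF Rectangle.box Rectangle.box_injective
      (fun _ _ _ => isGood_iff) ?_ Rectangle.mult_eq_count ?_ State.generic State.exists_row
      ω 1 x z f ?_
    · intro x Y b H
      obtain ⟨y, hy⟩ := exists_state H
      obtain ⟨r, hr⟩ := exists_rectangle hpq H
      exact ⟨y, r, hy, hr⟩
    · intro r
      exact Int.ofNat_lt.2 r.2.1.2
    · rintro rfl y r r' h1 h2 h3 h4
      rw [hf]
      congr 1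
      refine hσ.horizontal _ y r r' h1.1 h2.1 ?_ ?_ ?_
      · rw [← torusFrame_tr]; exact h3.1
      · exact Int.ofNat_inj.1 h3.2.2.symm
      · exact Int.ofNat_inj.1 h4
  have e3 : ∑ t : State N p q × Rectangle N p q × Rectangle N p q with
      (t.2.1.IsGood x t.1 ∧ t.2.2.IsGood t.1 z) ∧
        (torusFrame N p q).transpose.Annulus t.2.1.box.transpose t.2.2.box.transpose, f t =
      if x = z then -1 * ∑ r : ZMod N, ∏ v : Torus N p q with col v = r, ω v else 0 := by
    refine sum_annuli hn one (torusFrame N p q).transpose hF.transpose (fun r => r.box.transpose)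
      (fun r r' h => Rectangle.box_injective (congrArg Box.transpose h))
      (fun x y r => isGood_iff.trans ⟨fun h => h.transpose, fun h => h.transpose⟩) ?_
      (fun r v => by rw [Frame.count_transpose]; exact r.mult_eq_count v) ?_
      (fun x => x.generic.transpose) State.exists_col ω (-1) x z f ?_
    · intro x Y b H
      obtain ⟨y, hy⟩ := exists_state (b := b.transpose) H.transpose
      obtain ⟨r, hr⟩ := exists_rectangle (b := b.transpose) hpq H.transpose
      exact ⟨y, r, hy, by rw [hr]; rfl⟩
    · intro r
      exact Int.ofNat_lt.2 r.2.2.2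
    · rintro rfl y r r' h1 h2 h3 h4
      rw [hf]
      congr 1
      refine hσ.vertical _ y r r' h1.1 h2.1 ?_ ?_ ?_
      · rw [← torusFrame_tr, ← Frame.transpose_tr]; exact h3.1
      · exact Int.ofNat_inj.1 h3.2.2.symm
      · exact Int.ofNat_inj.1 h4
  -- a vertical annulus is not a horizontal one
  have e4 : (((Finset.univ.filter fun t : State N p q × Rectangle N p q × Rectangle N p q =>
      t.2.1.IsGood x t.1 ∧ t.2.2.IsGood t.1 z).filter fun t =>
        ¬ (torusFrame N p q).Annulus t.2.1.box t.2.2.box).filter fun t =>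
        (torusFrame N p q).transpose.Annulus t.2.1.box.transpose t.2.2.box.transpose) =
      Finset.univ.filter fun t => (t.2.1.IsGood x t.1 ∧ t.2.2.IsGood t.1 z) ∧
        (torusFrame N p q).transpose.Annulus t.2.1.box.transpose t.2.2.box.transpose := by
    ext t
    simp only [Finset.mem_filter, Finset.mem_univ, true_and]
    refine ⟨fun h => ⟨h.1.1, h.2⟩, fun h => ⟨⟨h.1, fun ha => ?_⟩, h.2⟩⟩
    exact Frame.not_beside_of_stacked x.generic (isGood_iff.1 h.1.1) (isGood_iff.1 h.1.2)
      (Or.inl h.2.1) (Or.inl ha.1)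
  -- the pairs of rectangles that do not form an annulus cancel
  have e5 : ∑ t ∈ ((Finset.univ.filter fun t : State N p q × Rectangle N p q × Rectangle N p q =>
      t.2.1.IsGood x t.1 ∧ t.2.2.IsGood t.1 z).filter fun t =>
        ¬ (torusFrame N p q).Annulus t.2.1.box t.2.2.box).filter fun t =>
        ¬ (torusFrame N p q).transpose.Annulus t.2.1.box.transpose t.2.2.box.transpose, f t =
      0 := by
    refine sum_eq_zero_of_pairing _ f (fun t t' =>
      (torusFrame N p q).exchange t.2.1.box t.2.2.box = (t'.2.1.box, t'.2.2.box)) ?_ ?_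
    · rintro ⟨y, r, r'⟩ ht
      simp only [Finset.mem_filter, Finset.mem_univ, true_and] at ht
      obtain ⟨⟨⟨h1, h2⟩, h3⟩, h4⟩ := ht
      obtain ⟨⟨Y, g1, g2, g3⟩, g4, g5, g6, g7⟩ :=
        Frame.isExchange_exchange x.generic (isGood_iff.1 h1) (isGood_iff.1 h2) h3 h4
      obtain ⟨y', rfl⟩ := exists_state g2
      obtain ⟨s, hs⟩ := exists_rectangle hpq g2
      obtain ⟨s', hs'⟩ := exists_rectangle hpq g3
      have hss : (torusFrame N p q).exchange r.box r'.box = (s.box, s'.box) := by rw [hs, hs']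
      rw [hss] at g2 g3 g4 g5 g6 g7
      have hm : ∀ v, r.mult v + r'.mult v = s.mult v + s'.mult v := by
        simpa only [Rectangle.mult_eq_count] using g7
      have hyy : y' ≠ y := fun e => g1 (congrArg Subtype.val e)
      refine ⟨(y', s, s'), ?_, hss, g4, ?_, fun e => hyy (congrArg Prod.fst e)⟩
      · simp only [Finset.mem_filter, Finset.mem_univ, true_and]
        exact ⟨⟨⟨isGood_iff.2 g2, isGood_iff.2 g3⟩, g5⟩, g6⟩
      · rw [hf, hf, hσ.alternative x y y' z r r' s s' h1.1 h2.1 (isGood_iff.2 g2).1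
          (isGood_iff.2 g3).1 hyy hm]
        simp only [hm]
        ring
    · rintro ⟨y, r, r'⟩ - ⟨y₁, r₁, r₁'⟩ h1 ⟨y₂, r₂, r₂'⟩ h2 e1 e2
      simp only [Finset.mem_filter, Finset.mem_univ, true_and] at h1 h2 e1 e2
      rw [e1] at e2
      have e3 := Rectangle.box_injective (congrArg Prod.fst e2)
      have e4 := Rectangle.box_injective (congrArg Prod.snd e2)
      subst e3 e4
      rw [Subtype.ext ((isGood_iff.1 h1.1.1.1).unique (isGood_iff.1 h2.1.1.1))]
  rw [e4, e5, Finset.filter_filter, e2, e3]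
  split_ifs <;> ring

end Square

/-! ### The exact triangle of a factorization -/

section Algebra

variable {K : Type*} [CommRing K] {M M' : Type*} [AddCommGroup M] [Module K M]
  [AddCommGroup M'] [Module K M']

/-- The homology class of a cycle. -/
def homologyClass (d : M →ₗ[K] M) (x : M) (hx : d x = 0) : Homology d :=
  Submodule.Quotient.mk ⟨x, hx⟩

theorem exists_homologyClass {d : M →ₗ[K] M} (c : Homology d) :
    ∃ x hx, c = homologyClass d x hx := by
  obtain ⟨⟨x, hx⟩, rfl⟩ := Submodule.Quotient.mk_surjective _ c
  exact ⟨x, hx, rfl⟩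

theorem homologyClass_eq_iff {d : M →ₗ[K] M} {x y : M} {hx : d x = 0} {hy : d y = 0} :
    homologyClass d x hx = homologyClass d y hy ↔ ∃ m, d m = x - y := by
  unfold homologyClass
  rw [Submodule.Quotient.eq]
  rfl

theorem homologyClass_eq_zero_iff {d : M →ₗ[K] M} {x : M} {hx : d x = 0} :
    homologyClass d x hx = 0 ↔ ∃ m, d m = x := by
  unfold homologyClass
  rw [Submodule.Quotient.mk_eq_zero]
  rfl

theorem homologyClass_add {d : M →ₗ[K] M} {x y : M} (hx : d x = 0) (hy : d y = 0) :
    homologyClass d x hx + homologyClass d y hy =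
      homologyClass d (x + y) (by rw [map_add, hx, hy, add_zero]) := rfl

theorem smul_homologyClass {d : M →ₗ[K] M} {x : M} (k : K) (hx : d x = 0) :
    k • homologyClass d x hx = homologyClass d (k • x) (by rw [map_smul, hx, smul_zero]) := rfl

/-- A linear map between homologies, given by a linear relation between cycles under which
boundaries only correspond to boundaries. -/
theorem exists_linearMap_homology (d : M →ₗ[K] M) (d' : M' →ₗ[K] M') (G : Submodule K (M × M'))
    (htot : ∀ x, d x = 0 → ∃ y, d' y = 0 ∧ (x, y) ∈ G)
    (hzero : ∀ x y, (d x, y) ∈ G → d' y = 0 → ∃ m, d' m = y) :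
    ∃ f : Homology d →ₗ[K] Homology d', ∀ x hx y hy, (x, y) ∈ G →
      f (homologyClass d x hx) = homologyClass d' y hy := by
  have huniq : ∀ x x' (hx : d x = 0) (hx' : d x' = 0) y y' (hy : d' y = 0) (hy' : d' y' = 0),
      (x, y) ∈ G → (x', y') ∈ G → homologyClass d x hx = homologyClass d x' hx' →
      homologyClass d' y hy = homologyClass d' y' hy' := by
    intro x x' hx hx' y y' hy hy' h h' e
    obtain ⟨m, hm⟩ := homologyClass_eq_iff.1 e
    rw [homologyClass_eq_iff]
    refine hzero m (y - y') ?_ (by rw [map_sub, hy, hy', sub_zero])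
    rw [hm]
    exact G.sub_mem h h'
  have hex : ∀ c : Homology d, ∃ c' : Homology d', ∃ x hx y hy, (x, y) ∈ G ∧
      c = homologyClass d x hx ∧ c' = homologyClass d' y hy := by
    intro c
    obtain ⟨x, hx, rfl⟩ := exists_homologyClass c
    obtain ⟨y, hy, h⟩ := htot x hx
    exact ⟨_, x, hx, y, hy, h, rfl, rfl⟩
  choose f hf using hex
  have key : ∀ x hx y hy, (x, y) ∈ G → f (homologyClass d x hx) = homologyClass d' y hy := by
    intro x hx y hy h
    obtain ⟨x', hx', y', hy', h', e, e'⟩ := hf (homologyClass d x hx)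
    rw [e']
    exact huniq _ _ hx' hx _ _ hy' hy h' h e.symm
  refine ⟨⟨⟨f, fun c₁ c₂ => ?_⟩, fun k c => ?_⟩, key⟩
  · obtain ⟨x, hx, y, hy, h, e, e'⟩ := hf c₁
    obtain ⟨x', hx', y', hy', h', g, g'⟩ := hf c₂
    rw [e', g', e, g, homologyClass_add, homologyClass_add]
    exact key _ _ _ _ (G.add_mem h h')
  · obtain ⟨x, hx, y, hy, h, e, e'⟩ := hf c
    change f (k • c) = k • f c
    rw [e', e, smul_homologyClass, smul_homologyClass]
    exact key _ _ _ _ (G.smul_mem k h)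

variable {A B C₁ C₂ : Type*} [AddCommGroup A] [Module K A] [AddCommGroup B] [Module K B]
  [AddCommGroup C₁] [Module K C₁] [AddCommGroup C₂] [Module K C₂]

theorem mem_span_singleton_smul_top {u : K} {a : A} :
    a ∈ Ideal.span {u} • (⊤ : Submodule K A) ↔ ∃ e, u • e = a := by
  rw [Submodule.ideal_span_singleton_smul, Submodule.mem_smul_pointwise_iff_exists]
  simp

/-- Let `φ : A → B` and `ψ : B → A` anticommute with the differentials, and let `ψ φ = -u` with `u`
regular on `A`. Then the homologies of the cone of `φ`, of `A / u A` and of the cone of `ψ`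
form an exact triangle. This is the octahedral axiom for the composition `ψ φ`, whose cone is
quasi-isomorphic to `A / u A`. -/
theorem exactTriangle_of_factorization {dA : A →ₗ[K] A} {dB : B →ₗ[K] B} {φ : A →ₗ[K] B}
    {ψ : B →ₗ[K] A} {u : K} (hA : ∀ a, dA (dA a) = 0)
    (hφ : ∀ a, φ (dA a) + dB (φ a) = 0) (hψ : ∀ b, dA (ψ b) + ψ (dB b) = 0)
    (hψφ : ∀ a, ψ (φ a) = -(u • a)) (hu : ∀ a : A, u • a = 0 → a = 0)
    {d₁ : C₁ →ₗ[K] C₁} {d₂ : C₂ →ₗ[K] C₂} (e₁ : C₁ ≃ₗ[K] A × B) (e₂ : C₂ ≃ₗ[K] A × B)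
    (h₁ : ∀ x, e₁ (d₁ x) = (dA (e₁ x).1, φ (e₁ x).1 + dB (e₁ x).2))
    (h₂ : ∀ x, e₂ (d₂ x) = (dA (e₂ x).1 + ψ (e₂ x).2, dB (e₂ x).2)) :
    ExactTriangle K (Homology d₁) (Homology (quotientDifferential dA u)) (Homology d₂) := by
  have hq : ∀ a, quotientDifferential dA u (Submodule.Quotient.mk a) =
      Submodule.Quotient.mk (dA a) := fun a => rfl
  have hmk : ∀ a : A, (Submodule.Quotient.mk a : A ⧸ (Ideal.span {u} • (⊤ : Submodule K A))) = 0 ↔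
      ∃ e, u • e = a := fun a => by
    rw [Submodule.Quotient.mk_eq_zero, mem_span_singleton_smul_top]
  have hq0 : ∀ a, quotientDifferential dA u (Submodule.Quotient.mk a) = 0 ↔ ∃ w, u • w = dA a :=
    fun a => by rw [hq, hmk]
  -- cycles and boundaries in coordinates
  have c₁ : ∀ a b, d₁ (e₁.symm (a, b)) = 0 ↔ dA a = 0 ∧ φ a + dB b = 0 := fun a b => by
    rw [← e₁.map_eq_zero_iff, h₁, e₁.apply_symm_apply, Prod.mk_eq_zero]
  have c₂ : ∀ a b, d₂ (e₂.symm (a, b)) = 0 ↔ dA a + ψ b = 0 ∧ dB b = 0 := fun a b => by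
    rw [← e₂.map_eq_zero_iff, h₂, e₂.apply_symm_apply, Prod.mk_eq_zero]
  have b₁ : ∀ a b a' b', d₁ (e₁.symm (a, b)) = e₁.symm (a', b') ↔ dA a = a' ∧ φ a + dB b = b' :=
    fun a b a' b' => by
      rw [← e₁.injective.eq_iff, h₁, e₁.apply_symm_apply, e₁.apply_symm_apply, Prod.mk.injEq]
  have b₂ : ∀ a b a' b', d₂ (e₂.symm (a, b)) = e₂.symm (a', b') ↔ dA a + ψ b = a' ∧ dB b = b' :=
    fun a b a' b' => by
      rw [← e₂.injective.eq_iff, h₂, e₂.apply_symm_apply, e₂.apply_symm_apply, Prod.mk.injEq]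
  have hcyc : ∀ a w, u • w = dA a → dA w = 0 := fun a w h => by
    apply hu; rw [← map_smul, h, hA]
  -- the first map is induced by `(a, b) ↦ ψ b`
  obtain ⟨f₁, hf₁⟩ := exists_linearMap_homology d₁ (quotientDifferential dA u)
    (LinearMap.graph ((Submodule.mkQ (Ideal.span {u} • (⊤ : Submodule K A))) ∘ₗ ψ ∘ₗ
      LinearMap.snd K A B ∘ₗ e₁.toLinearMap)) (by
      intro x hx
      obtain ⟨⟨a, b⟩, rfl⟩ := e₁.symm.surjective x
      obtain ⟨ha, hb⟩ := (c₁ a b).1 hx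
      refine ⟨Submodule.Quotient.mk (ψ b), ?_, ?_⟩
      · rw [hq0]
        refine ⟨-a, ?_⟩
        have := hψ b
        rw [eq_neg_of_add_eq_zero_right hb, map_neg, hψφ, neg_neg] at this
        rw [smul_neg, eq_neg_of_add_eq_zero_left this]
      · simp [LinearMap.mem_graph_iff]) (by
      intro x y h hy
      obtain ⟨⟨a, b⟩, rfl⟩ := e₁.symm.surjective x
      rw [LinearMap.mem_graph_iff] at h
      simp only [LinearMap.comp_apply, LinearEquiv.coe_coe, h₁, LinearEquiv.apply_symm_apply,
        LinearMap.snd_apply] at h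
      refine ⟨Submodule.Quotient.mk (-ψ b), ?_⟩
      rw [hq, h, Submodule.mkQ_apply, Submodule.Quotient.eq, mem_span_singleton_smul_top]
      refine ⟨a, ?_⟩
      rw [map_add, hψφ, map_neg, eq_neg_of_add_eq_zero_right (hψ b)]
      abel)
  have hf₁' : ∀ a b (h : d₁ (e₁.symm (a, b)) = 0)
      (h' : quotientDifferential dA u (Submodule.Quotient.mk (ψ b)) = 0),
      f₁ (homologyClass d₁ _ h) = homologyClass _ _ h' := fun a b h h' =>
    hf₁ _ _ _ _ (by simp [LinearMap.mem_graph_iff])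
  -- the second map sends the class of `a` with `dA a = u w` to the class of `(a, φ w)`
  obtain ⟨f₂, hf₂⟩ := exists_linearMap_homology (quotientDifferential dA u) d₂
    { carrier := {t | ∃ a w, u • w = dA a ∧ t.1 = Submodule.Quotient.mk a ∧
        t.2 = e₂.symm (a, φ w)}
      add_mem' := by
        rintro s t ⟨a, w, h1, h2, h3⟩ ⟨a', w', h1', h2', h3'⟩
        refine ⟨a + a', w + w', by rw [smul_add, h1, h1', map_add], ?_, ?_⟩
        · rw [Prod.fst_add, h2, h2']; rfl
        · rw [Prod.snd_add, h3, h3', ← map_add, Prod.mk_add_mk, map_add]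
      zero_mem' := ⟨0, 0, by simp, rfl, by
        rw [map_zero]; exact (map_zero e₂.symm).symm⟩
      smul_mem' := by
        rintro k t ⟨a, w, h1, h2, h3⟩
        refine ⟨k • a, k • w, by rw [smul_comm, h1, map_smul], ?_, ?_⟩
        · rw [Prod.smul_fst, h2]; rfl
        · rw [Prod.smul_snd, h3, ← map_smul, Prod.smul_mk, map_smul] } (by
      intro x hx
      obtain ⟨a, rfl⟩ := Submodule.Quotient.mk_surjective _ x
      obtain ⟨w, hw⟩ := (hq0 a).1 hx
      refine ⟨e₂.symm (a, φ w), ?_, a, w, hw, rfl, rfl⟩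
      rw [c₂]
      refine ⟨by rw [hψφ, hw, add_neg_cancel], ?_⟩
      have := hφ w
      rwa [hcyc a w hw, map_zero, zero_add] at this) (by
      rintro x y ⟨a, w, h1, h2, h3⟩ -
      dsimp only at h2 h3
      obtain ⟨c, rfl⟩ := Submodule.Quotient.mk_surjective _ x
      rw [hq, Submodule.Quotient.eq, mem_span_singleton_smul_top] at h2
      obtain ⟨e, he⟩ := h2
      have hw : w = -dA e := by
        have : u • (w + dA e) = 0 := by
          rw [smul_add, h1, ← map_smul, he, map_sub, hA]; abel
        exact eq_neg_of_add_eq_zero_left (hu _ this)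
      refine ⟨e₂.symm (c, φ e), ?_⟩
      rw [h3, b₂, hψφ, he, hw, map_neg]
      exact ⟨by abel, eq_neg_of_add_eq_zero_right (hφ e)⟩)
  have hf₂' : ∀ a w (h : u • w = dA a)
      (h' : quotientDifferential dA u (Submodule.Quotient.mk a) = 0)
      (h'' : d₂ (e₂.symm (a, φ w)) = 0),
      f₂ (homologyClass _ _ h') = homologyClass d₂ _ h'' := fun a w h h' h'' =>
    hf₂ _ _ _ _ ⟨a, w, h, rfl, rfl⟩
  have hcyc₂ : ∀ a w, u • w = dA a → d₂ (e₂.symm (a, φ w)) = 0 := fun a w h => by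
    rw [c₂]
    refine ⟨by rw [hψφ, h, add_neg_cancel], ?_⟩
    have := hφ w
    rwa [hcyc a w h, map_zero, zero_add] at this
  -- the third map is induced by `(a, b) ↦ (0, b)`
  obtain ⟨f₃, hf₃⟩ := exists_linearMap_homology d₂ d₁
    (LinearMap.graph (e₁.symm.toLinearMap ∘ₗ LinearMap.inr K A B ∘ₗ LinearMap.snd K A B ∘ₗ
      e₂.toLinearMap)) (by
      intro x hx
      obtain ⟨⟨a, b⟩, rfl⟩ := e₂.symm.surjective x
      obtain ⟨ha, hb⟩ := (c₂ a b).1 hx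
      refine ⟨e₁.symm (0, b), (c₁ _ _).2 ⟨map_zero _, by rw [map_zero, hb, add_zero]⟩, ?_⟩
      simp [LinearMap.mem_graph_iff]) (by
      intro x y h hy
      obtain ⟨⟨a, b⟩, rfl⟩ := e₂.symm.surjective x
      rw [LinearMap.mem_graph_iff] at h
      simp only [LinearMap.comp_apply, LinearEquiv.coe_coe, h₂, LinearEquiv.apply_symm_apply,
        LinearMap.snd_apply, LinearMap.inr_apply] at h
      refine ⟨e₁.symm (0, b), ?_⟩
      rw [h, b₁]
      exact ⟨map_zero _, by rw [map_zero, zero_add]⟩)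
  have hf₃' : ∀ a b (h : d₂ (e₂.symm (a, b)) = 0) (h' : d₁ (e₁.symm (0, b)) = 0),
      f₃ (homologyClass d₂ _ h) = homologyClass d₁ _ h' := fun a b h h' =>
    hf₃ _ _ _ _ (by simp [LinearMap.mem_graph_iff])
  have hcyc₁ : ∀ b, dB b = 0 → d₁ (e₁.symm (0, b)) = 0 := fun b h =>
    (c₁ _ _).2 ⟨map_zero _, by rw [map_zero, h, add_zero]⟩
  refine ⟨f₁, f₂, f₃, fun c => ⟨fun hc => ?_, ?_⟩, fun c => ⟨fun hc => ?_, ?_⟩,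
    fun c => ⟨fun hc => ?_, ?_⟩⟩
  · obtain ⟨x, hx, rfl⟩ := exists_homologyClass c
    obtain ⟨a₀, rfl⟩ := Submodule.Quotient.mk_surjective _ x
    obtain ⟨w, hw⟩ := (hq0 a₀).1 hx
    rw [hf₂' a₀ w hw hx (hcyc₂ a₀ w hw), homologyClass_eq_zero_iff] at hc
    obtain ⟨m, hm⟩ := hc
    obtain ⟨⟨a, b⟩, rfl⟩ := e₂.symm.surjective m
    obtain ⟨g1, g2⟩ := (b₂ _ _ _ _).1 hm
    have hz : d₁ (e₁.symm (-w, b)) = 0 := by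
      rw [c₁, map_neg, hcyc a₀ w hw, map_neg, g2]
      exact ⟨neg_zero, neg_add_cancel _⟩
    have hz' : quotientDifferential dA u (Submodule.Quotient.mk (ψ b)) = 0 := by
      rw [hq0]
      refine ⟨w, ?_⟩
      rw [hw, ← g1, map_add, hA, zero_add]
    refine ⟨homologyClass d₁ _ hz, ?_⟩
    rw [hf₁' _ _ hz hz', homologyClass_eq_iff]
    refine ⟨Submodule.Quotient.mk (-a), ?_⟩
    rw [hq, ← Submodule.Quotient.mk_sub, ← g1, map_neg]
    congr 1; abel
  · rintro ⟨c', rfl⟩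
    obtain ⟨x, hx, rfl⟩ := exists_homologyClass c'
    obtain ⟨⟨a, b⟩, rfl⟩ := e₁.symm.surjective x
    obtain ⟨g1, g2⟩ := (c₁ _ _).1 hx
    have hw : u • (-a) = dA (ψ b) := by
      have := hψ b
      rw [eq_neg_of_add_eq_zero_right g2, map_neg, hψφ, neg_neg] at this
      rw [smul_neg, eq_neg_of_add_eq_zero_left this]
    rw [hf₁' a b hx ((hq0 _).2 ⟨_, hw⟩), hf₂' _ _ hw _ (hcyc₂ _ _ hw), homologyClass_eq_zero_iff]
    refine ⟨e₂.symm (0, b), ?_⟩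
    rw [b₂, map_zero, zero_add, map_neg]
    exact ⟨rfl, eq_neg_of_add_eq_zero_right g2⟩
  · obtain ⟨x, hx, rfl⟩ := exists_homologyClass c
    obtain ⟨⟨a, b⟩, rfl⟩ := e₂.symm.surjective x
    obtain ⟨g1, g2⟩ := (c₂ _ _).1 hx
    rw [hf₃' a b hx (hcyc₁ b g2), homologyClass_eq_zero_iff] at hc
    obtain ⟨m, hm⟩ := hc
    obtain ⟨⟨a₁, b₁'⟩, rfl⟩ := e₁.symm.surjective m
    obtain ⟨k1, k2⟩ := (b₁ _ _ _ _).1 hm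
    have hw : u • a₁ = dA (a - ψ b₁') := by
      rw [map_sub, eq_neg_of_add_eq_zero_left g1, ← k2, map_add, hψφ,
        eq_neg_of_add_eq_zero_left (hψ b₁')]
      abel
    refine ⟨homologyClass _ _ ((hq0 _).2 ⟨_, hw⟩), ?_⟩
    rw [hf₂' _ _ hw _ (hcyc₂ _ _ hw), homologyClass_eq_iff]
    refine ⟨e₂.symm (0, -b₁'), ?_⟩
    rw [← map_sub, Prod.mk_sub_mk, b₂, map_zero, zero_add, map_neg, map_neg, ← k2]
    exact ⟨by abel, by abel⟩
  · rintro ⟨c', rfl⟩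
    obtain ⟨x, hx, rfl⟩ := exists_homologyClass c'
    obtain ⟨a₀, rfl⟩ := Submodule.Quotient.mk_surjective _ x
    obtain ⟨w, hw⟩ := (hq0 a₀).1 hx
    have hz := hcyc₂ a₀ w hw
    rw [hf₂' a₀ w hw hx hz, hf₃' _ _ hz (hcyc₁ _ ((c₂ _ _).1 hz).2), homologyClass_eq_zero_iff]
    refine ⟨e₁.symm (w, 0), ?_⟩
    rw [b₁, map_zero, add_zero]
    exact ⟨hcyc a₀ w hw, rfl⟩
  · obtain ⟨x, hx, rfl⟩ := exists_homologyClass c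
    obtain ⟨⟨a, b⟩, rfl⟩ := e₁.symm.surjective x
    obtain ⟨g1, g2⟩ := (c₁ _ _).1 hx
    have hw : u • (-a) = dA (ψ b) := by
      have := hψ b
      rw [eq_neg_of_add_eq_zero_right g2, map_neg, hψφ, neg_neg] at this
      rw [smul_neg, eq_neg_of_add_eq_zero_left this]
    rw [hf₁' a b hx ((hq0 _).2 ⟨_, hw⟩), homologyClass_eq_zero_iff] at hc
    obtain ⟨m, hm⟩ := hc
    obtain ⟨k, rfl⟩ := Submodule.Quotient.mk_surjective _ m
    rw [hq, Submodule.Quotient.eq, mem_span_singleton_smul_top] at hm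
    obtain ⟨e, he⟩ := hm
    -- `u e = dA k - ψ b`, hence `a = dA e`
    have ha : a = dA e := by
      have : u • (dA e - a) = 0 := by
        rw [smul_sub, ← map_smul, he, map_sub, hA, ← hw, smul_neg]; abel
      exact (sub_eq_zero.1 (hu _ this)).symm
    have hb : dB (b - φ e) = 0 := by
      rw [map_sub, eq_neg_of_add_eq_zero_right g2, eq_neg_of_add_eq_zero_right (hφ e), ha]
      abel
    have hz : d₂ (e₂.symm (-k, b - φ e)) = 0 := by
      rw [c₂]
      refine ⟨?_, hb⟩
      rw [map_neg, map_sub, hψφ, he]; abel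
    refine ⟨homologyClass _ _ hz, ?_⟩
    rw [hf₃' _ _ hz (hcyc₁ _ hb), homologyClass_eq_iff]
    refine ⟨e₁.symm (-e, 0), ?_⟩
    rw [← map_sub, Prod.mk_sub_mk, b₁, map_zero, add_zero, map_neg, map_neg, ha]
    exact ⟨by abel, by abel⟩
  · rintro ⟨c', rfl⟩
    obtain ⟨x, hx, rfl⟩ := exists_homologyClass c'
    obtain ⟨⟨a, b⟩, rfl⟩ := e₂.symm.surjective x
    obtain ⟨g1, g2⟩ := (c₂ _ _).1 hx
    have hz := hcyc₁ b g2
    have hz' : quotientDifferential dA u (Submodule.Quotient.mk (ψ b)) = 0 := by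
      rw [hq0]
      refine ⟨0, ?_⟩
      rw [eq_neg_of_add_eq_zero_right g1, map_neg, hA]; simp
    rw [hf₃' _ _ hx hz, hf₁' _ _ hz hz', homologyClass_eq_zero_iff]
    refine ⟨Submodule.Quotient.mk (-a), ?_⟩
    rw [hq, map_neg, eq_neg_of_add_eq_zero_right g1]

end Algebra

/-! ### Matrices of differentials -/

section Matrices

variable {K : Type*} [CommRing K] {α β : Type*}

/-- The linear map between free modules with the matrix `m`. -/
def matMap [Fintype β] (m : α → β → K) : (α →₀ K) →ₗ[K] (β →₀ K) :=
  Finsupp.linearCombination K fun x => ∑ y, Finsupp.single y (m x y)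

theorem matMap_apply [Fintype α] [Fintype β] (m : α → β → K) (f : α →₀ K) (y : β) :
    matMap m f y = ∑ x, f x * m x y := by
  classical
  rw [matMap, Finsupp.linearCombination_apply, Finsupp.sum_fintype _ _ (by simp),
    Finsupp.finsetSum_apply]
  refine Finset.sum_congr rfl fun x _ => ?_
  rw [Finsupp.smul_apply, Finsupp.finsetSum_apply, smul_eq_mul]
  simp [Finsupp.single_apply]

theorem matMap_matMap_apply [Fintype α] {γ : Type*} [Fintype β] [Fintype γ] (m : α → β → K)
    (m' : β → γ → K) (f : α →₀ K) (z : γ) :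
    matMap m' (matMap m f) z = ∑ x, f x * ∑ y, m x y * m' y z := by
  simp only [matMap_apply, Finset.sum_mul, Finset.mul_sum, mul_assoc]
  rw [Finset.sum_comm]

/-- Two block triangular differentials with the same diagonal blocks, one lower and the other one
upper triangular, such that the product of the two off-diagonal blocks is `-u` on the free module
on `α`. -/
theorem exactTriangle_of_blocks {S : Type*} [Fintype S] [Fintype α] [Fintype β] [DecidableEq α]
    (E : S ≃ α ⊕ β) {m₁ m₂ : S → S → K} {m : α → α → K} {u : K}
    (h₁ : ∀ x z, ∑ y, m₁ x y * m₁ y z = 0) (h₂ : ∀ x z, ∑ y, m₂ x y * m₂ y z = 0)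
    (aa₁ : ∀ a a', m₁ (E.symm (.inl a)) (E.symm (.inl a')) = m a a')
    (aa₂ : ∀ a a', m₂ (E.symm (.inl a)) (E.symm (.inl a')) = m a a')
    (ba₁ : ∀ b a, m₁ (E.symm (.inr b)) (E.symm (.inl a)) = 0)
    (ab₂ : ∀ a b, m₂ (E.symm (.inl a)) (E.symm (.inr b)) = 0)
    (bb : ∀ b b', m₁ (E.symm (.inr b)) (E.symm (.inr b')) = m₂ (E.symm (.inr b)) (E.symm (.inr b')))
    (hu : ∀ a a', ∑ a₀, m a a₀ * m a₀ a' +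
      ∑ b, m₁ (E.symm (.inl a)) (E.symm (.inr b)) * m₂ (E.symm (.inr b)) (E.symm (.inl a')) =
        if a = a' then -u else 0)
    (reg : ∀ k : K, u * k = 0 → k = 0) :
    ExactTriangle K (Homology (matMap m₁)) (Homology (quotientDifferential (matMap m) u))
      (Homology (matMap m₂)) := by
  have split : ∀ f : S → K, ∑ y, f y = ∑ a, f (E.symm (.inl a)) + ∑ b, f (E.symm (.inr b)) :=
    fun f => by rw [← E.symm.sum_comp f, Fintype.sum_sum_type]
  simp only [split] at h₁ h₂
  let e : (S →₀ K) ≃ₗ[K] (α →₀ K) × (β →₀ K) :=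
    Finsupp.domLCongr E ≪≫ₗ Finsupp.sumFinsuppLEquivProdFinsupp K
  have e_fst : ∀ f a, (e f).1 a = f (E.symm (.inl a)) := fun f a => rfl
  have e_snd : ∀ f b, (e f).2 b = f (E.symm (.inr b)) := fun f b => rfl
  have hm : ∀ a a', ∑ a₀, m a a₀ * m a₀ a' = 0 := fun a a' => by
    simpa [aa₁, ba₁] using h₁ (E.symm (.inl a)) (E.symm (.inl a'))
  refine exactTriangle_of_factorization (dA := matMap m) (u := u)
    (dB := matMap fun b b' => m₂ (E.symm (.inr b)) (E.symm (.inr b')))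
    (φ := matMap fun a b => m₁ (E.symm (.inl a)) (E.symm (.inr b)))
    (ψ := matMap fun b a => m₂ (E.symm (.inr b)) (E.symm (.inl a)))
    ?_ ?_ ?_ ?_ ?_ e e ?_ ?_
  · intro f
    ext z
    rw [matMap_matMap_apply]
    simp [hm]
  · intro f
    ext z
    rw [Finsupp.add_apply, matMap_matMap_apply, matMap_matMap_apply, ← Finset.sum_add_distrib]
    refine Finset.sum_eq_zero fun a _ => ?_
    have := h₁ (E.symm (.inl a)) (E.symm (.inr z))
    simp only [aa₁, bb] at this
    rw [← mul_add, this, mul_zero]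
  · intro f
    ext z
    rw [Finsupp.add_apply, matMap_matMap_apply, matMap_matMap_apply, ← Finset.sum_add_distrib]
    refine Finset.sum_eq_zero fun b _ => ?_
    have := h₂ (E.symm (.inr b)) (E.symm (.inl z))
    simp only [aa₂] at this
    rw [← mul_add, this, mul_zero]
  · intro f
    ext z
    rw [matMap_matMap_apply, Finsupp.neg_apply, Finsupp.smul_apply, smul_eq_mul]
    simp only [hm, zero_add] at hu
    simp [hu, mul_comm]
  · intro f hf
    ext z
    exact reg _ (by simpa using DFunLike.congr_fun hf z)
  · intro f
    refine Prod.ext ?_ ?_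
    · ext a
      simp only [e_fst, matMap_apply, split, aa₁, ba₁]
      simp
    · ext b
      simp only [e_snd, e_fst, matMap_apply, split, bb, Finsupp.add_apply]
  · intro f
    refine Prod.ext ?_ ?_
    · ext a
      simp only [e_snd, e_fst, matMap_apply, split, aa₂, Finsupp.add_apply]
    · ext b
      simp only [e_snd, matMap_apply, split, ab₂]
      simp

theorem ExactTriangle.rotate {M₁ M₂ M₃ : Type*} [AddCommGroup M₁] [Module K M₁] [AddCommGroup M₂]
    [Module K M₂] [AddCommGroup M₃] [Module K M₃] (h : ExactTriangle K M₁ M₂ M₃) :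
    ExactTriangle K M₃ M₁ M₂ := by
  obtain ⟨f₁, f₂, f₃, h1, h2, h3⟩ := h
  exact ⟨f₃, f₁, f₂, h3, h1, h2⟩

end Matrices

/-! ### The matrix of the differential of a grid diagram -/

section Weights

open MvPolynomial

variable {N p : ℕ} {q : ℤ} {R : Type*} [CommRing R] {ι : Type*}

/-- The signs in the coefficient ring. -/
def signCoeff (R : Type*) [CommRing R] (ι : Type*) {N p : ℕ} {q : ℤ} (S : Signs N p q)
    (x y : State N p q) (r : Rectangle N p q) : MvPolynomial ι R :=
  C (((S x y r : ℤˣ) : ℤ) : R)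

theorem IsSignAssignment.signLaw {S : Signs N p q} (hS : IsSignAssignment S) :
    SignLaw (signCoeff R ι S) where
  alternative x w y z r₁ r₂ s₁ s₂ h1 h2 h3 h4 h5 h6 := by
    simp only [signCoeff, ← map_mul, ← map_neg]
    have := hS.alternative x w y z r₁ r₂ s₁ s₂ h1 h2 h3 h4 h5 h6
    have := congrArg (fun e : ℤˣ => ((e : ℤ) : R)) this
    simpa using congrArg C this
  horizontal x y r₁ r₂ h1 h2 h3 h4 h5 := by
    simp only [signCoeff, ← map_mul]
    have := hS.horizontal x y r₁ r₂ h1 h2 h3 h4 h5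
    have := congrArg (fun e : ℤˣ => ((e : ℤ) : R)) this
    simpa using congrArg (C (σ := ι)) this
  vertical x y r₁ r₂ h1 h2 h3 h4 h5 := by
    simp only [signCoeff, ← map_mul]
    have := hS.vertical x y r₁ r₂ h1 h2 h3 h4 h5
    have := congrArg (fun e : ℤˣ => ((e : ℤ) : R)) this
    simpa using congrArg (C (σ := ι)) this

/-- In characteristic two, no signs are needed. -/
theorem signLaw_one [CharP R 2] :
    SignLaw (signCoeff R ι (1 : Signs N p q)) := by
  have h : (1 : MvPolynomial ι R) = -1 := by
    rw [eq_neg_iff_add_eq_zero, one_add_one_eq_two]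
    exact CharTwo.two_eq_zero
  constructor <;> intros <;> simp [signCoeff, ← h]

variable [NeZero N] [NeZero p] [Fintype ι]

open Classical in
/-- The weight `0` of the blocked cells, and the product of the variables of the `O`s in each of
the other cells. -/
def cellWeight (R : Type*) [CommRing R] {N p : ℕ} {q : ℤ} {ι : Type*} [Fintype ι]
    (O : ι → Torus N p q) (Z : Set (Torus N p q)) (v : Torus N p q) : MvPolynomial ι R :=
  if v ∈ Z then 0 else ∏ i, if O i = v then X i else 1

open Classical in
theorem weight_cellWeight (O : ι → Torus N p q) (Z : Set (Torus N p q)) (r : Rectangle N p q) :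
    weight (cellWeight R O Z) r =
      if ∀ c ∈ Z, r.mult c = 0 then ∏ i, X i ^ r.mult (O i) else 0 := by
  unfold weight cellWeight
  split_ifs with h
  · have : ∀ v, (if v ∈ Z then 0 else ∏ i, if O i = v then (X i : MvPolynomial ι R) else 1) ^
        r.mult v = ∏ i, (if O i = v then X i else 1) ^ r.mult v := by
      intro v
      split_ifs with hv
      · simp [h v hv]
      · rw [Finset.prod_pow]
    simp only [this]
    rw [Finset.prod_comm]
    refine Finset.prod_congr rfl fun i _ => ?_
    rw [Finset.prod_eq_single (O i)]
    · rw [if_pos rfl]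
    · intro v _ hv
      rw [if_neg (Ne.symm hv), one_pow]
    · simp
  · push Not at h
    obtain ⟨c, hc, h0⟩ := h
    refine Finset.prod_eq_zero (Finset.mem_univ c) ?_
    rw [if_pos hc, zero_pow h0]

theorem boundary_eq_matMap (g : Markings N p q ι) (S : Signs N p q) :
    boundary R g S = matMap (coeff (signCoeff R ι S) (cellWeight R g.O (g.X ∪ g.XX))) := by
  classical
  unfold boundary matMap
  congr 1
  funext x
  refine Finset.sum_congr rfl fun y _ => ?_
  unfold coeff
  rw [Finset.sum_filter, Finset.sum_filter, Finsupp.single_finsetSum]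
  refine Finset.sum_congr rfl fun r _ => ?_
  rw [weight_cellWeight]
  unfold Rectangle.IsGood signCoeff
  by_cases h3 : ∀ c ∈ g.X ∪ g.XX, r.mult c = 0
  · rw [if_pos h3]
    by_cases h : r.IsFromTo x y ∧ r.IsEmpty x y
    · rw [if_pos h, if_pos ⟨h.1, h.2, h3⟩]
    · rw [if_neg h, if_neg (fun h' => h ⟨h'.1, h'.2.1⟩), Finsupp.single_zero]
  · rw [if_neg (fun h => h3 h.2.2), if_neg h3, mul_zero, ite_self, Finsupp.single_zero]

open Classical in
/-- The weights of the thin annuli, for the rows or the columns `ℓ`: only the annuli without blocked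
cells contribute. -/
theorem sum_prod_cellWeight (ℓ : Torus N p q → ZMod N) (O : ι → Torus N p q)
    (Z : Set (Torus N p q))
    (h : ∀ r : ZMod N, (∀ v ∈ Z, ℓ v ≠ r) → {i | ℓ (O i) = r}.ncard = 1) :
    ∑ r : ZMod N, ∏ v : Torus N p q with ℓ v = r, cellWeight R O Z v =
      ∑ i with ∀ v ∈ Z, ℓ v ≠ ℓ (O i), (X i : MvPolynomial ι R) := by
  have hr : ∀ r : ZMod N, ∏ v : Torus N p q with ℓ v = r, cellWeight R O Z v =
      ∑ i with (∀ v ∈ Z, ℓ v ≠ ℓ (O i)) ∧ ℓ (O i) = r, X i := by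
    intro r
    by_cases hZ : ∀ v ∈ Z, ℓ v ≠ r
    · obtain ⟨i, hi⟩ := Set.ncard_eq_one.1 (h r hZ)
      have hi' : ∀ j, ℓ (O j) = r ↔ j = i := fun j => Set.ext_iff.1 hi j
      have e : (Finset.univ.filter fun j => (∀ v ∈ Z, ℓ v ≠ ℓ (O j)) ∧ ℓ (O j) = r) = {i} := by
        ext j
        simp only [Finset.mem_filter, Finset.mem_univ, true_and, Finset.mem_singleton, ← hi']
        exact ⟨fun h => h.2, fun h => ⟨h ▸ hZ, h⟩⟩
      rw [e, Finset.sum_singleton]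
      have e' : ∀ v ∈ Finset.univ.filter (fun v : Torus N p q => ℓ v = r),
          cellWeight R O Z v = ∏ j, if O j = v then X j else 1 := by
        intro v hv
        rw [cellWeight, if_neg]
        exact fun hv' => hZ v hv' (Finset.mem_filter.1 hv).2
      rw [Finset.prod_congr rfl e', Finset.prod_comm, Finset.prod_eq_single i]
      · rw [Finset.prod_ite_eq, if_pos]
        simpa using (hi' i).2 rfl
      · intro j _ hj
        refine Finset.prod_eq_one fun v hv => if_neg fun e => hj ((hi' j).1 ?_)
        rw [e]; exact (Finset.mem_filter.1 hv).2
      · simp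
    · push Not at hZ
      obtain ⟨v, hv, hvr⟩ := hZ
      rw [Finset.prod_eq_zero (i := v) (by simpa using hvr) (by rw [cellWeight, if_pos hv])]
      rw [Finset.filter_eq_empty_iff.2, Finset.sum_empty]
      rintro i - ⟨h1, h2⟩
      exact h1 v hv (hvr.trans h2.symm)
  simp only [hr]
  rw [← Finset.sum_fiberwise _ (fun i => ℓ (O i))]
  simp only [Finset.filter_filter]

theorem Markings.IsGridDiagram.exists_row {N p : ℕ} {q : ℤ} {ι : Type*} {g : Markings N p q ι}
    (hg : g.IsGridDiagram) (r : ZMod N) : ∃ v ∈ g.X ∪ g.XX, row v = r := by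
  rcases hg.rows r with ⟨-, h, -⟩ | ⟨-, -, h⟩
  · obtain ⟨v, hv⟩ := Set.ncard_eq_one.1 h
    have : v ∈ {x ∈ g.X | row x = r} := by rw [hv]; rfl
    exact ⟨v, Or.inl this.1, this.2⟩
  · obtain ⟨v, hv⟩ := Set.ncard_eq_one.1 h
    have : v ∈ {x ∈ g.XX | row x = r} := by rw [hv]; rfl
    exact ⟨v, Or.inr this.1, this.2⟩

theorem Markings.IsGridDiagram.exists_col {N p : ℕ} {q : ℤ} {ι : Type*} {g : Markings N p q ι}
    (hg : g.IsGridDiagram) (r : ZMod N) : ∃ v ∈ g.X ∪ g.XX, col v = r := by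
  rcases hg.cols r with ⟨-, h, -⟩ | ⟨-, -, h⟩
  · obtain ⟨v, hv⟩ := Set.ncard_eq_one.1 h
    have : v ∈ {x ∈ g.X | col x = r} := by rw [hv]; rfl
    exact ⟨v, Or.inl this.1, this.2⟩
  · obtain ⟨v, hv⟩ := Set.ncard_eq_one.1 h
    have : v ∈ {x ∈ g.XX | col x = r} := by rw [hv]; rfl
    exact ⟨v, Or.inr this.1, this.2⟩

/-- If every row and every column contains a blocked cell, then the differential has square zero. -/
theorem sum_coeff_mul_coeff_eq_zero (hpq : IsCoprime (p : ℤ) q) (hN : 1 < N) {S : Signs N p q}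
    (hS : SignLaw (signCoeff R ι S)) {O : ι → Torus N p q} {Z : Set (Torus N p q)}
    (hrow : ∀ r : ZMod N, ∃ v ∈ Z, row v = r) (hcol : ∀ c : ZMod N, ∃ v ∈ Z, col v = c)
    (x z : State N p q) :
    ∑ y, coeff (signCoeff R ι S) (cellWeight R O Z) x y *
      coeff (signCoeff R ι S) (cellWeight R O Z) y z = 0 := by
  classical
  rw [sum_coeff_mul_coeff hpq hN hS, sum_prod_cellWeight row, sum_prod_cellWeight col,
    Finset.filter_eq_empty_iff.2, Finset.filter_eq_empty_iff.2, Finset.sum_empty, sub_zero,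
    ite_self]
  · intro i _ h
    obtain ⟨v, hv, e⟩ := hcol (col (O i))
    exact h v hv e
  · intro i _ h
    obtain ⟨v, hv, e⟩ := hrow (row (O i))
    exact h v hv e
  · intro c h
    obtain ⟨v, hv, e⟩ := hcol c
    exact absurd e (h v hv)
  · intro c h
    obtain ⟨v, hv, e⟩ := hrow c
    exact absurd e (h v hv)

end Weights

/-! ### The differential near the block -/

section Block

variable {N p : ℕ} {q : ℤ}

theorem Rectangle.mult_ne_zero_iff {r : Rectangle N p q} {c : Torus N p q} :
    r.mult c ≠ 0 ↔ ∃ i j : ℕ, i < r.width ∧ j < r.height ∧ r.corner + pt i j = c := by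
  have hfin : {u : ℕ × ℕ | u.1 < r.width ∧ u.2 < r.height ∧ r.corner + pt u.1 u.2 = c}.Finite :=
    ((Set.finite_Iio r.width).prod (Set.finite_Iio r.height)).subset
      fun u hu => ⟨hu.1, hu.2.1⟩
  rw [Rectangle.mult, Ne, Set.ncard_eq_zero hfin, ← Ne, ← Set.nonempty_iff_ne_empty]
  exact ⟨fun ⟨u, h⟩ => ⟨u.1, u.2, h⟩, fun ⟨i, j, h⟩ => ⟨(i, j), h⟩⟩

/-- The position of a point relative to a rectangle: it is either outside the closed rectangle, or
has coordinates `I`, `J` in it. These determine which of the four cells around the point lie in the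
rectangle, and whether the point belongs to the two generators. -/
theorem Rectangle.IsGood.position {r : Rectangle N p q} {x y : State N p q} (H : r.IsGood x y)
    (P : Torus N p q) :
    (r.mult P = 0 ∧ r.mult (P - pt 1 0) = 0 ∧ r.mult (P - pt 1 1) = 0 ∧ r.mult (P - pt 0 1) = 0 ∧
      (P ∈ x.1 ↔ P ∈ y.1)) ∨
    ∃ I J : ℕ, I ≤ r.width ∧ J ≤ r.height ∧ 0 < r.width ∧ 0 < r.height ∧
      (r.mult P ≠ 0 ↔ I < r.width ∧ J < r.height) ∧
      (r.mult (P - pt 1 0) ≠ 0 ↔ 0 < I ∧ J < r.height) ∧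
      (r.mult (P - pt 1 1) ≠ 0 ↔ 0 < I ∧ 0 < J) ∧
      (r.mult (P - pt 0 1) ≠ 0 ↔ I < r.width ∧ 0 < J) ∧
      (P ∈ x.1 ↔ (I = 0 ∧ J = 0) ∨ (I = r.width ∧ J = r.height)) ∧
      (P ∈ y.1 ↔ (I = r.width ∧ J = 0) ∨ (I = 0 ∧ J = r.height)) := by
  obtain ⟨⟨w0, h0, emb, ll, ur, hy⟩, he⟩ := H
  have cell : ∀ a b : ℕ, r.mult (P - pt a b) ≠ 0 ↔
      ∃ i j : ℕ, i < r.width ∧ j < r.height ∧ r.corner + pt ((i + a : ℕ) : ℤ) ((j + b : ℕ) : ℤ) = P := by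
    intro a b
    rw [Rectangle.mult_ne_zero_iff]
    simp only [eq_sub_iff_add_eq, add_assoc, pt_add, Nat.cast_add]
  have c00 := cell 0 0
  have c10 := cell 1 0
  have c11 := cell 1 1
  have c01 := cell 0 1
  simp only [Nat.cast_zero, Nat.cast_one, add_zero, show (pt 0 0 : Torus N p q) = 0 from rfl,
    sub_zero] at c00 c10 c11 c01
  by_cases hP : ∃ I J : ℕ, I ≤ r.width ∧ J ≤ r.height ∧ r.corner + pt I J = P
  · right
    obtain ⟨I, J, hI, hJ, e⟩ := hP
    have inj : ∀ i j : ℕ, i ≤ r.width → j ≤ r.height → (r.corner + pt i j = P ↔ i = I ∧ j = J) := by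
      intro i j hi hj
      constructor
      · intro e'
        have := emb (x₁ := (i, j)) (x₂ := (I, J)) ⟨hi, hj⟩ ⟨hI, hJ⟩ (e'.trans e.symm)
        simpa using this
      · rintro ⟨rfl, rfl⟩; exact e
    have ill : r.corner = P ↔ 0 = I ∧ 0 = J := by
      rw [← inj 0 0 (by omega) (by omega)]
      simp [show (pt 0 0 : Torus N p q) = 0 from rfl]
    have iur := inj r.width r.height le_rfl le_rfl
    have hx : P ∈ x.1 ↔ (I = 0 ∧ J = 0) ∨ (I = r.width ∧ J = r.height) := by
      constructor
      · intro hx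
        have g := x.generic
        by_contra hc
        have n1 : r.corner ≠ P := fun e => hc (Or.inl ⟨(ill.1 e).1.symm, (ill.1 e).2.symm⟩)
        have n2 : r.corner + pt r.width r.height ≠ P := fun e =>
          hc (Or.inr ⟨(iur.1 e).1.symm, (iur.1 e).2.symm⟩)
        have cP : col P = col r.corner + ((I : ℤ) : ZMod N) := by rw [← e, map_add, col_pt]
        have rP : row P = row r.corner + ((J : ℤ) : ZMod N) := by rw [← e, map_add, row_pt]
        by_cases h1 : I = 0
        · exact n1 (g.1 _ ll _ hx (by
            change col _ = col _; rw [cP, h1]; simp))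
        by_cases h2 : J = 0
        · exact n1 (g.2 _ ll _ hx (by
            change row _ = row _; rw [rP, h2]; simp))
        by_cases h3 : I = r.width
        · exact n2 (g.1 _ ur _ hx (by
            change col _ = col _; rw [cP, h3, map_add, col_pt]))
        by_cases h4 : J = r.height
        · exact n2 (g.2 _ ur _ hx (by
            change row _ = row _; rw [rP, h4, map_add, row_pt]))
        exact (he I J (by omega) (by omega) (by omega) (by omega)).1 (e ▸ hx)
      · rintro (⟨rfl, rfl⟩ | ⟨rfl, rfl⟩)
        · rw [← ill.2 ⟨rfl, rfl⟩]; exact ll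
        · rw [← e]; exact ur
    refine ⟨I, J, hI, hJ, w0, h0, ?_, ?_, ?_, ?_, hx, ?_⟩
    · rw [c00]
      exact ⟨fun ⟨i, j, h1, h2, h3⟩ => by have := (inj i j (by omega) (by omega)).1 h3; omega,
        fun h => ⟨I, J, h.1, h.2, e⟩⟩
    · rw [c10]
      exact ⟨fun ⟨i, j, h1, h2, h3⟩ => by
          have := (inj (i + 1) j (by omega) (by omega)).1 h3; omega,
        fun h => ⟨I - 1, J, by omega, by omega, by rw [Nat.sub_add_cancel h.1]; exact e⟩⟩
    · rw [c11]
      exact ⟨fun ⟨i, j, h1, h2, h3⟩ => by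
          have := (inj (i + 1) (j + 1) (by omega) (by omega)).1 h3; omega,
        fun h => ⟨I - 1, J - 1, by omega, by omega, by
          rw [Nat.sub_add_cancel h.1, Nat.sub_add_cancel h.2]; exact e⟩⟩
    · rw [c01]
      exact ⟨fun ⟨i, j, h1, h2, h3⟩ => by
          have := (inj i (j + 1) (by omega) (by omega)).1 h3; omega,
        fun h => ⟨I, J - 1, by omega, by omega, by rw [Nat.sub_add_cancel h.2]; exact e⟩⟩
    · have i1 := inj r.width 0 le_rfl (by omega)
      have i2 := inj 0 r.height (by omega) le_rfl
      simp only [Nat.cast_zero] at i1 i2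
      simp only [hy, Set.mem_union, Set.mem_sdiff, Set.mem_insert_iff, Set.mem_singleton_iff, hx,
        eq_comm (a := P), ill, iur, i1, i2]
      omega
  · left
    have out : ∀ i j : ℕ, i ≤ r.width → j ≤ r.height → r.corner + pt i j ≠ P :=
      fun i j hi hj e => hP ⟨i, j, hi, hj, e⟩
    refine ⟨?_, ?_, ?_, ?_, ?_⟩
    · by_contra h
      obtain ⟨i, j, hi, hj, e⟩ := c00.1 h
      exact out i j hi.le hj.le e
    · by_contra h
      obtain ⟨i, j, hi, hj, e⟩ := c10.1 h
      exact out _ _ hi hj.le e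
    · by_contra h
      obtain ⟨i, j, hi, hj, e⟩ := c11.1 h
      exact out _ _ hi hj e
    · by_contra h
      obtain ⟨i, j, hi, hj, e⟩ := c01.1 h
      exact out _ _ hi.le hj e
    · have o1 := out 0 0 (by omega) (by omega)
      have o2 := out r.width r.height le_rfl le_rfl
      have o3 := out r.width 0 le_rfl (by omega)
      have o4 := out 0 r.height (by omega) le_rfl
      simp only [Nat.cast_zero, show (pt 0 0 : Torus N p q) = 0 from rfl, add_zero] at o1 o3 o4
      simp only [hy, Set.mem_union, Set.mem_sdiff, Set.mem_insert_iff, Set.mem_singleton_iff,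
        eq_comm (a := P), o1, o2, o3, o4]
      simp

section

variable {r : Rectangle N p q} {x y : State N p q} {P : Torus N p q}

/-- The four lemmas `block_of_…` say which of the cells around a point `P` a rectangle contains,
depending on whether `P` belongs to the two generators. The cells are grouped in the two diagonals
of the `2 × 2` block around `P`. -/
theorem Rectangle.IsGood.block_of_mem_of_mem (H : r.IsGood x y) (hx : P ∈ x.1) (hy : P ∈ y.1) :
    (r.mult P = 0 ∧ r.mult (P - pt 1 1) = 0) ∧ r.mult (P - pt 1 0) = 0 ∧
      r.mult (P - pt 0 1) = 0 := by
  rcases H.position P with h | ⟨I, J, h⟩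
  · exact ⟨⟨h.1, h.2.2.1⟩, h.2.1, h.2.2.2.1⟩
  · simp only [hx, hy, true_iff] at h; omega

theorem Rectangle.IsGood.block_of_mem_of_notMem (H : r.IsGood x y) (hx : P ∈ x.1)
    (hy : P ∉ y.1) : (r.mult P ≠ 0 ∨ r.mult (P - pt 1 1) ≠ 0) ∧ r.mult (P - pt 1 0) = 0 ∧
      r.mult (P - pt 0 1) = 0 := by
  rcases H.position P with h | ⟨I, J, l1, l2, l3, l4, h1, h2, h3, h4, h5, h6⟩
  · exact absurd (h.2.2.2.2.1 hx) hy
  · rw [h1, h3, not_ne_iff.symm.trans h2.not, not_ne_iff.symm.trans h4.not]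
    simp only [hx, true_iff] at h5
    omega

theorem Rectangle.IsGood.block_of_notMem_of_mem (H : r.IsGood x y) (hx : P ∉ x.1)
    (hy : P ∈ y.1) : (r.mult P = 0 ∧ r.mult (P - pt 1 1) = 0) ∧ (r.mult (P - pt 1 0) ≠ 0 ∨
      r.mult (P - pt 0 1) ≠ 0) := by
  rcases H.position P with h | ⟨I, J, l1, l2, l3, l4, h1, h2, h3, h4, h5, h6⟩
  · exact absurd (h.2.2.2.2.2 hy) hx
  · rw [h2, h4, not_ne_iff.symm.trans h1.not, not_ne_iff.symm.trans h3.not]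
    simp only [hy, true_iff] at h6
    omega

theorem Rectangle.IsGood.block_of_notMem_of_notMem (H : r.IsGood x y) (hx : P ∉ x.1)
    (hy : P ∉ y.1) : (r.mult (P - pt 1 0) = 0 ∧ r.mult (P - pt 0 1) = 0) ↔
      (r.mult P = 0 ∧ r.mult (P - pt 1 1) = 0) := by
  rcases H.position P with h | ⟨I, J, l1, l2, l3, l4, h1, h2, h3, h4, h5, h6⟩
  · tauto
  · simp only [hx, hy, false_iff] at h5 h6
    rw [not_ne_iff.symm.trans h1.not, not_ne_iff.symm.trans h2.not,
      not_ne_iff.symm.trans h3.not, not_ne_iff.symm.trans h4.not]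
    omega

end

open MvPolynomial

variable [NeZero N] [NeZero p] {R : Type*} [CommRing R] {ι : Type*} [Fintype ι]
  {σ : State N p q → State N p q → Rectangle N p q → MvPolynomial ι R} {O : ι → Torus N p q}
  {Z Z' : Set (Torus N p q)} {x y : State N p q}

/-- The matrix coefficient depends only on which empty rectangles avoid the blocked cells. -/
theorem coeff_congr (h : ∀ r : Rectangle N p q, r.IsGood x y →
      ((∀ c ∈ Z, r.mult c = 0) ↔ ∀ c ∈ Z', r.mult c = 0)) :
    coeff σ (cellWeight R O Z) x y = coeff σ (cellWeight R O Z') x y := by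
  classical
  unfold coeff
  refine Finset.sum_congr rfl fun r hr => ?_
  rw [weight_cellWeight, weight_cellWeight]
  simp only [h r (Finset.mem_filter.1 hr).2]

theorem coeff_eq_zero (h : ∀ r : Rectangle N p q, r.IsGood x y → ∃ c ∈ Z, r.mult c ≠ 0) :
    coeff σ (cellWeight R O Z) x y = 0 := by
  classical
  unfold coeff
  refine Finset.sum_eq_zero fun r hr => ?_
  rw [weight_cellWeight, if_neg, mul_zero]
  obtain ⟨c, hc, h0⟩ := h r (Finset.mem_filter.1 hr).2
  exact fun h' => h0 (h' c hc)

open Classical in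
/-- The two ways of blocking two diagonally opposite ones of the four cells around the point `P`
give an exact triangle. The generators that contain `P` form the free module on `α`. A rectangle
from such a generator to one without `P` contains exactly one of the cells `P` and `P - (1, 1)`
and none of the other two; for a rectangle in the opposite direction it is the other way round. -/
theorem exactTriangle_of_point (hpq : IsCoprime (p : ℤ) q) (hN : 1 < N) {S : Signs N p q}
    (hS : SignLaw (signCoeff R ι S)) (P : Torus N p q) {Z₁ Z₂ : Set (Torus N p q)}
    (hZ₁ : Z₁ = Z ∪ {P - pt 1 0, P - pt 0 1}) (hZ₂ : Z₂ = Z ∪ {P, P - pt 1 1})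
    (hr₁ : ∀ r : ZMod N, ∃ v ∈ Z₁, row v = r) (hc₁ : ∀ c : ZMod N, ∃ v ∈ Z₁, col v = c)
    (hr₂ : ∀ r : ZMod N, ∃ v ∈ Z₂, row v = r) (hc₂ : ∀ c : ZMod N, ∃ v ∈ Z₂, col v = c)
    {α : Type*} [Fintype α] (f : α ≃ {x : State N p q // P ∈ x.1})
    {m : α → α → MvPolynomial ι R}
    (hm : ∀ a a', m a a' = coeff (signCoeff R ι S) (cellWeight R O Z) (f a).1 (f a').1)
    {u : MvPolynomial ι R}
    (hu : ∑ r : ZMod N, ∏ v : Torus N p q with row v = r, cellWeight R O Z v -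
        ∑ c : ZMod N, ∏ v : Torus N p q with col v = c, cellWeight R O Z v = -u)
    (reg : ∀ k, u * k = 0 → k = 0) :
    (∀ a a', ∑ a₀, m a a₀ * m a₀ a' = 0) ∧
    ExactTriangle (MvPolynomial ι R)
      (Homology (matMap (coeff (signCoeff R ι S) (cellWeight R O Z₁))))
      (Homology (quotientDifferential (matMap m) u))
      (Homology (matMap (coeff (signCoeff R ι S) (cellWeight R O Z₂)))) := by
  let E : State N p q ≃ α ⊕ {x : State N p q // ¬ P ∈ x.1} :=
    (Equiv.sumCompl fun x : State N p q => P ∈ x.1).symm.trans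
      (Equiv.sumCongr f.symm (Equiv.refl _))
  have E₁ : ∀ a, E.symm (.inl a) = (f a).1 := fun a => rfl
  have E₂ : ∀ b, E.symm (.inr b) = b.1 := fun b => rfl
  have av₁ : ∀ r : Rectangle N p q, (∀ c ∈ Z₁, r.mult c = 0) ↔
      (∀ c ∈ Z, r.mult c = 0) ∧ r.mult (P - pt 1 0) = 0 ∧ r.mult (P - pt 0 1) = 0 := by
    intro r
    rw [hZ₁]
    simp only [Set.mem_union, Set.mem_insert_iff, Set.mem_singleton_iff, or_imp, forall_and,
      forall_eq]
  have av₂ : ∀ r : Rectangle N p q, (∀ c ∈ Z₂, r.mult c = 0) ↔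
      (∀ c ∈ Z, r.mult c = 0) ∧ r.mult P = 0 ∧ r.mult (P - pt 1 1) = 0 := by
    intro r
    rw [hZ₂]
    simp only [Set.mem_union, Set.mem_insert_iff, Set.mem_singleton_iff, or_imp, forall_and,
      forall_eq]
  have P₁ : P - pt 1 0 ∈ Z₁ := by rw [hZ₁]; simp
  have P₁' : P - pt 0 1 ∈ Z₁ := by rw [hZ₁]; simp
  have P₂ : P ∈ Z₂ := by rw [hZ₂]; simp
  have P₂' : P - pt 1 1 ∈ Z₂ := by rw [hZ₂]; simp
  have aa₁ : ∀ x y : State N p q, P ∈ x.1 → P ∈ y.1 →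
      coeff (signCoeff R ι S) (cellWeight R O Z₁) x y =
        coeff (signCoeff R ι S) (cellWeight R O Z) x y := fun x y hx hy =>
    coeff_congr fun r hr => (av₁ r).trans (and_iff_left (hr.block_of_mem_of_mem hx hy).2)
  have aa₂ : ∀ x y : State N p q, P ∈ x.1 → P ∈ y.1 →
      coeff (signCoeff R ι S) (cellWeight R O Z₂) x y =
        coeff (signCoeff R ι S) (cellWeight R O Z) x y := fun x y hx hy =>
    coeff_congr fun r hr => (av₂ r).trans (and_iff_left (hr.block_of_mem_of_mem hx hy).1)
  have ab₁ : ∀ x y : State N p q, P ∈ x.1 → P ∉ y.1 →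
      coeff (signCoeff R ι S) (cellWeight R O Z₁) x y =
        coeff (signCoeff R ι S) (cellWeight R O Z) x y := fun x y hx hy =>
    coeff_congr fun r hr => (av₁ r).trans (and_iff_left (hr.block_of_mem_of_notMem hx hy).2)
  have ab₂ : ∀ x y : State N p q, P ∈ x.1 → P ∉ y.1 →
      coeff (signCoeff R ι S) (cellWeight R O Z₂) x y = 0 := fun x y hx hy =>
    coeff_eq_zero fun r hr => (hr.block_of_mem_of_notMem hx hy).1.elim
      (fun h => ⟨_, P₂, h⟩) fun h => ⟨_, P₂', h⟩
  have ba₁ : ∀ x y : State N p q, P ∉ x.1 → P ∈ y.1 →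
      coeff (signCoeff R ι S) (cellWeight R O Z₁) x y = 0 := fun x y hx hy =>
    coeff_eq_zero fun r hr => (hr.block_of_notMem_of_mem hx hy).2.elim
      (fun h => ⟨_, P₁, h⟩) fun h => ⟨_, P₁', h⟩
  have ba₂ : ∀ x y : State N p q, P ∉ x.1 → P ∈ y.1 →
      coeff (signCoeff R ι S) (cellWeight R O Z₂) x y =
        coeff (signCoeff R ι S) (cellWeight R O Z) x y := fun x y hx hy =>
    coeff_congr fun r hr => (av₂ r).trans (and_iff_left (hr.block_of_notMem_of_mem hx hy).1)
  have bb : ∀ x y : State N p q, P ∉ x.1 → P ∉ y.1 →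
      coeff (signCoeff R ι S) (cellWeight R O Z₁) x y =
        coeff (signCoeff R ι S) (cellWeight R O Z₂) x y := fun x y hx hy =>
    coeff_congr fun r hr => (av₁ r).trans
      ((and_congr_right' (hr.block_of_notMem_of_notMem hx hy)).trans (av₂ r).symm)
  have sq₁ := sum_coeff_mul_coeff_eq_zero hpq hN hS (O := O) hr₁ hc₁
  have sq₂ := sum_coeff_mul_coeff_eq_zero hpq hN hS (O := O) hr₂ hc₂
  have split : ∀ g : State N p q → MvPolynomial ι R,
      ∑ y, g y = ∑ a, g (f a).1 + ∑ b : {x : State N p q // ¬ P ∈ x.1}, g b.1 :=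
    fun g => by rw [← E.symm.sum_comp g, Fintype.sum_sum_type]; rfl
  refine ⟨fun a a' => ?_, ?_⟩
  · have h := sq₁ (f a).1 (f a').1
    rw [split, Finset.sum_congr rfl fun a₀ _ => by
      rw [aa₁ _ _ (f a).2 (f a₀).2, aa₁ _ _ (f a₀).2 (f a').2, ← hm, ← hm]] at h
    rw [← h, left_eq_add]
    exact Finset.sum_eq_zero fun b _ => by rw [ba₁ _ _ b.2 (f a').2, mul_zero]
  · refine exactTriangle_of_blocks E sq₁ sq₂ (fun a a' => ?_) (fun a a' => ?_) (fun b a => ?_)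
      (fun a b => ?_) (fun b b' => ?_) (fun a a' => ?_) reg
    · rw [E₁, E₁, hm, aa₁ _ _ (f a).2 (f a').2]
    · rw [E₁, E₁, hm, aa₂ _ _ (f a).2 (f a').2]
    · exact ba₁ _ _ b.2 (f a).2
    · exact ab₂ _ _ (f a).2 b.2
    · exact bb _ _ b.2 b'.2
    · have h := sum_coeff_mul_coeff hpq hN hS (cellWeight R O Z) (f a).1 (f a').1
      rw [split, hu] at h
      simp only [E₁, E₂]
      have e : (f a).1 = (f a').1 ↔ a = a' := by rw [Subtype.val_inj, f.injective.eq_iff]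
      rw [← if_congr e rfl rfl, ← h]
      congr 1
      · exact Finset.sum_congr rfl fun a₀ _ => by rw [hm, hm]
      · exact Finset.sum_congr rfl fun b _ => by
          rw [ab₁ _ _ (f a).2 b.2, ba₂ _ _ b.2 (f a').2]

end Block

/-! ### Merging lines -/

/-- The line `⌈k (N + 1) / N⌉` of the large grid corresponding to the line `k` of the small one. On
coordinates, `unmerge` is `expand`. -/
def expand (N : ℕ) (k : ℤ) : ℤ := -(-(k * (N + 1)) / N)

/-- The column `⌊m N / (N + 1)⌋` of the small grid corresponding to the column `m` of the large one,
and likewise for rows. On coordinates, `merge` is `contract`. -/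
def contract (N : ℕ) (m : ℤ) : ℤ := m * N / (N + 1)

section Lines

variable {N : ℕ}

theorem contract_add_mul (m t : ℤ) : contract N (m + t * (N + 1)) = contract N m + t * N := by
  unfold contract
  rw [show (m + t * ((N : ℤ) + 1)) * N = m * N + t * N * (N + 1) by ring,
    Int.add_mul_ediv_right _ _ (by positivity)]

theorem expand_zero : expand N 0 = 0 := by simp [expand]

theorem contract_zero : contract N 0 = 0 := by simp [contract]

theorem contract_one : contract N 1 = 0 := by
  unfold contract
  rw [one_mul]
  exact Int.ediv_eq_zero_of_lt (by positivity) (by omega)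

variable [NeZero N]

theorem natCast_pos : (0 : ℤ) < N := by exact_mod_cast Nat.pos_of_ne_zero (NeZero.ne N)

/-- The Galois connection between lines and columns, from which the properties of `expand` and
`contract` follow. -/
theorem expand_le_iff {k m : ℤ} : expand N k ≤ m ↔ k ≤ contract N m := by
  have h := natCast_pos (N := N)
  unfold expand contract
  rw [neg_le, Int.le_ediv_iff_mul_le h, Int.le_ediv_iff_mul_le (by omega)]
  constructor <;> intro h <;> linarith

theorem expand_add_mul (k t : ℤ) : expand N (k + t * N) = expand N k + t * (N + 1) := by
  have h := natCast_pos (N := N)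
  unfold expand
  rw [show -((k + t * N) * ((N : ℤ) + 1)) = -(k * (N + 1)) + -(t * (N + 1)) * N by ring,
    Int.add_mul_ediv_right _ _ h.ne']
  ring

theorem expand_strictMono : StrictMono (expand N) := by
  refine strictMono_int_of_lt_succ fun k => ?_
  rw [Int.lt_iff_add_one_le, ← le_sub_iff_add_le, expand_le_iff]
  have h := natCast_pos (N := N)
  have : k + 1 ≤ contract N (expand N (k + 1)) := expand_le_iff.1 le_rfl
  unfold contract at this ⊢
  rw [Int.le_ediv_iff_mul_le (by omega)] at this ⊢
  linarith

theorem contract_expand (k : ℤ) : contract N (expand N k) = k := by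
  refine le_antisymm ?_ (expand_le_iff.1 le_rfl)
  exact (expand_strictMono (N := N)).le_iff_le.1 (expand_le_iff.2 le_rfl)

theorem expand_one : expand N 1 = 2 := by
  have h := natCast_pos (N := N)
  refine le_antisymm (expand_le_iff.2 ?_) ?_
  · unfold contract
    rw [Int.le_ediv_iff_mul_le (by omega)]
    omega
  · rw [show (2 : ℤ) = 1 + 1 from rfl, ← Int.lt_iff_add_one_le, ← not_le, expand_le_iff,
      contract_one]
    omega

theorem contract_eq_zero_iff {m : ℤ} : contract N m = 0 ↔ m = 0 ∨ m = 1 := by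
  have h0 : 0 ≤ m ↔ 0 ≤ contract N m := by rw [← expand_le_iff, expand_zero]
  have h1 : 2 ≤ m ↔ 1 ≤ contract N m := by rw [← expand_le_iff, expand_one]
  omega

/-- Only the lines congruent to `1` are erased. -/
theorem expand_contract {m : ℤ} (h : ¬ ((N : ℤ) + 1) ∣ m - 1) : expand N (contract N m) = m := by
  refine le_antisymm (expand_le_iff.2 le_rfl) ?_
  by_contra hlt
  have h0 := natCast_pos (N := N)
  have h1 : contract N m = contract N (m - 1) := by
    refine le_antisymm (expand_le_iff.1 (by omega)) ?_
    rw [← expand_le_iff]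
    exact (expand_le_iff.2 le_rfl).trans (by omega)
  -- two adjacent columns are merged only if the line between them is erased
  unfold contract at h1
  have e1 := Int.emod_add_mul_ediv (m * N) (N + 1)
  have e2 := Int.emod_add_mul_ediv ((m - 1) * N) (N + 1)
  have l1 := Int.emod_lt_of_pos (m * N) (show (0 : ℤ) < N + 1 by omega)
  have l2 := Int.emod_nonneg ((m - 1) * N) (show (N : ℤ) + 1 ≠ 0 by omega)
  rw [← h1] at e2
  set k := m * N / (N + 1)
  have e3 : (m - 1) * N = (N + 1) * k := by
    have : m * N - (m - 1) * N = N := by ring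
    omega
  exact h ⟨m - 1 - k, by linear_combination -e3⟩

theorem not_dvd_expand_sub_one (k : ℤ) : ¬ ((N : ℤ) + 1) ∣ expand N k - 1 := by
  rintro ⟨t, ht⟩
  have h : expand N k = 1 + t * (N + 1) := by linear_combination ht
  have h1 : k = t * N := by
    rw [← contract_expand (N := N) k, h, contract_add_mul, contract_one, zero_add]
  rw [h1, show t * (N : ℤ) = 0 + t * N by ring, expand_add_mul, expand_zero] at h
  omega

end Lines

section Merge

variable {N p : ℕ} {q : ℤ}

theorem pt_eq_pt {a b a' b' : ℤ} :
    (pt a b : Torus N p q) = pt a' b' ↔ ∃ s t : ℤ, a = a' + (s * p + t * q) * N ∧ b = b' + t * N := by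
  rw [← sub_eq_zero]
  change (pt (a - a') (b - b') : Torus N p q) = 0 ↔ _
  rw [pt_eq_zero]
  simp only [sub_eq_iff_eq_add']

theorem row_pt_one : row (pt 1 1 : Torus N p q) = 1 := by rw [row_pt, Int.cast_one]

theorem col_pt_one : col (pt 1 1 : Torus N p q) = 1 := by rw [col_pt, Int.cast_one]

theorem merge_pt (a b : ℤ) :
    merge (pt a b : Torus (N + 1) p q) = pt (contract N a) (contract N b) := rfl

variable [NeZero N]

theorem unmerge_pt (a b : ℤ) :
    unmerge (pt a b : Torus N p q) = pt (expand N a) (expand N b) := rfl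

theorem merge_unmerge (v : Torus N p q) : merge (unmerge v) = v := by
  obtain ⟨a, b, rfl⟩ := exists_pt v
  rw [unmerge_pt, merge_pt, contract_expand, contract_expand]

theorem unmerge_injective : Function.Injective (unmerge : Torus N p q → Torus (N + 1) p q) :=
  Function.LeftInverse.injective merge_unmerge

/-- The row or column of the large grid that corresponds to one of the small grid. -/
def expandMod (N : ℕ) (b : ZMod N) : ZMod (N + 1) := (expand N b.val : ℤ)

theorem expandMod_intCast (b : ℤ) : expandMod N (b : ZMod N) = (expand N b : ℤ) := by
  unfold expandMod
  rw [ZMod.val_intCast]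
  conv_rhs => rw [← Int.emod_add_mul_ediv b N, mul_comm, expand_add_mul]
  have : ((N : ZMod (N + 1)) + 1) = 0 := by exact_mod_cast ZMod.natCast_self (N + 1)
  push_cast
  rw [this]; ring

theorem expandMod_injective : Function.Injective (expandMod N) := by
  intro b b' h
  obtain ⟨b, rfl⟩ := ZMod.intCast_surjective b
  obtain ⟨b', rfl⟩ := ZMod.intCast_surjective b'
  rw [expandMod_intCast, expandMod_intCast, ZMod.intCast_eq_intCast_iff_dvd_sub] at h
  obtain ⟨t, ht⟩ := h
  rw [ZMod.intCast_eq_intCast_iff_dvd_sub]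
  refine ⟨t, ?_⟩
  have : expand N b' = expand N b + t * (N + 1) := by push_cast at ht; linear_combination ht
  rw [← contract_expand (N := N) b', this, contract_add_mul, contract_expand]
  ring

theorem expandMod_ne_one (b : ZMod N) : expandMod N b ≠ 1 := by
  obtain ⟨b, rfl⟩ := ZMod.intCast_surjective b
  rw [expandMod_intCast]
  intro h
  refine not_dvd_expand_sub_one (N := N) b ?_
  have h' : ((1 : ℤ) : ZMod (N + 1)) = (expand N b : ℤ) := by rw [h]; simp
  rw [ZMod.intCast_eq_intCast_iff_dvd_sub] at h'
  exact_mod_cast h'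

theorem expand_contract_of_ne {m : ℤ} (h : (m : ZMod (N + 1)) ≠ 1) :
    expand N (contract N m) = m := by
  refine expand_contract fun hd => h ?_
  have : ((1 : ℤ) : ZMod (N + 1)) = (m : ℤ) := by
    rw [ZMod.intCast_eq_intCast_iff_dvd_sub]; exact_mod_cast hd
  rw [← this]; simp

theorem exists_expandMod {r : ZMod (N + 1)} (h : r ≠ 1) : ∃ b, expandMod N b = r := by
  obtain ⟨m, rfl⟩ := ZMod.intCast_surjective r
  exact ⟨(contract N m : ℤ), by rw [expandMod_intCast, expand_contract_of_ne h]⟩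

theorem row_unmerge (v : Torus N p q) : row (unmerge v) = expandMod N (row v) := by
  obtain ⟨a, b, rfl⟩ := exists_pt v
  rw [unmerge_pt, row_pt, row_pt, expandMod_intCast]

theorem col_unmerge (v : Torus N p q) : col (unmerge v) = expandMod N (col v) := by
  obtain ⟨a, b, rfl⟩ := exists_pt v
  rw [unmerge_pt, col_pt, col_pt, expandMod_intCast]

theorem unmerge_merge {v : Torus (N + 1) p q} (hr : row v ≠ 1) (hc : col v ≠ 1) :
    unmerge (merge v) = v := by
  obtain ⟨a, b, rfl⟩ := exists_pt v
  rw [row_pt] at hr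
  rw [col_pt] at hc
  rw [merge_pt, unmerge_pt, expand_contract_of_ne hr, expand_contract_of_ne hc]

end Merge

/-! ### Generators of the small grid -/

section LiftState

variable {N p : ℕ} {q : ℤ} [NeZero N]

theorem one_not_mem_range {c₀ : Torus (N + 1) p q} {ℓ : Torus (N + 1) p q →+ ZMod (N + 1)}
    {ℓ₀ : Torus N p q → ZMod N} (h : ∀ v, ℓ (unmerge v) = expandMod N (ℓ₀ v))
    (h₁ : ℓ (pt 1 1) = 1) (v : Torus N p q) : ℓ (c₀ + unmerge v) ≠ ℓ (c₀ + pt 1 1) := by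
  rw [map_add, map_add, h, h₁]
  exact fun e => expandMod_ne_one _ (add_left_cancel e)

/-- One point on each line `ℓ` of the small grid, together with the centre of the block on the erased
line, is one point on each line of the large grid. -/
theorem lift_existsUnique (c₀ : Torus (N + 1) p q) {ℓ : Torus (N + 1) p q →+ ZMod (N + 1)}
    {ℓ₀ : Torus N p q → ZMod N} (h : ∀ v, ℓ (unmerge v) = expandMod N (ℓ₀ v))
    (h₁ : ℓ (pt 1 1) = 1) {x : Set (Torus N p q)} (hx : ∀ r, ∃! v, v ∈ x ∧ ℓ₀ v = r)
    (r : ZMod (N + 1)) :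
    ∃! v, v ∈ insert (c₀ + pt 1 1) ((fun v => c₀ + unmerge v) '' x) ∧ ℓ v = r := by
  by_cases hr : r = ℓ (c₀ + pt 1 1)
  · subst hr
    refine ⟨_, ⟨Set.mem_insert _ _, rfl⟩, ?_⟩
    rintro v ⟨rfl | ⟨v, -, rfl⟩, hv⟩
    · rfl
    · exact absurd hv (one_not_mem_range h h₁ v)
  · obtain ⟨b, hb⟩ := exists_expandMod (N := N) (r := r - ℓ c₀) (fun e => hr (by
      rw [map_add, h₁, ← e]; abel))
    obtain ⟨v, ⟨hv, hvb⟩, huniq⟩ := hx b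
    refine ⟨c₀ + unmerge v, ⟨Or.inr ⟨v, hv, rfl⟩, by
      rw [map_add, h, hvb, hb, add_sub_cancel]⟩, ?_⟩
    rintro w ⟨rfl | ⟨w, hw, rfl⟩, hwr⟩
    · exact absurd hwr.symm hr
    · dsimp only at hwr ⊢
      rw [huniq w ⟨hw, expandMod_injective (N := N) ?_⟩]
      rw [hb, ← h, ← hwr, map_add]; abel

/-- The converse of `lift_existsUnique`, for a set that meets the erased lines only in the centre of
the block. -/
theorem lower_existsUnique (c₀ : Torus (N + 1) p q) {ℓ : Torus (N + 1) p q →+ ZMod (N + 1)}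
    {ℓ₀ : Torus N p q → ZMod N} (h : ∀ v, ℓ (unmerge v) = expandMod N (ℓ₀ v))
    (h₁ : ℓ (pt 1 1) = 1) {x : Set (Torus (N + 1) p q)} (hx : ∀ r, ∃! v, v ∈ x ∧ ℓ v = r)
    (hcover : ∀ v ∈ x, v = c₀ + pt 1 1 ∨ ∃ w, v = c₀ + unmerge w) (r : ZMod N) :
    ∃! v, v ∈ (fun v => c₀ + unmerge v) ⁻¹' x ∧ ℓ₀ v = r := by
  obtain ⟨v, ⟨hv, hvr⟩, huniq⟩ := hx (ℓ c₀ + expandMod N r)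
  rcases hcover v hv with rfl | ⟨w, rfl⟩
  · rw [map_add, h₁] at hvr
    exact absurd (add_left_cancel hvr).symm (expandMod_ne_one r)
  · rw [map_add, h] at hvr
    refine ⟨w, ⟨hv, expandMod_injective (add_left_cancel hvr)⟩, ?_⟩
    rintro w' ⟨hw', rfl⟩
    exact unmerge_injective (add_left_cancel (huniq _ ⟨hw', by rw [map_add, h]⟩))

/-- The centre of the block is the only point of the generator on the two erased lines. -/
theorem State.cover (c₀ : Torus (N + 1) p q) (x : State (N + 1) p q) (hx : c₀ + pt 1 1 ∈ x.1)
    (v : Torus (N + 1) p q) (hv : v ∈ x.1) :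
    v = c₀ + pt 1 1 ∨ ∃ w : Torus N p q, v = c₀ + unmerge w := by
  by_cases e : v = c₀ + pt 1 1
  · exact Or.inl e
  refine Or.inr ⟨merge (v - c₀), ?_⟩
  rw [unmerge_merge, add_sub_cancel]
  · intro h
    refine e (x.generic.2 _ hv _ hx ?_)
    change row _ = row _
    rw [map_add, row_pt_one, ← h, map_sub]; abel
  · intro h
    refine e (x.generic.1 _ hv _ hx ?_)
    change col _ = col _
    rw [map_add, col_pt_one, ← h, map_sub]; abel

theorem add_unmerge_ne (c₀ : Torus (N + 1) p q) (v : Torus N p q) :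
    c₀ + unmerge v ≠ c₀ + pt 1 1 :=
  fun e => one_not_mem_range (c₀ := c₀) row_unmerge row_pt_one v
    (congrArg row e)

theorem add_unmerge_mem {c₀ : Torus (N + 1) p q} {x : Set (Torus N p q)} {v : Torus N p q} :
    c₀ + unmerge v ∈ insert (c₀ + pt 1 1) ((fun v => c₀ + unmerge v) '' x) ↔ v ∈ x := by
  rw [Set.mem_insert_iff, or_iff_right (add_unmerge_ne c₀ v)]
  exact ⟨fun ⟨w, hw, e⟩ => unmerge_injective (add_left_cancel e) ▸ hw, fun h => ⟨v, h, rfl⟩⟩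

/-- The generators of the small grid are the generators of the large grid that contain the centre
of the block with lower left cell `c₀`. -/
def liftState (c₀ : Torus (N + 1) p q) :
    State N p q ≃ {x : State (N + 1) p q // c₀ + pt 1 1 ∈ x.1} where
  toFun x := ⟨⟨insert (c₀ + pt 1 1) ((fun v => c₀ + unmerge v) '' x.1),
    lift_existsUnique c₀ row_unmerge row_pt_one x.2.1,
    lift_existsUnique c₀ col_unmerge col_pt_one x.2.2⟩, Set.mem_insert _ _⟩
  invFun x := ⟨(fun v => c₀ + unmerge v) ⁻¹' x.1.1,
    lower_existsUnique c₀ row_unmerge row_pt_one x.1.2.1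
      (x.1.cover c₀ x.2),
    lower_existsUnique c₀ col_unmerge col_pt_one x.1.2.2
      (x.1.cover c₀ x.2)⟩
  left_inv x := by
    refine Subtype.ext (Set.ext fun v => ?_)
    exact add_unmerge_mem (c₀ := c₀) (x := x.1) (v := v)
  right_inv x := by
    refine Subtype.ext (Subtype.ext (Set.ext fun v => ?_))
    constructor
    · rintro (rfl | ⟨w, hw, rfl⟩)
      · exact x.2
      · exact hw
    · intro hv
      rcases x.1.cover c₀ x.2 v hv with rfl | ⟨w, rfl⟩
      · exact Set.mem_insert _ _
      · exact add_unmerge_mem.2 hv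

end LiftState

/-! ### Rectangles of the small grid -/

section LiftRectangle

variable {N p : ℕ} {q : ℤ}

theorem pt_out (v : Torus N p q) : pt (Quotient.out v).1 (Quotient.out v).2 = v :=
  Quotient.out_eq' v

variable [NeZero N]

theorem expand_nonneg_sub {k m : ℤ} (h : k ≤ m) : 0 ≤ expand N m - expand N k :=
  sub_nonneg.2 ((expand_strictMono (N := N)).monotone h)

theorem expand_sub_lt {a w : ℤ} (h : w < ((p * N : ℕ) : ℤ)) :
    expand N (a + w) - expand N a < ((p * (N + 1) : ℕ) : ℤ) := by
  have h1 := expand_strictMono (N := N) (show a + w < a + p * N by push_cast at h; omega)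
  rw [expand_add_mul] at h1
  push_cast
  linarith

/-- The rectangle of the large grid that covers the same region as a rectangle of the small grid;
`c₀` is the lower left cell of the block. -/
def liftRect (c₀ : Torus (N + 1) p q) (r : Rectangle N p q) : Rectangle (N + 1) p q :=
  let v := Quotient.out r.corner
  (c₀ + unmerge r.corner,
    ⟨(expand N (v.1 + r.width) - expand N v.1).toNat, by
      have h1 := expand_sub_lt (N := N) (p := p) (a := v.1) (w := r.width)
        (Int.ofNat_lt.2 r.2.1.2)
      have h2 := expand_nonneg_sub (N := N) (k := v.1) (m := v.1 + r.width) (by omega)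
      omega⟩,
    ⟨(expand N (v.2 + r.height) - expand N v.2).toNat, by
      have h1 := expand_sub_lt (N := N) (p := p) (a := v.2) (w := r.height)
        (Int.ofNat_lt.2 r.2.2.2)
      have h2 := expand_nonneg_sub (N := N) (k := v.2) (m := v.2 + r.height) (by omega)
      omega⟩)

variable {c₀ : Torus (N + 1) p q} {r : Rectangle N p q} {a b : ℤ}

theorem liftRect_corner : (liftRect c₀ r).corner = c₀ + unmerge r.corner := rfl

/-- The size of the lift may be computed from any representative of the corner. -/
theorem liftRect_size (h : r.corner = pt a b) :
    ((liftRect c₀ r).width : ℤ) = expand N (a + r.width) - expand N a ∧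
    ((liftRect c₀ r).height : ℤ) = expand N (b + r.height) - expand N b := by
  obtain ⟨s, t, h1, h2⟩ := pt_eq_pt.1 ((pt_out r.corner).trans h)
  set v := Quotient.out r.corner
  constructor
  · change ((expand N (v.1 + r.width) - expand N v.1).toNat : ℤ) = _
    rw [Int.toNat_of_nonneg (expand_nonneg_sub (by omega)), h1, add_right_comm, expand_add_mul,
      expand_add_mul]
    ring
  · change ((expand N (v.2 + r.height) - expand N v.2).toNat : ℤ) = _
    rw [Int.toNat_of_nonneg (expand_nonneg_sub (by omega)), h2, add_right_comm, expand_add_mul,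
      expand_add_mul]
    ring

theorem liftRect_width_eq_zero : (liftRect c₀ r).width = 0 ↔ r.width = 0 := by
  have h := (liftRect_size (c₀ := c₀) (pt_out r.corner).symm).1
  have h' := (expand_strictMono (N := N)).lt_iff_lt (a := (Quotient.out r.corner).1)
    (b := (Quotient.out r.corner).1 + r.width)
  omega

theorem liftRect_height_eq_zero : (liftRect c₀ r).height = 0 ↔ r.height = 0 := by
  have h := (liftRect_size (c₀ := c₀) (pt_out r.corner).symm).2
  have h' := (expand_strictMono (N := N)).lt_iff_lt (a := (Quotient.out r.corner).2)
    (b := (Quotient.out r.corner).2 + r.height)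
  omega

theorem liftRect_point (h : r.corner = pt a b) (i j : ℤ) :
    (liftRect c₀ r).corner + pt (expand N (a + i) - expand N a) (expand N (b + j) - expand N b) =
      c₀ + unmerge (r.corner + pt i j) := by
  rw [liftRect_corner, h, pt_add, unmerge_pt, unmerge_pt, add_assoc, pt_add]
  congr 2 <;> ring

theorem liftRect_lr : (liftRect c₀ r).corner + pt (liftRect c₀ r).width 0 =
    c₀ + unmerge (r.corner + pt r.width 0) := by
  rw [← liftRect_point (pt_out r.corner).symm, (liftRect_size (pt_out r.corner).symm).1, add_zero,
    sub_self]

theorem liftRect_ul : (liftRect c₀ r).corner + pt 0 (liftRect c₀ r).height =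
    c₀ + unmerge (r.corner + pt 0 r.height) := by
  rw [← liftRect_point (pt_out r.corner).symm, (liftRect_size (pt_out r.corner).symm).2, add_zero,
    sub_self]

theorem liftRect_ur : (liftRect c₀ r).corner + pt (liftRect c₀ r).width (liftRect c₀ r).height =
    c₀ + unmerge (r.corner + pt r.width r.height) := by
  rw [← liftRect_point (pt_out r.corner).symm, (liftRect_size (pt_out r.corner).symm).1,
    (liftRect_size (pt_out r.corner).symm).2]

/-- A rectangle and its lift have the same multiplicities. -/
theorem liftRect_mult (v : Torus (N + 1) p q) :
    (liftRect c₀ r).mult v = r.mult (merge (v - c₀)) := by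
  obtain ⟨a, b, hab⟩ := exists_pt r.corner
  obtain ⟨m, n, hmn⟩ := exists_pt (v - c₀)
  obtain ⟨hw, hh⟩ := liftRect_size (c₀ := c₀) hab
  have hv : v = c₀ + pt m n := by rw [← hmn, add_sub_cancel]
  have e₁ : ∀ i j : ℤ, (liftRect c₀ r).corner + pt i j = v ↔ ∃ s t : ℤ,
      expand N a + i = m + (s * p + t * q) * (N + 1) ∧ expand N b + j = n + t * (N + 1) := by
    intro i j
    rw [liftRect_corner, hab, unmerge_pt, add_assoc, pt_add, hv, add_right_inj, pt_eq_pt]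
    push_cast; rfl
  have e₂ : ∀ i j : ℤ, r.corner + pt i j = merge (v - c₀) ↔ ∃ s t : ℤ,
      a + i = contract N m + (s * p + t * q) * N ∧ b + j = contract N n + t * N := by
    intro i j
    rw [hab, pt_add, hmn, merge_pt, pt_eq_pt]
  have bounds : ∀ A k l : ℤ, (k ≤ contract N A ∧ contract N A < l) ↔
      (expand N k ≤ A ∧ A < expand N l) := by
    intro A k l
    rw [expand_le_iff, ← not_le, ← not_le, ← expand_le_iff (k := l)]
  refine Set.ncard_congr (fun u _ => ((contract N (expand N a + u.1) - a).toNat,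
    (contract N (expand N b + u.2) - b).toNat)) ?_ ?_ ?_
  · rintro ⟨i, j⟩ ⟨h1, h2, h3⟩
    dsimp only at h1 h2 h3 ⊢
    obtain ⟨s, t, h4, h5⟩ := (e₁ _ _).1 h3
    have b1 := (bounds (expand N a + i) a (a + r.width)).2 ⟨by omega, by omega⟩
    have b2 := (bounds (expand N b + j) b (b + r.height)).2 ⟨by omega, by omega⟩
    refine ⟨by simp only; omega, by simp only; omega, ?_⟩
    simp only
    rw [e₂, Int.toNat_of_nonneg (by omega), Int.toNat_of_nonneg (by omega), h4, h5]
    exact ⟨s, t, by rw [contract_add_mul]; ring, by rw [contract_add_mul]; ring⟩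
  · rintro ⟨i, j⟩ ⟨i', j'⟩ ⟨h1, h2, h3⟩ ⟨h1', h2', h3'⟩ e
    dsimp only at h1 h2 h3 h1' h2' h3' e
    obtain ⟨s, t, h4, h5⟩ := (e₁ _ _).1 h3
    obtain ⟨s', t', h4', h5'⟩ := (e₁ _ _).1 h3'
    have b1 := (bounds (expand N a + i) a (a + r.width)).2 ⟨by omega, by omega⟩
    have b2 := (bounds (expand N b + j) b (b + r.height)).2 ⟨by omega, by omega⟩
    have b1' := (bounds (expand N a + i') a (a + r.width)).2 ⟨by omega, by omega⟩
    have b2' := (bounds (expand N b + j') b (b + r.height)).2 ⟨by omega, by omega⟩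
    rw [Prod.mk.injEq] at e
    have g1 : contract N (expand N a + i) = contract N (expand N a + i') := by omega
    have g2 : contract N (expand N b + j) = contract N (expand N b + j') := by omega
    rw [h4, h4', contract_add_mul, contract_add_mul, add_right_inj] at g1
    rw [h5, h5', contract_add_mul, contract_add_mul, add_right_inj] at g2
    have hN := (natCast_pos (N := N)).ne'
    have g1 := mul_right_cancel₀ hN g1
    have g2 := mul_right_cancel₀ hN g2
    rw [g1, ← h4'] at h4
    rw [g2, ← h5'] at h5
    rw [Prod.mk.injEq]
    omega
  · rintro ⟨i, j⟩ ⟨h1, h2, h3⟩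
    dsimp only at h1 h2 h3
    obtain ⟨s, t, h4, h5⟩ := (e₂ _ _).1 h3
    have c1 : contract N (m + (s * p + t * q) * (N + 1)) = a + i := by
      rw [contract_add_mul, h4]
    have c2 : contract N (n + t * (N + 1)) = b + j := by rw [contract_add_mul, h5]
    have b1 := (bounds (m + (s * p + t * q) * (N + 1)) a (a + r.width)).1
      ⟨by omega, by omega⟩
    have b2 := (bounds (n + t * (N + 1)) b (b + r.height)).1 ⟨by omega, by omega⟩
    have t1 : ((m + (s * p + t * q) * (N + 1) - expand N a).toNat : ℤ) =
      m + (s * p + t * q) * (N + 1) - expand N a := Int.toNat_of_nonneg (by omega)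
    have t2 : ((n + t * (N + 1) - expand N b).toNat : ℤ) =
      n + t * (N + 1) - expand N b := Int.toNat_of_nonneg (by omega)
    refine ⟨((m + (s * p + t * q) * (N + 1) - expand N a).toNat,
      (n + t * (N + 1) - expand N b).toNat), ⟨?_, ?_, ?_⟩, ?_⟩
    · simp only; omega
    · simp only; omega
    · simp only
      rw [e₁, t1, t2]
      exact ⟨s, t, by ring, by ring⟩
    · simp only
      rw [t1, t2, add_sub_cancel, add_sub_cancel, c1, c2, add_sub_cancel_left,
        add_sub_cancel_left, Int.toNat_natCast, Int.toNat_natCast]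

theorem liftRect_isEmbedded : (liftRect c₀ r).IsEmbedded ↔ r.IsEmbedded := by
  obtain ⟨a, b, hab⟩ := exists_pt r.corner
  obtain ⟨hw, hh⟩ := liftRect_size (c₀ := c₀) hab
  have mono : ∀ {a b : ℤ}, expand N a ≤ expand N b ↔ a ≤ b := expand_strictMono.le_iff_le
  constructor
  · rintro emb ⟨i, j⟩ ⟨hi, hj⟩ ⟨i', j'⟩ ⟨hi', hj'⟩ e
    dsimp only at hi hj hi' hj' e
    have f : ∀ k l : ℤ, k ≤ l → ((expand N l - expand N k).toNat : ℤ) = expand N l - expand N k :=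
      fun k l h => Int.toNat_of_nonneg (expand_nonneg_sub h)
    have m1 := mono (a := a + i) (b := a + r.width)
    have m2 := mono (a := a + i') (b := a + r.width)
    have m3 := mono (a := b + j) (b := b + r.height)
    have m4 := mono (a := b + j') (b := b + r.height)
    have f1 := f a (a + i) (by omega)
    have f2 := f a (a + i') (by omega)
    have f3 := f b (b + j) (by omega)
    have f4 := f b (b + j') (by omega)
    have := emb (x₁ := ((expand N (a + i) - expand N a).toNat, (expand N (b + j) - expand N b).toNat))
      (x₂ := ((expand N (a + i') - expand N a).toNat, (expand N (b + j') - expand N b).toNat))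
      ⟨by simp only; omega, by simp only; omega⟩ ⟨by simp only; omega, by simp only; omega⟩
      (by simp only [f1, f2, f3, f4, liftRect_point hab, e])
    rw [Prod.mk.injEq] at this
    have g1 := (expand_strictMono (N := N)).injective
      (show expand N (a + i) = expand N (a + i') by omega)
    have g2 := (expand_strictMono (N := N)).injective
      (show expand N (b + j) = expand N (b + j') by omega)
    rw [Prod.mk.injEq]
    omega
  · rintro emb ⟨i, j⟩ ⟨hi, hj⟩ ⟨i', j'⟩ ⟨hi', hj'⟩ e
    dsimp only at hi hj hi' hj' e
    rw [add_right_inj, pt_eq_pt] at e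
    obtain ⟨s, t, h1, h2⟩ := e
    push_cast at h1 h2
    -- a period of the large grid within the rectangle gives one of the small grid
    have shift : ∀ c k w : ℤ, k * (N + 1) ≤ expand N (c + w) - expand N c → k * N ≤ w := by
      intro c k w h
      have : expand N (c + k * N) ≤ expand N (c + w) := by rw [expand_add_mul]; linarith
      have := mono.1 this
      linarith
    have s1 := shift a (s * p + t * q) r.width (by omega)
    have s2 := shift a (-(s * p + t * q)) r.width (by rw [neg_mul]; omega)
    have s3 := shift b t r.height (by omega)
    have s4 := shift b (-t) r.height (by rw [neg_mul]; omega)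
    rw [neg_mul] at s2 s4
    have e1 : ((s * p + t * q) * N).toNat - ((-((s * p + t * q) * N)).toNat : ℤ) =
        (s * p + t * q) * N := by omega
    have e2 : (t * N).toNat - ((-(t * N)).toNat : ℤ) = t * N := by omega
    have := emb (x₁ := (((s * p + t * q) * N).toNat, (t * N).toNat))
      (x₂ := ((-((s * p + t * q) * N)).toNat, (-(t * N)).toNat))
      ⟨by simp only; omega, by simp only; omega⟩ ⟨by simp only; omega, by simp only; omega⟩ (by
        simp only
        rw [add_right_inj, pt_eq_pt]
        exact ⟨s, t, by omega, by omega⟩)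
    rw [Prod.mk.injEq] at this
    have hN := (natCast_pos (N := N)).ne'
    have k1 : (s * p + t * q) * N = 0 := by omega
    have k2 : t * N = 0 := by omega
    rw [(mul_eq_zero.1 k1).resolve_right hN, zero_mul, add_zero] at h1
    rw [(mul_eq_zero.1 k2).resolve_right hN, zero_mul, add_zero] at h2
    rw [Prod.mk.injEq]
    omega

theorem liftRect_isFromTo {x y : State N p q} :
    (liftRect c₀ r).IsFromTo (liftState c₀ x).1 (liftState c₀ y).1 ↔ r.IsFromTo x y := by
  unfold Rectangle.IsFromTo
  rw [Nat.pos_iff_ne_zero, Nat.pos_iff_ne_zero, Nat.pos_iff_ne_zero, Nat.pos_iff_ne_zero, Ne, Ne,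
    liftRect_width_eq_zero, liftRect_height_eq_zero, liftRect_isEmbedded, liftRect_ur,
    liftRect_lr, liftRect_ul, liftRect_corner]
  refine and_congr_right' (and_congr_right' (and_congr_right' (and_congr add_unmerge_mem
    (and_congr add_unmerge_mem ?_))))
  have inj : ∀ v w : Torus N p q, c₀ + unmerge v = c₀ + unmerge w ↔ v = w := fun v w =>
    ⟨fun e => unmerge_injective (add_left_cancel e), fun e => by rw [e]⟩
  constructor
  · intro h
    ext v
    have := Set.ext_iff.1 h (c₀ + unmerge v)
    simp only [Set.mem_union, Set.mem_sdiff, Set.mem_insert_iff, Set.mem_singleton_iff, inj]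
      at this ⊢
    refine (add_unmerge_mem (c₀ := c₀) (x := y.1)).symm.trans (this.trans ?_)
    rw [show c₀ + unmerge v ∈ (liftState c₀ x).1.1 ↔ v ∈ x.1 from add_unmerge_mem]
  · intro h
    ext v
    by_cases hv : ∃ w : Torus N p q, v = c₀ + unmerge w
    · obtain ⟨w, rfl⟩ := hv
      refine (add_unmerge_mem (c₀ := c₀) (x := y.1)).trans ?_
      rw [h]
      simp only [Set.mem_union, Set.mem_sdiff, Set.mem_insert_iff, Set.mem_singleton_iff, inj]
      rw [show c₀ + unmerge w ∈ (liftState c₀ x).1.1 ↔ w ∈ x.1 from add_unmerge_mem]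
    · have hne : ∀ w : Torus N p q, v ≠ c₀ + unmerge w := fun w e => hv ⟨w, e⟩
      have hmem : ∀ z : State N p q, v ∈ (liftState c₀ z).1.1 ↔ v = c₀ + pt 1 1 := by
        intro z
        refine ⟨?_, fun e => e ▸ (liftState c₀ z).2⟩
        rintro (e | ⟨w, -, e⟩)
        · exact e
        · exact absurd e.symm (hne w)
      simp only [Set.mem_union, Set.mem_sdiff, Set.mem_insert_iff, Set.mem_singleton_iff, hmem, hne]
      simp

theorem liftRect_injective : Function.Injective (liftRect c₀ : Rectangle N p q → _) := by
  intro r r' h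
  have hc : r.corner = r'.corner := by
    have := congrArg Rectangle.corner h
    exact unmerge_injective (add_left_cancel this)
  obtain ⟨a, b, hab⟩ := exists_pt r.corner
  obtain ⟨hw, hh⟩ := liftRect_size (c₀ := c₀) hab
  obtain ⟨hw', hh'⟩ := liftRect_size (c₀ := c₀) (hc.symm.trans hab)
  rw [h] at hw hh
  have g1 := (expand_strictMono (N := N)).injective
    (show expand N (a + r.width) = expand N (a + r'.width) by omega)
  have g2 := (expand_strictMono (N := N)).injective
    (show expand N (b + r.height) = expand N (b + r'.height) by omega)
  exact Prod.ext hc (Prod.ext (Fin.ext (by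
    change r.width = r'.width; omega)) (Fin.ext (by change r.height = r'.height; omega)))

end LiftRectangle

/-! ### The singular complex as a block of the differential -/

section LiftGood

variable {N p : ℕ} {q : ℤ}

theorem merge_zero : merge (0 : Torus (N + 1) p q) = 0 := by
  change merge (pt 0 0) = pt 0 0
  rw [merge_pt, contract_zero]

theorem merge_one : merge (pt 1 1 : Torus (N + 1) p q) = 0 := by
  rw [merge_pt, contract_one]; rfl

variable [NeZero N] {c₀ : Torus (N + 1) p q}

theorem exists_of_unmerge_eq {w : Torus N p q} {a b i j : ℤ}
    (h : unmerge w = pt (expand N a + i) (expand N b + j)) :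
    ∃ i₀ j₀ : ℤ, w = pt (a + i₀) (b + j₀) ∧ expand N (a + i₀) = expand N a + i ∧
      expand N (b + j₀) = expand N b + j := by
  obtain ⟨m, n, rfl⟩ := exists_pt w
  rw [unmerge_pt, pt_eq_pt] at h
  obtain ⟨s, t, h1, h2⟩ := h
  push_cast at h1 h2
  refine ⟨m + -(s * p + t * q) * N - a, n + -t * N - b, ?_, ?_, ?_⟩
  · rw [pt_eq_pt]
    exact ⟨s, t, by ring, by ring⟩
  · rw [add_sub_cancel, expand_add_mul, h1]; ring
  · rw [add_sub_cancel, expand_add_mul, h2]; ring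

variable {r : Rectangle N p q} {x y : State N p q}

/-- If the lifted generator has no point in the interior of the lifted rectangle, then the generator
has none in the interior of the rectangle. -/
theorem interior_of_liftRect
    (h : ∀ i j : ℕ, 0 < i → i < (liftRect c₀ r).width → 0 < j → j < (liftRect c₀ r).height →
      (liftRect c₀ r).corner + pt i j ∉ (liftState c₀ x).1.1)
    (i j : ℕ) (hi : 0 < i) (hi' : i < r.width) (hj : 0 < j) (hj' : j < r.height) :
    r.corner + pt i j ∉ x.1 := by
  intro hx
  obtain ⟨a, b, hab⟩ := exists_pt r.corner
  obtain ⟨hw, hh⟩ := liftRect_size (c₀ := c₀) hab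
  have e1 := expand_strictMono (N := N) (show a < a + i by omega)
  have e2 := expand_strictMono (N := N) (show a + i < a + r.width by omega)
  have e3 := expand_strictMono (N := N) (show b < b + j by omega)
  have e4 := expand_strictMono (N := N) (show b + j < b + r.height by omega)
  have := h (expand N (a + i) - expand N a).toNat (expand N (b + j) - expand N b).toNat
    (by omega) (by omega) (by omega) (by omega)
  rw [Int.toNat_of_nonneg (by omega), Int.toNat_of_nonneg (by omega), liftRect_point hab] at this
  exact this (add_unmerge_mem.2 hx)

/-- The lifted generator has one more point, the centre of the block. It lies in the interior of the
lifted rectangle only if the merged cell `0` lies in the rectangle, which `h0` excludes. -/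
theorem interior_liftRect (h0 : r.mult 0 = 0)
    (h : ∀ i j : ℕ, 0 < i → i < r.width → 0 < j → j < r.height → r.corner + pt i j ∉ x.1)
    (i j : ℕ) (hi : 0 < i) (hi' : i < (liftRect c₀ r).width) (hj : 0 < j)
    (hj' : j < (liftRect c₀ r).height) :
    (liftRect c₀ r).corner + pt i j ∉ (liftState c₀ x).1.1 := by
  intro hx
  obtain ⟨a, b, hab⟩ := exists_pt r.corner
  obtain ⟨hw, hh⟩ := liftRect_size (c₀ := c₀) hab
  rcases State.cover c₀ _ (liftState c₀ x).2 _ hx with e | ⟨w, e⟩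
  · refine absurd (Rectangle.mult_ne_zero_iff.2 ⟨i, j, hi', hj', e⟩) ?_
    rw [liftRect_mult, add_sub_cancel_left, merge_one, h0]
    simp
  · rw [e] at hx
    rw [liftRect_corner, add_assoc, add_right_inj, hab, unmerge_pt, pt_add] at e
    obtain ⟨i₀, j₀, rfl, h1, h2⟩ := exists_of_unmerge_eq e.symm
    have mono : ∀ {a b : ℤ}, expand N a < expand N b ↔ a < b := expand_strictMono.lt_iff_lt
    have m1 := mono (a := a) (b := a + i₀)
    have m2 := mono (a := a + i₀) (b := a + r.width)
    have m3 := mono (a := b) (b := b + j₀)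
    have m4 := mono (a := b + j₀) (b := b + r.height)
    have := h i₀.toNat j₀.toNat (by omega) (by omega) (by omega) (by omega)
    rw [Int.toNat_of_nonneg (by omega), Int.toNat_of_nonneg (by omega), hab, pt_add] at this
    exact this (add_unmerge_mem.1 hx)

/-- The double mark in the cell `0` of the small grid excludes exactly the rectangles whose lifts
contain the centre of the block. -/
theorem liftRect_isGood :
    (liftRect c₀ r).IsGood (liftState c₀ x).1 (liftState c₀ y).1 ↔ r.IsGood x y ∧ r.mult 0 = 0 := by
  constructor
  · intro h
    refine ⟨⟨liftRect_isFromTo.1 h.1, fun i j h1 h2 h3 h4 => ⟨?_, ?_⟩⟩, ?_⟩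
    · exact interior_of_liftRect (fun i j h1 h2 h3 h4 => (h.2 i j h1 h2 h3 h4).1) i j h1 h2 h3 h4
    · exact interior_of_liftRect (fun i j h1 h2 h3 h4 => (h.2 i j h1 h2 h3 h4).2) i j h1 h2 h3 h4
    · have := (h.block_of_mem_of_mem (liftState c₀ x).2 (liftState c₀ y).2).1.2
      rwa [add_sub_cancel_right, liftRect_mult, sub_self, merge_zero] at this
  · rintro ⟨h, h0⟩
    refine ⟨liftRect_isFromTo.2 h.1, fun i j h1 h2 h3 h4 => ⟨?_, ?_⟩⟩
    · exact interior_liftRect h0 (fun i j h1 h2 h3 h4 => (h.2 i j h1 h2 h3 h4).1) i j h1 h2 h3 h4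
    · exact interior_liftRect h0 (fun i j h1 h2 h3 h4 => (h.2 i j h1 h2 h3 h4).2) i j h1 h2 h3 h4

/-- The corners of a rectangle between generators that contain the centre of the block do not lie on
the erased lines. -/
theorem exists_liftRect {r' : Rectangle (N + 1) p q}
    (h : r'.IsGood (liftState c₀ x).1 (liftState c₀ y).1) : ∃ r, liftRect c₀ r = r' := by
  have hP := (liftState c₀ y).2
  have H := isGood_iff.1 h
  obtain ⟨v, hv⟩ := (State.cover c₀ _ (liftState c₀ x).2 _ H.ll).resolve_left
    fun e => H.ll_notMem (by rw [e]; exact hP)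
  obtain ⟨w, hw⟩ := (State.cover c₀ _ (liftState c₀ x).2 _ H.ur).resolve_left
    fun e => H.ur_notMem (by rw [e]; exact hP)
  have hab := pt_out v
  set a := (Quotient.out v).1 with ha
  set b := (Quotient.out v).2 with hb
  rw [hv, torusFrame_tr, add_assoc, add_right_inj, ← hab, unmerge_pt, pt_add] at hw
  obtain ⟨i, j, -, h1, h2⟩ := exists_of_unmerge_eq hw.symm
  change _ = _ + (r'.width : ℤ) at h1
  change _ = _ + (r'.height : ℤ) at h2
  have w0 : 0 < r'.width := h.1.1
  have h0 : 0 < r'.height := h.1.2.1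
  have w1 : r'.width < p * (N + 1) := r'.2.1.2
  have h1' : r'.height < p * (N + 1) := r'.2.2.2
  have mono : ∀ {a b : ℤ}, expand N a < expand N b ↔ a < b := expand_strictMono.lt_iff_lt
  have m1 := mono (a := a) (b := a + i)
  have m2 := mono (a := b) (b := b + j)
  have m3 := mono (a := a + i) (b := a + p * N)
  have m4 := mono (a := b + j) (b := b + p * N)
  rw [expand_add_mul] at m3 m4
  zify at w1 h1'
  have i1 : i < ((p * N : ℕ) : ℤ) := by push_cast; omega
  have j1 : j < ((p * N : ℕ) : ℤ) := by push_cast; omega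
  refine ⟨(v, ⟨i.toNat, by omega⟩, ⟨j.toNat, by omega⟩), ?_⟩
  have hs := liftRect_size (c₀ := c₀) (a := a) (b := b)
    (r := ((v, ⟨i.toNat, by omega⟩, ⟨j.toNat, by omega⟩) : Rectangle N p q)) hab.symm
  have hi : (i.toNat : ℤ) = i := Int.toNat_of_nonneg (by omega)
  have hj : (j.toNat : ℤ) = j := Int.toNat_of_nonneg (by omega)
  simp only [Rectangle.width, Rectangle.height, hi, hj, h1, h2, add_sub_cancel_left] at hs
  exact Prod.ext hv.symm (Prod.ext (Fin.ext (Int.ofNat_inj.1 hs.1)) (Fin.ext (Int.ofNat_inj.1 hs.2)))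

open MvPolynomial

variable [NeZero p] {R : Type*} [CommRing R] {ι : Type*} [Fintype ι]

open Classical in
theorem coeff_cellWeight {M : ℕ} [NeZero M]
    (σ : State M p q → State M p q → Rectangle M p q → MvPolynomial ι R) (O : ι → Torus M p q)
    (Z : Set (Torus M p q)) (x y : State M p q) :
    coeff σ (cellWeight R O Z) x y = ∑ r : Rectangle M p q with
      r.IsGood x y ∧ ∀ c ∈ Z, r.mult c = 0, σ x y r * ∏ i, X i ^ r.mult (O i) := by
  unfold coeff
  rw [← Finset.filter_filter, Finset.sum_filter (p := fun r => ∀ c ∈ Z, _)]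
  refine Finset.sum_congr rfl fun r _ => ?_
  rw [weight_cellWeight]
  split_ifs <;> simp

/-- The differential of the singular diagram is the part of the differential on the large grid,
without `X`s in the `2 × 2` block, between the generators that contain the centre of the block. -/
theorem coeff_liftState {S : Signs (N + 1) p q} {Ss : Signs N p q}
    (hS : ∀ x y r, r.IsFromTo x y → Ss x y r = S (liftState c₀ x).1 (liftState c₀ y).1
      (liftRect c₀ r))
    (O : ι → Torus (N + 1) p q) (Z : Set (Torus (N + 1) p q)) (x y : State N p q) :
    coeff (signCoeff R ι Ss) (cellWeight R (fun i => merge (O i - c₀))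
        (insert 0 ((fun v => merge (v - c₀)) '' Z))) x y =
      coeff (signCoeff R ι S) (cellWeight R O Z) (liftState c₀ x).1 (liftState c₀ y).1 := by
  classical
  rw [coeff_cellWeight, coeff_cellWeight]
  refine Finset.sum_nbij (liftRect c₀) ?_ liftRect_injective.injOn ?_ ?_
  · intro r hr
    simp only [Finset.mem_filter, Finset.mem_univ, true_and, Set.forall_mem_insert,
      Set.forall_mem_image] at hr ⊢
    exact ⟨liftRect_isGood.2 ⟨hr.1, hr.2.1⟩, fun c hc => by
      rw [liftRect_mult]; exact hr.2.2 hc⟩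
  · intro r' hr'
    simp only [Finset.coe_filter, Finset.mem_univ, true_and, Set.mem_ofPred_eq] at hr'
    obtain ⟨r, rfl⟩ := exists_liftRect hr'.1
    obtain ⟨h1, h2⟩ := liftRect_isGood.1 hr'.1
    refine ⟨r, ?_, rfl⟩
    simp only [Finset.coe_filter, Finset.mem_univ, true_and, Set.mem_ofPred_eq,
      Set.forall_mem_insert, Set.forall_mem_image]
    exact ⟨h1, h2, fun c hc => by rw [← liftRect_mult]; exact hr'.2 c hc⟩
  · intro r hr
    simp only [Finset.mem_filter, Finset.mem_univ, true_and] at hr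
    simp only [signCoeff, hS x y r hr.1.1, liftRect_mult]

end LiftGood

/-! ### Induced signs -/

section InducedSigns

variable {N p : ℕ} {q : ℤ}

theorem Rectangle.IsEmbedded.eq {r : Rectangle N p q} (h : r.IsEmbedded) {i j i' j' : ℕ}
    (hi : i ≤ r.width) (hj : j ≤ r.height) (hi' : i' ≤ r.width) (hj' : j' ≤ r.height)
    (e : r.corner + pt i j = r.corner + pt i' j') : i = i' ∧ j = j' := by
  have := h (x₁ := (i, j)) (x₂ := (i', j')) ⟨hi, hj⟩ ⟨hi', hj'⟩ e
  simpa using this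

/-- A rectangle between given generators is determined by the region that it covers. -/
theorem Rectangle.IsFromTo.eq_of_mult {r r' : Rectangle N p q} {x y : State N p q}
    (h : r.IsFromTo x y) (h' : r'.IsFromTo x y) (hm : ∀ c, r.mult c = r'.mult c) : r = r' := by
  obtain ⟨w0, h0, emb, ll, ur, hy⟩ := h
  obtain ⟨w0', h0', emb', ll', ur', hy'⟩ := h'
  have pt0 : ∀ s : Rectangle N p q, s.corner = s.corner + pt (0 : ℕ) (0 : ℕ) := fun s =>
    (add_zero s.corner).symm
  have hc : r'.corner = r.corner := by
    have hn : r'.corner ∉ y.1 := by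
      rw [hy']
      rintro (h | h | h)
      · exact h.2 (Or.inl rfl)
      · have := emb'.eq (i := 0) (j := 0) (i' := r'.width) (j' := 0) (by omega) (by omega) le_rfl
          (by omega) ((pt0 r').symm.trans h)
        omega
      · have := emb'.eq (i := 0) (j := 0) (i' := 0) (j' := r'.height) (by omega) (by omega)
          (by omega) le_rfl ((pt0 r').symm.trans h)
        omega
    have hmult : r.mult r'.corner ≠ 0 := by
      rw [hm, mult_ne_zero_iff]
      exact ⟨0, 0, w0', h0', (pt0 r').symm⟩
    obtain ⟨i, j, hi, hj, e⟩ := mult_ne_zero_iff.1 hmult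
    by_contra hne
    refine hn ?_
    rw [hy]
    refine Or.inl ⟨ll', ?_⟩
    rintro (h | h)
    · exact hne h
    · have := emb.eq hi.le hj.le le_rfl le_rfl (e.trans h)
      omega
  have size : ∀ s s' : Rectangle N p q, s.IsEmbedded → s'.corner = s.corner → 0 < s.width →
      0 < s.height → 0 < s'.width → 0 < s'.height → (∀ c, s.mult c = s'.mult c) →
      s'.width ≤ s.width ∧ s'.height ≤ s.height := by
    intro s s' hs e w1 h1 w1' h1' hm
    constructor <;> by_contra hlt
    · have : s.mult (s.corner + pt s.width (0 : ℕ)) ≠ 0 := by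
        rw [hm, mult_ne_zero_iff]
        exact ⟨s.width, 0, by omega, h1', by rw [e]⟩
      obtain ⟨i, j, hi, hj, e'⟩ := mult_ne_zero_iff.1 this
      have := hs.eq hi.le hj.le le_rfl (by omega) e'
      omega
    · have : s.mult (s.corner + pt (0 : ℕ) s.height) ≠ 0 := by
        rw [hm, mult_ne_zero_iff]
        exact ⟨0, s.height, w1', by omega, by rw [e]⟩
      obtain ⟨i, j, hi, hj, e'⟩ := mult_ne_zero_iff.1 this
      have := hs.eq hi.le hj.le (by omega) le_rfl e'
      omega
  have s1 := size r r' emb hc w0 h0 w0' h0' hm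
  have s2 := size r' r emb' hc.symm w0' h0' w0 h0 fun c => (hm c).symm
  exact Prod.ext hc.symm (Prod.ext (Fin.ext (le_antisymm s2.1 s1.1))
    (Fin.ext (le_antisymm s2.2 s1.2)))

variable [NeZero N] (c₀ : Torus (N + 1) p q)

/-- The signs of the lifted rectangles. -/
def inducedSigns (S : Signs (N + 1) p q) : Signs N p q := fun x y r =>
  S (liftState c₀ x).1 (liftState c₀ y).1 (liftRect c₀ r)

theorem isSignAssignment_inducedSigns {S : Signs (N + 1) p q} (hS : IsSignAssignment S) :
    IsSignAssignment (inducedSigns c₀ S) where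
  alternative x w y z r₁ r₂ s₁ s₂ h1 h2 h3 h4 hne hm := by
    refine hS.alternative _ _ _ _ _ _ _ _ (liftRect_isFromTo.2 h1) (liftRect_isFromTo.2 h2)
      (liftRect_isFromTo.2 h3) (liftRect_isFromTo.2 h4)
      (fun e => hne ((liftState c₀).injective (Subtype.ext e))) fun c => ?_
    simp only [liftRect_mult]
    exact hm _
  horizontal x y r₁ r₂ h1 h2 hc hh hw := by
    obtain ⟨a, b, hab⟩ := exists_pt r₁.corner
    obtain ⟨w1, g1⟩ := liftRect_size (c₀ := c₀) hab
    obtain ⟨w2, g2⟩ := liftRect_size (c₀ := c₀) (hc.trans (by rw [hab, pt_add]))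
    refine hS.horizontal _ _ _ _ (liftRect_isFromTo.2 h1) (liftRect_isFromTo.2 h2) ?_ ?_ ?_
    · rw [liftRect_lr, ← hc]; rfl
    · rw [add_zero, hh] at g2; omega
    · have e : a + r₁.width + r₂.width = a + p * N := by
        rw [add_assoc, ← Nat.cast_add, hw]; push_cast; ring
      rw [e, expand_add_mul] at w2
      zify
      rw [w1, w2]; ring
  vertical x y r₁ r₂ h1 h2 hc hw hh := by
    obtain ⟨a, b, hab⟩ := exists_pt r₁.corner
    obtain ⟨w1, g1⟩ := liftRect_size (c₀ := c₀) hab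
    obtain ⟨w2, g2⟩ := liftRect_size (c₀ := c₀) (hc.trans (by rw [hab, pt_add]))
    refine hS.vertical _ _ _ _ (liftRect_isFromTo.2 h1) (liftRect_isFromTo.2 h2) ?_ ?_ ?_
    · rw [liftRect_ul, ← hc]; rfl
    · rw [add_zero, hw] at w2; omega
    · have e : b + r₁.height + r₂.height = b + p * N := by
        rw [add_assoc, ← Nat.cast_add, hh]; push_cast; ring
      rw [e, expand_add_mul] at g2
      zify
      rw [g1, g2]; ring

theorem isInduced_inducedSigns (δ : Direction) (z : Torus (N + 1) p q) (S : Signs (N + 1) p q) :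
    IsInduced δ z S (inducedSigns (blockCorner δ z) S) := by
  intro x y x' y' r r' h h' hx hy hm
  obtain rfl : x' = (liftState (blockCorner δ z) x).1 := Subtype.ext hx
  obtain rfl : y' = (liftState (blockCorner δ z) y).1 := Subtype.ext hy
  rw [h'.eq_of_mult (liftRect_isFromTo.2 h) fun c => by rw [hm, liftRect_mult]]
  rfl

theorem IsInduced.eq {δ : Direction} {z : Torus (N + 1) p q} {S : Signs (N + 1) p q}
    {Ss : Signs N p q} (hS : IsInduced δ z S Ss) (x y : State N p q) (r : Rectangle N p q)
    (h : r.IsFromTo x y) : Ss x y r = S (liftState (blockCorner δ z) x).1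
      (liftState (blockCorner δ z) y).1 (liftRect (blockCorner δ z) r) :=
  hS x y _ _ r _ h (liftRect_isFromTo.2 h) rfl rfl liftRect_mult

end InducedSigns

/-! ### The resolved diagrams -/

section Resolutions

theorem contract_cast_eq_zero_iff {N : ℕ} [NeZero N] {m : ℤ} :
    ((contract N m : ℤ) : ZMod N) = 0 ↔ (m : ZMod (N + 1)) = 0 ∨ (m : ZMod (N + 1)) = 1 := by
  have h1 : (m : ZMod (N + 1)) = 1 ↔ (((N + 1 : ℕ) : ℤ)) ∣ m - 1 := by
    rw [← ZMod.intCast_zmod_eq_zero_iff_dvd]; push_cast; rw [sub_eq_zero]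
  rw [h1, ZMod.intCast_zmod_eq_zero_iff_dvd, ZMod.intCast_zmod_eq_zero_iff_dvd]
  push_cast
  constructor
  · rintro ⟨t, ht⟩
    have : contract N (m + -t * (N + 1)) = 0 := by rw [contract_add_mul, ht]; ring
    rcases contract_eq_zero_iff.1 this with h | h
    · exact Or.inl ⟨t, by linear_combination h⟩
    · exact Or.inr ⟨t, by linear_combination h⟩
  · rintro (⟨t, ht⟩ | ⟨t, ht⟩)
    · refine ⟨t, ?_⟩
      rw [show m = 0 + t * (N + 1) by linear_combination ht, contract_add_mul, contract_zero]; ring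
    · refine ⟨t, ?_⟩
      rw [show m = 1 + t * (N + 1) by linear_combination ht, contract_add_mul, contract_one]; ring

theorem row_merge_eq_zero_iff {N p : ℕ} {q : ℤ} [NeZero N] {v : Torus (N + 1) p q} :
    row (merge v) = 0 ↔ row v = 0 ∨ row v = 1 := by
  obtain ⟨a, b, rfl⟩ := exists_pt v
  rw [merge_pt, row_pt, row_pt, contract_cast_eq_zero_iff]

theorem col_merge_eq_zero_iff {N p : ℕ} {q : ℤ} [NeZero N] {v : Torus (N + 1) p q} :
    col (merge v) = 0 ↔ col v = 0 ∨ col v = 1 := by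
  obtain ⟨a, b, rfl⟩ := exists_pt v
  rw [merge_pt, col_pt, col_pt, contract_cast_eq_zero_iff]

/-- The condition on the rows or columns `ℓ` of a grid diagram, separately from the other
conditions, so that rows and columns can be treated alike. -/
def IsBalanced {T ι β : Type*} (O : ι → T) (X XX : Set T) (ℓ : T → β) : Prop :=
  ∀ r : β, ({i | ℓ (O i) = r}.ncard = 1 ∧ {x ∈ X | ℓ x = r}.ncard = 1 ∧
      {x ∈ XX | ℓ x = r}.ncard = 0) ∨
    ({i | ℓ (O i) = r}.ncard = 2 ∧ {x ∈ X | ℓ x = r}.ncard = 0 ∧ {x ∈ XX | ℓ x = r}.ncard = 1)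

section Balanced

variable {T ι β : Type*} {O : ι → T} {X XX : Set T} {ℓ : T → β}

theorem IsBalanced.of_forall_notMem (h : IsBalanced O X XX ℓ) {r : β} (hr : ∀ x ∈ XX, ℓ x ≠ r) :
    {i | ℓ (O i) = r}.ncard = 1 ∧ ∃ x ∈ X, ℓ x = r := by
  rcases h r with ⟨h1, h2, -⟩ | ⟨-, -, h3⟩
  · obtain ⟨x, hx⟩ := Set.ncard_eq_one.1 h2
    have : x ∈ {x ∈ X | ℓ x = r} := by rw [hx]; rfl
    exact ⟨h1, x, this⟩
  · obtain ⟨x, hx⟩ := Set.ncard_eq_one.1 h3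
    have : x ∈ {x ∈ XX | ℓ x = r} := by rw [hx]; rfl
    exact absurd this.2 (hr x this.1)

variable [Finite T]

theorem IsBalanced.of_mem_X (h : IsBalanced O X XX ℓ) {d : T} (hd : d ∈ X) :
    {i | ℓ (O i) = ℓ d}.ncard = 1 ∧ (∀ x ∈ X, ℓ x = ℓ d → x = d) ∧ ∀ x ∈ XX, ℓ x ≠ ℓ d := by
  rcases h (ℓ d) with ⟨h1, h2, h3⟩ | ⟨-, h2, -⟩
  · refine ⟨h1, fun x hx e => ?_, fun x hx e => ?_⟩
    · obtain ⟨y, hy⟩ := Set.ncard_eq_one.1 h2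
      have e1 : x ∈ {x ∈ X | ℓ x = ℓ d} := ⟨hx, e⟩
      have e2 : d ∈ {x ∈ X | ℓ x = ℓ d} := ⟨hd, rfl⟩
      rw [hy] at e1 e2
      exact e1.trans e2.symm
    · rw [Set.ncard_eq_zero (Set.toFinite _)] at h3
      exact (Set.ext_iff.1 h3 x).1 ⟨hx, e⟩
  · rw [Set.ncard_eq_zero (Set.toFinite _)] at h2
    exact ((Set.ext_iff.1 h2 d).1 ⟨hd, rfl⟩).elim

theorem IsBalanced.of_mem_XX (h : IsBalanced O X XX ℓ) {d : T} (hd : d ∈ XX) :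
    {i | ℓ (O i) = ℓ d}.ncard = 2 := by
  rcases h (ℓ d) with ⟨-, -, h3⟩ | ⟨h1, -, -⟩
  · rw [Set.ncard_eq_zero (Set.toFinite _)] at h3
    exact ((Set.ext_iff.1 h3 d).1 ⟨hd, rfl⟩).elim
  · exact h1

/-- Two `X`s in different lines may be moved along their lines. -/
theorem IsBalanced.replace (h : IsBalanced O X XX ℓ) {d₁ d₂ e₁ e₂ : T} (h₁ : d₁ ∈ X) (h₂ : d₂ ∈ X)
    (hne : ℓ d₁ ≠ ℓ d₂) (he₁ : ℓ e₁ = ℓ d₁) (he₂ : ℓ e₂ = ℓ d₂) :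
    IsBalanced O ((X \ {d₁, d₂}) ∪ {e₁, e₂}) XX ℓ := by
  intro r
  have key : {x ∈ (X \ {d₁, d₂}) ∪ {e₁, e₂} | ℓ x = r}.ncard = {x ∈ X | ℓ x = r}.ncard := by
    obtain ⟨-, u₁, -⟩ := h.of_mem_X h₁
    obtain ⟨-, u₂, -⟩ := h.of_mem_X h₂
    have single : ∀ d e : T, d ∈ X → (∀ x ∈ X, ℓ x = ℓ d → x = d) → ℓ e = ℓ d →
        e ∈ ({e₁, e₂} : Set T) → d ∈ ({d₁, d₂} : Set T) →
        (∀ x ∈ ({e₁, e₂} : Set T), ℓ x = ℓ d → x = e) →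
        {x ∈ (X \ {d₁, d₂}) ∪ {e₁, e₂} | ℓ x = ℓ d}.ncard = {x ∈ X | ℓ x = ℓ d}.ncard := by
      intro d e hd hu he hm hdm hue
      rw [show {x ∈ (X \ {d₁, d₂}) ∪ {e₁, e₂} | ℓ x = ℓ d} = {e} from ?_,
        show {x ∈ X | ℓ x = ℓ d} = {d} from ?_, Set.ncard_singleton, Set.ncard_singleton]
      · ext x
        exact ⟨fun hx => hu x hx.1 hx.2, fun hx => by rw [hx]; exact ⟨hd, rfl⟩⟩
      · ext x
        refine ⟨fun hx => ?_, fun hx => by rw [hx]; exact ⟨Or.inr hm, he⟩⟩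
        rcases hx.1 with h' | h'
        · exact absurd (hu x h'.1 hx.2 ▸ hdm) h'.2
        · exact hue x h' hx.2
    by_cases r₁ : r = ℓ d₁
    · subst r₁
      refine single d₁ e₁ h₁ u₁ he₁ (Or.inl rfl) (Or.inl rfl) ?_
      rintro x (rfl | rfl) hx
      · rfl
      · exact absurd (hx.symm.trans he₂) hne
    by_cases r₂ : r = ℓ d₂
    · subst r₂
      refine single d₂ e₂ h₂ u₂ he₂ (Or.inr rfl) (Or.inr rfl) ?_
      rintro x (rfl | rfl) hx
      · exact absurd (he₁.symm.trans hx) hne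
      · rfl
    · congr 1
      ext x
      simp only [Set.mem_ofPred_eq, Set.mem_union, Set.mem_sdiff, Set.mem_insert_iff,
        Set.mem_singleton_iff]
      constructor
      · rintro ⟨hx | rfl | rfl, e⟩
        · exact ⟨hx.1, e⟩
        · exact absurd (e.symm.trans he₁) r₁
        · exact absurd (e.symm.trans he₂) r₂
      · rintro ⟨hx, e⟩
        refine ⟨Or.inl ⟨hx, ?_⟩, e⟩
        rintro (rfl | rfl)
        · exact r₁ e.symm
        · exact r₂ e.symm
  rw [key]
  exact h r

/-- The lines that become free when two `X`s are removed. -/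
theorem IsBalanced.free_iff (h : IsBalanced O X XX ℓ) {d₁ d₂ : T} (h₁ : d₁ ∈ X) (h₂ : d₂ ∈ X)
    (r : β) : (∀ v ∈ (X \ {d₁, d₂}) ∪ XX, ℓ v ≠ r) ↔ r = ℓ d₁ ∨ r = ℓ d₂ := by
  constructor
  · intro hr
    obtain ⟨-, x, hx, rfl⟩ := h.of_forall_notMem fun x hx => hr x (Or.inr hx)
    by_contra hc
    push Not at hc
    refine hr x (Or.inl ⟨hx, ?_⟩) rfl
    rintro (rfl | rfl)
    · exact hc.1 rfl
    · exact hc.2 rfl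
  · rintro (rfl | rfl) v (hv | hv)
    · exact fun e => hv.2 (Or.inl ((h.of_mem_X h₁).2.1 v hv.1 e))
    · exact (h.of_mem_X h₁).2.2 v hv
    · exact fun e => hv.2 (Or.inr ((h.of_mem_X h₂).2.1 v hv.1 e))
    · exact (h.of_mem_X h₂).2.2 v hv

end Balanced

variable {N p : ℕ} {q : ℤ} {ι : Type*} {g : Markings (N + 1) p q ι}
  {δ : Direction} {z : Torus (N + 1) p q}

open Classical in
/-- The thin annuli that avoid the blocked cells after the removal of two `X`s lie in the two lines
of these `X`s, and each of them contains one `O`. -/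
theorem IsBalanced.sum_prod_cellWeight {M : ℕ} [NeZero M] [NeZero p] [Fintype ι]
    {R : Type*} [CommRing R] {O : ι → Torus M p q} {X XX : Set (Torus M p q)} {ℓ : Torus M p q → ZMod M}
    (h : IsBalanced O X XX ℓ) {d₁ d₂ : Torus M p q} (h₁ : d₁ ∈ X) (h₂ : d₂ ∈ X) {c d : ι}
    (hcd : c ≠ d) (hfree : ∀ i, (ℓ (O i) = ℓ d₁ ∨ ℓ (O i) = ℓ d₂) ↔ i = c ∨ i = d) :
    ∑ r : ZMod M, ∏ v : Torus M p q with ℓ v = r, cellWeight R O ((X \ {d₁, d₂}) ∪ XX) v =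
      (MvPolynomial.X c + MvPolynomial.X d : MvPolynomial ι R) := by
  rw [LensGrid.sum_prod_cellWeight ℓ, ← Finset.sum_pair hcd]
  · congr 1
    ext i
    simp only [Finset.mem_filter, Finset.mem_univ, true_and, h.free_iff h₁ h₂, hfree,
      Finset.mem_insert, Finset.mem_singleton]
  · exact fun r hr => (h.of_forall_notMem fun x hx => hr x (Or.inr hx)).1

theorem pt_zero {M : ℕ} : (pt 0 0 : Torus M p q) = 0 := rfl

theorem merge_crossing : merge (z - blockCorner δ z) = 0 := by
  cases δ
  · rw [blockCorner, show z - (z + pt (-1) (-1)) = pt 1 1 from ?_, merge_one]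
    rw [sub_eq_iff_eq_add, add_left_comm, pt_add]; simp [pt_zero]
  · rw [blockCorner, show z - (z + pt 0 (-1)) = pt 0 1 from ?_, merge_pt, contract_one,
      contract_zero]
    · rfl
    · rw [sub_eq_iff_eq_add, add_left_comm, pt_add]; simp [pt_zero]

theorem merge_opposite : merge (z + pt δ.step (-1) - blockCorner δ z) = 0 := by
  cases δ
  · rw [blockCorner, Direction.step, sub_self, merge_zero]
  · rw [blockCorner, Direction.step, show z + pt 1 (-1) - (z + pt 0 (-1)) = pt 1 0 from ?_,
      merge_pt, contract_one, contract_zero]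
    · rfl
    · rw [sub_eq_iff_eq_add, add_left_comm, pt_add]; simp

variable [NeZero N]

/-- The rows of the two `X`s of the standard picture are the two rows of the block. -/
theorem row_block (v : Torus (N + 1) p q) :
    (row v = row (z + pt 0 (-1)) ∨ row v = row (z + pt δ.step 0)) ↔
      row (merge (v - blockCorner δ z)) = 0 := by
  rw [row_merge_eq_zero_iff, map_sub, sub_eq_zero, sub_eq_iff_eq_add]
  cases δ <;> simp [blockCorner, Direction.step, row_pt]

theorem col_block (v : Torus (N + 1) p q) :
    (col v = col (z + pt 0 (-1)) ∨ col v = col (z + pt δ.step 0)) ↔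
      col (merge (v - blockCorner δ z)) = 0 := by
  rw [col_merge_eq_zero_iff, map_sub, sub_eq_zero, sub_eq_iff_eq_add]
  cases δ
  · simp [blockCorner, Direction.step, col_pt, or_comm]
  · simp [blockCorner, Direction.step, col_pt, add_comm]

theorem row_ne_row : row (z + pt 0 (-1)) ≠ row (z + pt δ.step 0) := by
  have : Fact (1 < N + 1) := ⟨by have := Nat.pos_of_ne_zero (NeZero.ne N); omega⟩
  rw [map_add, map_add, row_pt, row_pt]
  simp

theorem col_ne_col : col (z + pt 0 (-1)) ≠ col (z + pt δ.step 0) := by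
  have : Fact (1 < N + 1) := ⟨by have := Nat.pos_of_ne_zero (NeZero.ne N); omega⟩
  rw [map_add, map_add, col_pt, col_pt]
  cases δ <;> simp [Direction.step]

variable [NeZero p]

/-- The new cells of the two `X`s are free: they are merged with the cell of the double mark of the
singularization, so an `O` in one of them would share the cell with that mark, and an `XX` would lie
in the column of an `X`. -/
theorem isGridDiagram_smoothing (hg : g.IsGridDiagram) (hstd : g.IsStandardAt δ z)
    (hs : (g.singularization δ z).IsGridDiagram) : (g.smoothing δ z).IsGridDiagram := by
  have rows : IsBalanced g.O g.X g.XX row := hg.rows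
  have cols : IsBalanced g.O g.X g.XX col := hg.cols
  -- the cells of the block are merged with the cell of the new double mark
  have hO : ∀ i v, merge (v - blockCorner δ z) = 0 → g.O i ≠ v := by
    rintro i v h rfl
    exact hs.O_notMem i (Or.inr (Or.inl h))
  refine ⟨hg.O_injective, ?_, ?_, ?_, ?_⟩
  · rintro i ((h | h | h) | h)
    · exact hg.O_notMem i (Or.inl h.1)
    · exact hO i _ merge_crossing h
    · exact hO i _ merge_opposite h
    · exact hg.O_notMem i (Or.inr h)
  · rw [Set.disjoint_left]
    rintro v (h | rfl | rfl) hv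
    · exact Set.disjoint_left.1 hg.disjoint h.1 hv
    · exact (cols.of_mem_X hstd.1).2.2 _ hv (by rw [map_add, col_pt]; simp)
    · exact (cols.of_mem_X hstd.2).2.2 _ hv (by rw [map_add, map_add, col_pt, col_pt])
  · change IsBalanced g.O ((g.X \ {z + pt 0 (-1), z + pt δ.step 0}) ∪ {z, z + pt δ.step (-1)})
      g.XX row
    rw [Set.pair_comm z]
    exact rows.replace hstd.1 hstd.2 row_ne_row (by rw [map_add, map_add, row_pt, row_pt])
      (by rw [map_add, row_pt]; simp)
  · change IsBalanced g.O ((g.X \ {z + pt 0 (-1), z + pt δ.step 0}) ∪ {z, z + pt δ.step (-1)})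
      g.XX col
    exact cols.replace hstd.1 hstd.2 col_ne_col (by rw [map_add, col_pt]; simp)
      (by rw [map_add, map_add, col_pt, col_pt])

theorem eq_pair_of_ncard [Finite ι] {s : Set ι} (hs : s.ncard = 2) {c d : ι} (hcd : c ≠ d)
    (hc : c ∈ s) (hd : d ∈ s) (i : ι) : i ∈ s ↔ i = c ∨ i = d := by
  have : ({c, d} : Set ι) = s := by
    refine Set.eq_of_subset_of_ncard_le ?_ ?_
    · rintro x (rfl | rfl) <;> assumption
    · rw [hs, Set.ncard_pair hcd]
  rw [← this]; rfl

open MvPolynomial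

theorem sub_ne_zero_of_pair_ne {R : Type*} [CommRing R] [Nontrivial R] {a b c d : ι} (hab : a ≠ b)
    (hcd : c ≠ d) (hu : ({a, b} : Set ι) ≠ {c, d}) :
    (X a + X b - X c - X d : MvPolynomial ι R) ≠ 0 := by
  classical
  have hk : ∃ k, (k = a ∨ k = b) ∧ k ≠ c ∧ k ≠ d := by
    by_contra h
    push Not at h
    refine hu (Set.eq_of_subset_of_ncard_le ?_ ?_ (Set.toFinite _))
    · intro k hk
      by_contra hn
      exact hn (Or.inr (h k hk fun e => hn (Or.inl e)))
    · rw [Set.ncard_pair hab, Set.ncard_pair hcd]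
  obtain ⟨k, hk, hc, hd⟩ := hk
  intro h
  have := congrArg (eval fun i => if i = k then (1 : R) else 0) h
  simp only [map_sub, map_add, eval_X, map_zero, if_neg hc.symm, if_neg hd.symm] at this
  rcases hk with rfl | rfl
  · simp [hab.symm] at this
  · simp [hab] at this

theorem matMap_comp_self {K α : Type*} [CommRing K] [Fintype α] {m : α → α → K}
    (h : ∀ x z, ∑ y, m x y * m y z = 0) : matMap m ∘ₗ matMap m = 0 := by
  refine LinearMap.ext fun f => Finsupp.ext fun z => ?_
  rw [LinearMap.comp_apply, matMap_matMap_apply]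
  simp [h]

/-- The skein exact sequence over an integral domain. The signs enter through the sign rules in the
coefficient ring, which hold trivially in characteristic two. -/
theorem skeinExactSequence {R : Type*} [CommRing R] [IsDomain R] [Fintype ι]
    (hpq : IsCoprime (p : ℤ) q) (hg : g.IsGridDiagram) (hstd : g.IsStandardAt δ z)
    (hs : (g.singularization δ z).IsGridDiagram) {a b c d : ι} (hab : a ≠ b) (hcd : c ≠ d)
    (ha : col ((g.singularization δ z).O a) = 0) (hb : col ((g.singularization δ z).O b) = 0)
    (hc : row ((g.singularization δ z).O c) = 0) (hd : row ((g.singularization δ z).O d) = 0)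
    (hu : ({a, b} : Set ι) ≠ {c, d}) {S : Signs (N + 1) p q} {Ss : Signs N p q}
    (hS : SignLaw (signCoeff R ι S))
    (hind : ∀ x y r, r.IsFromTo x y → Ss x y r = S (liftState (blockCorner δ z) x).1
      (liftState (blockCorner δ z) y).1 (liftRect (blockCorner δ z) r)) :
    SkeinExactSequence R g δ z S Ss (X a + X b - X c - X d) := by
  classical
  have hN : 1 < N + 1 := by have := Nat.pos_of_ne_zero (NeZero.ne N); omega
  have hg' := isGridDiagram_smoothing hg hstd hs
  have rows : IsBalanced g.O g.X g.XX row := hg.rows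
  have cols : IsBalanced g.O g.X g.XX col := hg.cols
  set P : Torus (N + 1) p q := blockCorner δ z + pt 1 1 with hP
  -- the blocked cells, without the two `X`s of the block
  set Z : Set (Torus (N + 1) p q) := (g.X \ {z + pt 0 (-1), z + pt δ.step 0}) ∪ g.XX with hZ
  have hX : g.X ∪ g.XX = Z ∪ {z + pt 0 (-1), z + pt δ.step 0} := by
    rw [hZ, Set.union_right_comm, Set.sdiff_union_of_subset]
    rintro v (rfl | rfl)
    exacts [hstd.1, hstd.2]
  have hX' : (g.smoothing δ z).X ∪ (g.smoothing δ z).XX = Z ∪ {z, z + pt δ.step (-1)} :=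
    Set.union_right_comm _ _ _
  have hXs : (g.singularization δ z).X ∪ (g.singularization δ z).XX =
      insert 0 ((fun v => merge (v - blockCorner δ z)) '' Z) := by
    rw [hZ, Set.image_union]
    exact Set.union_insert
  have row_two : {i | row ((g.singularization δ z).O i) = 0}.ncard = 2 := by
    have := (show IsBalanced _ _ _ row from hs.rows).of_mem_XX (d := 0) (Or.inl rfl)
    rwa [map_zero] at this
  have col_two : {i | col ((g.singularization δ z).O i) = 0}.ncard = 2 := by
    have := (show IsBalanced _ _ _ col from hs.cols).of_mem_XX (d := 0) (Or.inl rfl)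
    rwa [map_zero] at this
  -- the thin annuli without blocked cells are the two rows and the two columns of the block
  have hu₀ : ∑ r : ZMod (N + 1), ∏ v : Torus (N + 1) p q with row v = r, cellWeight R g.O Z v -
      ∑ c : ZMod (N + 1), ∏ v : Torus (N + 1) p q with col v = c, cellWeight R g.O Z v =
        -(X a + X b - X c - X d) := by
    rw [hZ, rows.sum_prod_cellWeight hstd.1 hstd.2 hcd, cols.sum_prod_cellWeight hstd.1 hstd.2 hab]
    · ring
    · intro i
      rw [col_block]
      exact eq_pair_of_ncard col_two hab ha hb i
    · intro i
      rw [row_block]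
      exact eq_pair_of_ncard row_two hcd hc hd i
  -- the base ring is a domain, so the nonzero polynomial `X a + X b - X c - X d` is regular
  have reg : ∀ k : MvPolynomial ι R, (X a + X b - X c - X d) * k = 0 → k = 0 := fun k hk =>
    (mul_eq_zero.1 hk).resolve_left (sub_ne_zero_of_pair_ne hab hcd hu)
  have hm : ∀ x y, coeff (signCoeff R ι Ss) (cellWeight R (g.singularization δ z).O
      ((g.singularization δ z).X ∪ (g.singularization δ z).XX)) x y =
      coeff (signCoeff R ι S) (cellWeight R g.O Z) (liftState (blockCorner δ z) x).1
        (liftState (blockCorner δ z) y).1 := fun x y => by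
    rw [hXs]
    exact coeff_liftState hind g.O Z x y
  have sq : boundary R g S ∘ₗ boundary R g S = 0 := by
    rw [boundary_eq_matMap]
    exact matMap_comp_self (sum_coeff_mul_coeff_eq_zero hpq hN hS hg.exists_row hg.exists_col)
  have sq' : boundary R (g.smoothing δ z) S ∘ₗ boundary R (g.smoothing δ z) S = 0 := by
    rw [boundary_eq_matMap]
    exact matMap_comp_self (sum_coeff_mul_coeff_eq_zero hpq hN hS hg'.exists_row hg'.exists_col)
  have hO : (g.smoothing δ z).O = g.O := rfl
  refine ⟨sq, sq', ?_⟩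
  rw [boundary_eq_matMap g, boundary_eq_matMap (g.smoothing δ z),
    boundary_eq_matMap (g.singularization δ z), hO]
  -- the centre of the block is the lower left corner of the cell `z`, or of the cell to its right
  cases δ with
  | left =>
    have eP : P = z := by
      rw [hP, blockCorner, add_assoc, pt_add]; simp [pt_zero]
    obtain ⟨t₁, t₂⟩ := exactTriangle_of_point (Z₁ := g.X ∪ g.XX)
      (Z₂ := (g.smoothing .left z).X ∪ (g.smoothing .left z).XX) hpq hN hS P (by
        rw [hX, Set.pair_comm, eP, sub_eq_add_neg, sub_eq_add_neg]; rfl) (by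
        rw [hX', eP, sub_eq_add_neg]; rfl)
      hg.exists_row hg.exists_col hg'.exists_row hg'.exists_col (liftState (blockCorner .left z))
      hm hu₀ reg
    exact ⟨matMap_comp_self t₁, fun _ => t₂, nofun⟩
  | right =>
    have eP : P = z + pt 1 0 := by
      rw [hP, blockCorner, add_assoc, pt_add]; rfl
    obtain ⟨t₁, t₂⟩ := exactTriangle_of_point
      (Z₁ := (g.smoothing .right z).X ∪ (g.smoothing .right z).XX)
      (Z₂ := g.X ∪ g.XX) hpq hN hS P (by
        rw [hX', eP, add_sub_cancel_right, add_sub_assoc]; rfl) (by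
        rw [hX, Set.pair_comm, eP, add_sub_assoc]; rfl)
      hg'.exists_row hg'.exists_col hg.exists_row hg.exists_col (liftState (blockCorner .right z))
      hm hu₀ reg
    exact ⟨matMap_comp_self t₁, nofun, fun _ => t₂.rotate⟩

end Resolutions

end LensGrid

end

open LensGrid MvPolynomial in
theorem mainTheorem4 {N p : ℕ} [NeZero N] [NeZero p] {q : ℤ} (hpq : IsCoprime (p : ℤ) q)
    {ι : Type*} [Fintype ι] (g : Markings (N + 1) p q ι) (hg : g.IsGridDiagram)
    (dir : ι → Direction) (i j : ι) (z : Torus (N + 1) p q)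
    (hc : g.IsCrossing dir i j z) (hstd : g.IsStandardAt (dir j) z)
    (hs : (g.singularization (dir j) z).IsGridDiagram)
    (a b c d : ι) (hab : a ≠ b) (hcd : c ≠ d)
    (ha : col ((g.singularization (dir j) z).O a) = 0)
    (hb : col ((g.singularization (dir j) z).O b) = 0)
    (hc' : row ((g.singularization (dir j) z).O c) = 0)
    (hd : row ((g.singularization (dir j) z).O d) = 0)
    (hu : ({a, b} : Set ι) ≠ {c, d}) :
    (g.smoothing (dir j) z).IsGridDiagram ∧
    SkeinExactSequence (ZMod 2) g (dir j) z 1 1 (X a + X b - X c - X d) ∧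
    ∀ S : Signs (N + 1) p q, IsSignAssignment S →
      (∃ Ss : Signs N p q, IsSignAssignment Ss ∧ IsInduced (dir j) z S Ss) ∧
      ∀ Ss : Signs N p q, IsSignAssignment Ss → IsInduced (dir j) z S Ss →
        SkeinExactSequence ℤ g (dir j) z S Ss (X a + X b - X c - X d) := by
  refine ⟨isGridDiagram_smoothing hg hstd hs,
    skeinExactSequence hpq hg hstd hs hab hcd ha hb hc' hd hu signLaw_one (fun _ _ _ _ => rfl),
    fun S hS => ⟨⟨_, isSignAssignment_inducedSigns _ hS, isInduced_inducedSigns _ _ S⟩,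
      fun Ss _ hind => ?_⟩⟩
  exact skeinExactSequence hpq hg hstd hs hab hcd ha hb hc' hd hu hS.signLaw hind.eq
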